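/- **Theorem 3.9.** Let $\kappa$ be an uncountable cardinal with $\kappa^{<\kappa}=\kappa$, and suppose that $\kappa$ is $\Pi^1_2$-indescribable: whenever $A\subseteq V_\kappa$ and $\sigma$ is a sentence $\forall X_1\cdots\forall X_k\,\exists Y_1\cdots\exists Y_l\,\psi$, with $\psi$ first order and the second order variables $X_i,Y_j$ ranging over subsets of the domain, such that $(V_\kappa,\in,A)\models\sigma$, there is $\alpha<\kappa$ with $(V_\alpha,\in,A\cap V_\alpha)\models\sigma$. Then the isomorphism relation $\cong_{\mathrm{DLO}}$ on $\kappa^\kappa$ is $\Sigma^1_1$-complete. Here $\kappa^\kappa$ carries the bounded topology, with basic open sets $[\zeta]=\{\eta\in\kappa^\kappa:\zeta\subset\eta\}$, $\zeta\in\kappa^{<\kappa}$, and $2^\kappa\subset\kappa^\kappa$ carries the subspace topology. For $X\in\{\kappa^\kappa,2^\kappa\}$, the Borel subsets of $X$ form the smallest collection that contains the basic open sets and is closed under unions and intersections of length $\kappa$. A function between such spaces is Borel if preimages of open sets are Borel. An equivalence relation $E$ on $X$ is Borel reducible to an equivalence relation $E'$ on $X'\in\{\kappa^\kappa,2^\kappa\}$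 if there is a Borel function $f\colon X\to X'$ with $\eta\mathrel{E}\xi\Leftrightarrow f(\eta)\mathrel{E'}f(\xi)$ for all $\eta,\xi\in X$. An equivalence relation on $X$ is $\Sigma^1_1$ if it is the projection of a closed subset of $X^2\times\kappa^\kappa$. It is $\Sigma^1_1$-complete if it is $\Sigma^1_1$ and every $\Sigma^1_1$ equivalence relation on $\kappa^\kappa$ or on $2^\kappa$ is Borel reducible to it. Fix a relational vocabulary $\mathcal L=\{P_m:m<\omega\}$, one of whose symbols is a binary symbol $<$, and a bijection $\pi\colon\kappa^{<\omega}\to\kappa$. For $\eta\in\kappa^\kappa$ let $\mathcal A_\eta$ be the $\mathcal L$-structure with universe $\kappa$ in which $P_m(a_1,\dots,a_n)$ holds if and only if $\eta(\pi(m,a_1,\dots,a_n))\ge 1$, where $n$ is the arity of $P_m$. Let $\mathrm{DLO}$ be the $\mathcal L$-theory that says that $<$ is a (strict) dense linear order without endpoints and that $P_m(\bar x)$ fails for all $\bar x$ whenever $P_m$ is not $<$. Then $\eta\cong_{\mathrm{DLO}}\xi$ means that either $\mathcal A_\eta$ and $\mathcal A_\xi$ are isomorphic models of $\mathrm{DLO}$,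 or neither $\mathcal A_\eta$ nor $\mathcal A_\xi$ is a model of $\mathrm{DLO}$. -/

import Mathlib

open scoped FirstOrder Cardinal ZFSet

universe u

namespace GDST

/-! ### Second order logic over the von Neumann hierarchy -/

/-- The relation symbols of the vocabulary consisting of `∈`, of one predicate for a fixed
parameter, and of `k + l` further predicates, which play the role of second order variables. -/
inductive SetRel (k l : ℕ) : ℕ → Type
  | mem : SetRel k l 2
  | param : SetRel k l 1
  | allVar (i : Fin k) : SetRel k l 1
  | exVar (j : Fin l) : SetRel k l 1

/-- The vocabulary with the relation symbols `SetRel k l` and no function symbols. -/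
abbrev setLang (k l : ℕ) : FirstOrder.Language.{0, 0} where
  Functions _ := Empty
  Relations := SetRel k l

/-- The underlying set of the structure `V_α`. -/
abbrev VSet (α : Ordinal.{u}) : Type (u + 1) := {x : ZFSet.{u} // x ∈ V_ α}

/-- The structure `(V_α, ∈, A ∩ V_α, X₁, …, X_k, Y₁, …, Y_l)`. -/
abbrev vStructure (α : Ordinal.{u}) (A : Set ZFSet.{u}) {k l : ℕ}
    (X : Fin k → Set (VSet α)) (Y : Fin l → Set (VSet α)) :
    (setLang k l).Structure (VSet α) where
  funMap f := f.elim
  RelMap r := match r with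
    | .mem => fun v => (v 0).1 ∈ (v 1).1
    | .param => fun v => (v 0).1 ∈ A
    | .allVar i => fun v => v 0 ∈ X i
    | .exVar j => fun v => v 0 ∈ Y j

/-- The `Π¹₂` sentence `∀ X₁ … X_k ∃ Y₁ … Y_l ψ`, with `ψ` first order and the second order
variables ranging over the subsets of `V_α`, holds in `(V_α, ∈, A ∩ V_α)`. -/
def SatPi12 (α : Ordinal.{u}) (A : Set ZFSet.{u}) {k l : ℕ} (ψ : (setLang k l).Sentence) : Prop :=
  ∀ X : Fin k → Set (VSet α), ∃ Y : Fin l → Set (VSet α),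
    @FirstOrder.Language.Sentence.Realize (setLang k l) (VSet α) (vStructure α A X Y) ψ

/-- `κ` is `Π¹₂`-indescribable: every `Π¹₂` sentence that holds in `(V_κ, ∈, A)`, where `A ⊆ V_κ`,
holds in `(V_α, ∈, A ∩ V_α)` for some `α < κ`. -/
def IsPi12Indescribable (κ : Cardinal.{u}) : Prop :=
  ∀ A : Set ZFSet.{u}, (∀ x ∈ A, x ∈ V_ κ.ord) →
    ∀ (k l : ℕ) (ψ : (setLang k l).Sentence), SatPi12 κ.ord A ψ →
      ∃ α < κ.ord, SatPi12 α A ψ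

/-! ### The generalized Baire and Cantor spaces -/

/-- The set `l ^ κ` of all functions from `κ` to the ordinal `l`. The generalized Baire space is
the case `l = κ`, and the generalized Cantor space is the case `l = 2`. -/
def GenSpace (κ : Cardinal.{u}) (l : Ordinal.{u}) : Type (u + 1) :=
  Set.Iio κ.ord → Set.Iio l

/-- The generalized Baire space. -/
abbrev Baire (κ : Cardinal.{u}) : Type (u + 1) := GenSpace κ κ.ord

/-- The basic open set `[ζ ↾ α]` of all functions that extend `ζ ↾ α`, where `α < κ`. -/
def cyl {κ : Cardinal.{u}} {l : Ordinal.{u}} (ζ : GenSpace κ l) (α : Set.Iio κ.ord) :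
    Set (GenSpace κ l) :=
  {η | ∀ β < α, η β = ζ β}

/-- The bounded topology. -/
instance (κ : Cardinal.{u}) (l : Ordinal.{u}) : TopologicalSpace (GenSpace κ l) :=
  TopologicalSpace.generateFrom {U | ∃ ζ α, U = cyl ζ α}

/-- The `κ`-Borel sets: the smallest collection that contains the basic open sets and is closed
under unions and intersections of length `κ`. -/
inductive IsKBorel {κ : Cardinal.{u}} {l : Ordinal.{u}} : Set (GenSpace κ l) → Prop
  | basic (ζ : GenSpace κ l) (α : Set.Iio κ.ord) : IsKBorel (cyl ζ α)
  | iUnion (A : Set.Iio κ.ord → Set (GenSpace κ l)) (h : ∀ i, IsKBorel (A i)) :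
      IsKBorel (⋃ i, A i)
  | iInter (A : Set.Iio κ.ord → Set (GenSpace κ l)) (h : ∀ i, IsKBorel (A i)) :
      IsKBorel (⋂ i, A i)

/-- `E₁` is (`κ`-)Borel reducible to `E₂`. -/
def BorelReducible {κ : Cardinal.{u}} {l₁ l₂ : Ordinal.{u}}
    (E₁ : GenSpace κ l₁ → GenSpace κ l₁ → Prop) (E₂ : GenSpace κ l₂ → GenSpace κ l₂ → Prop) :
    Prop :=
  ∃ f : GenSpace κ l₁ → GenSpace κ l₂,
    (∀ U : Set (GenSpace κ l₂), IsOpen U → IsKBorel (f ⁻¹' U)) ∧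
      ∀ η ξ, E₁ η ξ ↔ E₂ (f η) (f ξ)

/-- `E` is a `Σ¹₁` equivalence relation on `X = l ^ κ`: an equivalence relation that is the
projection of a closed subset of `X × X × κ ^ κ`. -/
structure IsSigma11Equiv {κ : Cardinal.{u}} {l : Ordinal.{u}}
    (E : GenSpace κ l → GenSpace κ l → Prop) : Prop where
  equivalence : Equivalence E
  projection : ∃ C : Set (GenSpace κ l × GenSpace κ l × Baire κ), IsClosed C ∧
    ∀ η ξ, E η ξ ↔ ∃ θ : Baire κ, (η, ξ, θ) ∈ C

/-- `E` is `Σ¹₁`-complete: it is a `Σ¹₁` equivalence relation, and every `Σ¹₁` equivalence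
relation, on the generalized Baire space or on the generalized Cantor space, is Borel reducible
to it. -/
structure IsSigma11Complete {κ : Cardinal.{u}} {l : Ordinal.{u}}
    (E : GenSpace κ l → GenSpace κ l → Prop) : Prop where
  sigma11 : IsSigma11Equiv E
  hard : ∀ l' : Ordinal.{u}, l' = 2 ∨ l' = κ.ord →
    ∀ E' : GenSpace κ l' → GenSpace κ l' → Prop, IsSigma11Equiv E' → BorelReducible E' E

/-! ### Coding of structures with universe `κ` -/

/-- The countable relational vocabulary `{P_m | m < ω}`, where `P_m` has arity `ar m`. -/
abbrev relLang (ar : ℕ → ℕ) : FirstOrder.Language.{0, 0} where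
  Functions _ := Empty
  Relations n := {m : ℕ // ar m = n}

/-- The natural number `m` as an element of the uncountable cardinal `κ`. -/
def natElt {κ : Cardinal.{u}} (hκ : ℵ₀ < κ) (m : ℕ) : Set.Iio κ.ord :=
  ⟨(m : Ordinal.{u}), Cardinal.lt_ord.2 (by
    rw [Ordinal.card_nat]; exact (Cardinal.natCast_lt_aleph0).trans hκ)⟩

/-- The universe of the structure coded by `η`; it is always `κ`. -/
def CodedModel {κ : Cardinal.{u}} (_ : ℵ₀ < κ) (_ : ℕ → ℕ)
    (_ : List (Set.Iio κ.ord) ≃ Set.Iio κ.ord) (_ : Baire κ) : Type (u + 1) :=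
  Set.Iio κ.ord

/-- The structure coded by `η`: `P_m (a₁, …, a_n)` holds iff `η (π (m, a₁, …, a_n)) ≥ 1`. -/
instance {κ : Cardinal.{u}} (hκ : ℵ₀ < κ) (ar : ℕ → ℕ)
    (π : List (Set.Iio κ.ord) ≃ Set.Iio κ.ord) (η : Baire κ) :
    (relLang ar).Structure (CodedModel hκ ar π η) where
  funMap f := f.elim
  RelMap P a := (1 : Ordinal.{u}) ≤ (η (π (natElt hκ P.1 :: List.ofFn a))).1

/-- The isomorphism relation `≅_T` on the generalized Baire space. -/
def IsoRel {κ : Cardinal.{u}} (hκ : ℵ₀ < κ) (ar : ℕ → ℕ)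
    (π : List (Set.Iio κ.ord) ≃ Set.Iio κ.ord) (T : (relLang ar).Theory) (η ξ : Baire κ) : Prop :=
  (CodedModel hκ ar π η ⊨ T ∧ CodedModel hκ ar π ξ ⊨ T ∧
      Nonempty (CodedModel hκ ar π η ≃[relLang ar] CodedModel hκ ar π ξ)) ∨
    (¬ CodedModel hκ ar π η ⊨ T ∧ ¬ CodedModel hκ ar π ξ ⊨ T)

/-! ### Dense linear orders without endpoints -/

open FirstOrder FirstOrder.Language in
/-- The axioms of strict dense linear orders without endpoints, for a binary symbol `r`. -/
def dloAxioms {L : FirstOrder.Language.{0, 0}} (r : L.Relations 2) : L.Theory :=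
  {r.irreflexive, r.transitive,
    ∀' ∀' (r.boundedFormula₂ (&0) &1 ⊔ (Term.bdEqual (&0) &1 ⊔ r.boundedFormula₂ (&1) &0)),
    ∀' ∀' (r.boundedFormula₂ (&0) &1 ⟹
      ∃' (r.boundedFormula₂ (&0) &2 ⊓ r.boundedFormula₂ (&2) &1)),
    ∀' ∃' (r.boundedFormula₂ (&0) &1),
    ∀' ∃' (r.boundedFormula₂ (&1) &0)}

open FirstOrder FirstOrder.Language in
/-- The theory `DLO` of dense linear orders without endpoints in the vocabulary `{P_m | m < ω}`,
the order being the binary symbol `P_s`: the axioms for `P_s`, together with the axioms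
`∀ x₁ … x_n, ¬ P_m (x₁, …, x_n)` for all `m ≠ s`. -/
def DLO (ar : ℕ → ℕ) (s : ℕ) (hs : ar s = 2) : (relLang ar).Theory :=
  dloAxioms (L := relLang ar) ⟨s, hs⟩ ∪
    {φ | ∃ m, m ≠ s ∧ φ = BoundedFormula.alls (∼(Relations.boundedFormula
      (L := relLang ar) (α := Empty) (n := ar m) (l := ar m) ⟨m, rfl⟩ (fun i => &i)))}

end GDST

/-! Membership in `Σ¹₁` is direct. An isomorphism is a bijection of κ, hence a point of κ^κ. Being a
model of `DLO` and preserving the order are obtained from clopen conditions by quantifiers over sets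
of size at most κ, and projections of closed sets are closed under such quantifiers
(`isoRel_sigma11`).

Hardness passes through equality modulo the club filter, where f and g in κ^κ are identified if they
agree on a closed unbounded set of δ < κ.

From a `Σ¹₁` relation E to this relation (`exists_reduction_club`): let E be the projection of a
closed set C. Bounded pieces of the points of C are coded in a parameter A ⊆ V_κ, and E has a local
version `LocalRel` on the subsets of each V_δ. Let F(η)(δ) code the local class of η at δ, with a
constant default if the local relation is not symmetric and transitive. If E relates η and ξ through
the witness θ, then the restrictions of θ are local witnesses at a club of δ. If E does not relate
them, then for any club it is a `Π¹₂` statement over V_κ that the relation is symmetric and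
transitive, that ξ is related to itself but not to η, and that the club is unbounded. Reflecting it
gives a point α of the club at which F(η) and F(ξ) differ.

From equality modulo club to dense orders (`exists_dense_orders`): f is sent to the sum over δ < κ
of a reversed ω_(f(δ)+1) followed by a fixed order A, with every point then replaced by a copy of ℚ.
An isomorphism respects the cut at a club of limit ordinals δ, and the coinitiality of the final
segment there determines f(δ) (`DenseSum.agree_of_orderIso`). Conversely, A is chosen so large that
it absorbs every sum over an interval with a greatest element. A sum over a closed interval then
depends only on the colour of its left end (`blockSum_Icc`), and cutting κ along a club yields an
isomorphism as soon as the colours agree at the left ends (`blockSum_congr_of_agree`).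

The universe has size κ only if ℵ_(c+1) ≤ κ for every c < κ. This holds because κ is regular, by
König's theorem, and a limit cardinal, by another reflection argument
(`IsPi12Indescribable.succ_lt`). The composed reduction is continuous, and open sets are Borel
because κ^{<κ} = κ. -/

namespace GDST

/-! ### Sums of linear orders -/

section LinearOrders

open Set

universe v w

/-- Two linear orders with monotone maps to the same linear order and isomorphic fibres are
isomorphic. -/
theorem nonempty_orderIso_of_fibers {X : Type v} {Y : Type w} {E : Type*} [LinearOrder X]
    [LinearOrder Y] [LinearOrder E] {p : X → E} {q : Y → E} (hp : Monotone p) (hq : Monotone q)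
    (h : ∀ e, Nonempty ({x // p x = e} ≃o {y // q y = e})) : Nonempty (X ≃o Y) := by
  let φ := fun e => (h e).some
  let F : X → Y := fun x => (φ (p x) ⟨x, rfl⟩).1
  have hF : ∀ e x (hx : p x = e), F x = (φ e ⟨x, hx⟩).1 := by
    rintro _ x rfl; rfl
  have hqF : ∀ x, q (F x) = p x := fun x => (φ (p x) ⟨x, rfl⟩).2
  have hmono : StrictMono F := by
    intro x y hxy
    rcases (hp hxy.le).lt_or_eq with hlt | heq
    · by_contra hcon
      have := hq (not_lt.1 hcon)
      rw [hqF, hqF] at this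
      exact absurd hlt (not_lt.2 this)
    · rw [hF _ x heq, hF _ y rfl]
      exact (φ (p y)).lt_iff_lt.2 hxy
  refine ⟨hmono.orderIsoOfSurjective F fun y => ?_⟩
  refine ⟨((φ (q y)).symm ⟨y, rfl⟩).1, ?_⟩
  rw [hF (q y) _ ((φ (q y)).symm ⟨y, rfl⟩).2]
  simp

/-- Lindenbaum's theorem: if `X` is isomorphic to an initial segment of `Y` and `Y` to a final
segment of `X`, then `X` and `Y` are isomorphic. -/
theorem nonempty_orderIso_of_initial_of_final {X : Type v} {Y : Type w} [LinearOrder X]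
    [LinearOrder Y] {f : X → Y} {g : Y → X} (hf : StrictMono f) (hg : StrictMono g)
    (hfr : IsLowerSet (range f)) (hgr : IsUpperSet (range g)) : Nonempty (X ≃o Y) := by
  classical
  have hfl : ∀ s : LowerSet X, IsLowerSet (f '' s) := by
    rintro s _ y hy ⟨x, hx, rfl⟩
    obtain ⟨x', rfl⟩ := hfr hy ⟨x, rfl⟩
    exact ⟨x', s.lower (hf.le_iff_le.1 hy) hx, rfl⟩
  have hgl : ∀ s : LowerSet X, IsLowerSet (g '' (f '' s)ᶜ)ᶜ := by
    intro s
    rw [isLowerSet_compl]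
    rintro _ x hx ⟨y, hy, rfl⟩
    obtain ⟨y', rfl⟩ := hgr hx ⟨y, rfl⟩
    exact ⟨y', (isUpperSet_compl.2 (hfl s)) (hg.le_iff_le.1 hx) hy, rfl⟩
  -- As in the Cantor–Bernstein theorem: a fixed point s of this monotone map, given by
  -- Knaster–Tarski, allows f to be used on s and the inverse of g off s. Working with lower sets
  -- makes the combined map monotone.
  let T : LowerSet X →o LowerSet X :=
    { toFun := fun s => ⟨(g '' (f '' s)ᶜ)ᶜ, hgl s⟩
      monotone' := fun s t hst => by
        change (g '' (f '' s)ᶜ)ᶜ ⊆ (g '' (f '' t)ᶜ)ᶜ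
        exact compl_subset_compl.2 (image_mono (compl_subset_compl.2 (image_mono hst))) }
  obtain ⟨s, hs⟩ : ∃ s : LowerSet X, (s : Set X) = (g '' (f '' s)ᶜ)ᶜ := by
    refine ⟨T.lfp, ?_⟩
    conv_lhs => rw [← T.map_lfp]
    rfl
  have hout : ∀ x, x ∉ s → ∃ y, y ∉ f '' s ∧ g y = x := by
    intro x hx
    have : x ∉ (s : Set X) := hx
    rw [hs] at this
    obtain ⟨y, hy, rfl⟩ := not_not.1 this
    exact ⟨y, hy, rfl⟩
  have hin : ∀ y, y ∉ f '' s → g y ∉ s := by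
    intro y hy h
    have : g y ∈ (s : Set X) := h
    rw [hs] at this
    exact this ⟨y, hy, rfl⟩
  choose k hk1 hk2 using hout
  let F : X → Y := fun x => if hx : x ∈ s then f x else k x hx
  have hmono : StrictMono F := by
    intro x y hxy
    by_cases hx : x ∈ s <;> by_cases hy : y ∈ s
    · simpa [F, hx, hy] using hf hxy
    · simp only [F, dif_pos hx, dif_neg hy]
      by_contra hcon
      exact hk1 y hy (hfl s (not_lt.1 hcon) ⟨x, hx, rfl⟩)
    · exact absurd (s.lower hxy.le hy) hx
    · simp only [F, dif_neg hx, dif_neg hy]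
      rw [← hg.lt_iff_lt, hk2 x hx, hk2 y hy]
      exact hxy
  refine ⟨hmono.orderIsoOfSurjective F fun y => ?_⟩
  by_cases hy : y ∈ f '' s
  · obtain ⟨x, hx, rfl⟩ := hy
    exact ⟨x, dif_pos hx⟩
  · refine ⟨g y, ?_⟩
    simp only [F, dif_neg (hin y hy)]
    exact hg.injective (hk2 _ (hin y hy))

variable {I J : Type*} [LinearOrder I] [LinearOrder J]

theorem sigmaLex_lt {α : I → Type*} [∀ i, LinearOrder (α i)] {i j : I} {x : α i} {y : α j} :
    (toLex ⟨i, x⟩ : Σₗ i, α i) < toLex ⟨j, y⟩ ↔ i < j ∨ ∃ h : i = j, h ▸ x < y := by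
  rw [Sigma.Lex.lt_def]
  rfl

theorem sigmaLex_lt_same {α : I → Type*} [∀ i, LinearOrder (α i)] {i : I} {x y : α i} :
    (toLex ⟨i, x⟩ : Σₗ i, α i) < toLex ⟨i, y⟩ ↔ x < y := by
  simp [sigmaLex_lt]

theorem sigmaLex_fst_mono {α : I → Type*} [∀ i, LinearOrder (α i)] {x y : Σₗ i, α i}
    (h : x ≤ y) : (ofLex x).1 ≤ (ofLex y).1 :=
  not_lt.1 fun hlt => absurd (Sigma.Lex.lt_def.2 (.inl hlt)) (not_lt.2 h)

/-- Lexicographic sums of isomorphic orders over isomorphic orders are isomorphic. -/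
theorem sigmaLex_congr {α : I → Type*} {β : J → Type*} [∀ i, LinearOrder (α i)]
    [∀ j, LinearOrder (β j)] (e : I ≃o J) (h : ∀ i, Nonempty (α i ≃o β (e i))) :
    Nonempty ((Σₗ i, α i) ≃o Σₗ j, β j) := by
  let φ := fun i => (h i).some
  let F : (Σₗ i, α i) → Σₗ j, β j := fun x => toLex ⟨e (ofLex x).1, φ _ (ofLex x).2⟩
  have hF : StrictMono F := by
    rintro ⟨i, x⟩ ⟨j, y⟩ hxy
    rcases sigmaLex_lt.1 hxy with h | ⟨h, h'⟩
    · exact sigmaLex_lt.2 (.inl (e.lt_iff_lt.2 h))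
    · subst h
      exact sigmaLex_lt_same.2 ((φ i).lt_iff_lt.2 h')
  refine ⟨hF.orderIsoOfSurjective F ?_⟩
  rintro ⟨j, y⟩
  obtain ⟨i, rfl⟩ := e.surjective j
  obtain ⟨x, rfl⟩ := (φ i).surjective y
  exact ⟨toLex ⟨i, x⟩, rfl⟩

/-- The lexicographic sum over the union of a set and a set above it. -/
theorem sigmaLex_union {α : I → Type*} [∀ i, LinearOrder (α i)] {s t r : Set I} (hr : r = s ∪ t)
    (hst : ∀ i ∈ s, ∀ j ∈ t, i < j) :
    Nonempty ((Σₗ i : r, α i) ≃o (Σₗ i : s, α i) ⊕ₗ Σₗ i : t, α i) := by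
  subst hr
  let F : (Σₗ i : s, α i) ⊕ₗ (Σₗ i : t, α i) → Σₗ i : (s ∪ t : Set I), α i := fun x =>
    (ofLex x).elim (fun y => toLex ⟨⟨(ofLex y).1.1, .inl (ofLex y).1.2⟩, (ofLex y).2⟩)
      (fun y => toLex ⟨⟨(ofLex y).1.1, .inr (ofLex y).1.2⟩, (ofLex y).2⟩)
  have hF : StrictMono F := by
    rintro (⟨⟨i, hi⟩, x⟩ | ⟨⟨i, hi⟩, x⟩) (⟨⟨j, hj⟩, y⟩ | ⟨⟨j, hj⟩, y⟩) hxy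
    · rcases sigmaLex_lt.1 (Sum.Lex.inl_lt_inl_iff.1 hxy) with h | ⟨h, h'⟩
      · exact sigmaLex_lt.2 (.inl h)
      · obtain rfl := Subtype.mk.inj h
        exact sigmaLex_lt_same.2 h'
    · exact sigmaLex_lt.2 (.inl (hst i hi j hj))
    · exact absurd hxy Sum.Lex.not_inr_lt_inl
    · rcases sigmaLex_lt.1 (Sum.Lex.inr_lt_inr_iff.1 hxy) with h | ⟨h, h'⟩
      · exact sigmaLex_lt.2 (.inl h)
      · obtain rfl := Subtype.mk.inj h
        exact sigmaLex_lt_same.2 h'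
  refine ⟨(hF.orderIsoOfSurjective F ?_).symm⟩
  rintro ⟨⟨i, hi | hi⟩, x⟩
  · exact ⟨toLex (.inl (toLex ⟨⟨i, hi⟩, x⟩)), rfl⟩
  · exact ⟨toLex (.inr (toLex ⟨⟨i, hi⟩, x⟩)), rfl⟩

theorem sigmaLex_singleton {α : I → Type*} [∀ i, LinearOrder (α i)] (i : I) :
    Nonempty ((Σₗ j : ({i} : Set I), α j) ≃o α i) := by
  let F : α i → Σₗ j : ({i} : Set I), α j := fun x => toLex ⟨⟨i, rfl⟩, x⟩
  have hF : StrictMono F := fun x y hxy => sigmaLex_lt_same.2 hxy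
  refine ⟨(hF.orderIsoOfSurjective F ?_).symm⟩
  rintro ⟨⟨j, hj⟩, x⟩
  obtain rfl : j = i := hj
  exact ⟨x, rfl⟩

/-- The part of a lexicographic sum with indices in a given set. -/
theorem sigmaLex_restrict {α : I → Type*} [∀ i, LinearOrder (α i)] (s : Set I) :
    Nonempty ({x : Σₗ i, α i // (ofLex x).1 ∈ s} ≃o Σₗ i : s, α i) := by
  let F : (Σₗ i : s, α i) → {x : Σₗ i, α i // (ofLex x).1 ∈ s} := fun x =>
    ⟨toLex ⟨(ofLex x).1.1, (ofLex x).2⟩, (ofLex x).1.2⟩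
  have hF : StrictMono F := by
    rintro ⟨⟨i, hi⟩, x⟩ ⟨⟨j, hj⟩, y⟩ hxy
    rcases sigmaLex_lt.1 hxy with h | ⟨h, h'⟩
    · exact sigmaLex_lt.2 (.inl h)
    · obtain rfl := Subtype.mk.inj h
      exact sigmaLex_lt_same.2 h'
  refine ⟨(hF.orderIsoOfSurjective F ?_).symm⟩
  rintro ⟨⟨i, x⟩, hi⟩
  exact ⟨toLex ⟨⟨i, hi⟩, x⟩, rfl⟩

theorem sumLex_isEmpty {X Y : Type*} [LinearOrder X] [LinearOrder Y] [IsEmpty Y] :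
    Nonempty (X ⊕ₗ Y ≃o X) := by
  let F : X → X ⊕ₗ Y := fun x => toLex (.inl x)
  have hF : StrictMono F := fun x y hxy => Sum.Lex.inl_lt_inl_iff.2 hxy
  refine ⟨(hF.orderIsoOfSurjective F ?_).symm⟩
  rintro (x | y)
  · exact ⟨x, rfl⟩
  · exact isEmptyElim y

end LinearOrders


section LinearOrders

open Set

universe v w

/-! ### A linear order that is a sum of blocks and of copies of itself -/

/-- Finite sequences of elements of `J` followed by an element of the block of the last one. -/
inductive IterSum (J : Type v) (B : J → Type v) : Type v
  | base (j : J) (b : B j) : IterSum J B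
  | deep (j : J) (a : IterSum J B) : IterSum J B

namespace IterSum

variable {J : Type v} {B : J → Type v}

/-- An element of `IterSum J B` as a word. -/
def toList : IterSum J B → List (Σₗ j, WithTop (B j))
  | base j b => [toLex ⟨j, (b : WithTop (B j))⟩]
  -- The letter ⊤ marks the descent into the copy of the whole order that follows the block of j, so
  -- it lies above all elements of this block.
  | deep j a => toLex ⟨j, ⊤⟩ :: toList a

theorem toLex_mk_inj {α : J → Type v} {j : J} {x y : α j} :
    (toLex ⟨j, x⟩ : Σₗ j, α j) = toLex ⟨j, y⟩ ↔ x = y := by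
  constructor
  · intro h
    have : (⟨j, x⟩ : Σ j, α j) = ⟨j, y⟩ := h
    simpa using this
  · rintro rfl; rfl

theorem fst_eq_of_toLex_eq {α : J → Type v} {j k : J} {x : α j} {y : α k}
    (h : (toLex ⟨j, x⟩ : Σₗ j, α j) = toLex ⟨k, y⟩) : j = k :=
  congrArg (fun z : Σₗ j, α j => (ofLex z).1) h

theorem toList_injective : Function.Injective (toList (J := J) (B := B)) := by
  intro x
  induction x with
  | base j b =>
    rintro (⟨k, c⟩ | ⟨k, c⟩) h
    · have h1 := (List.cons.inj h).1
      obtain rfl := fst_eq_of_toLex_eq h1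
      rw [toLex_mk_inj, WithTop.coe_inj] at h1
      rw [h1]
    · have h1 := (List.cons.inj h).1
      obtain rfl := fst_eq_of_toLex_eq h1
      rw [toLex_mk_inj] at h1
      exact absurd h1 (WithTop.coe_ne_top)
  | deep j a ih =>
    rintro (⟨k, c⟩ | ⟨k, c⟩) h
    · have h1 := (List.cons.inj h).1
      obtain rfl := fst_eq_of_toLex_eq h1
      rw [toLex_mk_inj] at h1
      exact absurd h1.symm (WithTop.coe_ne_top)
    · have h1 := fst_eq_of_toLex_eq (List.cons.inj h).1
      subst h1
      rw [ih (List.cons.inj h).2]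

variable [LinearOrder J] [∀ j, LinearOrder (B j)]

/-- The lexicographic order of words. In a code exactly the last letter is not ⊤, so no code is a
proper prefix of another. -/
noncomputable instance : LinearOrder (IterSum J B) :=
  LinearOrder.lift' toList toList_injective

theorem lt_iff {x y : IterSum J B} : x < y ↔ x.toList < y.toList := Iff.rfl

/-- `IterSum J B` is the sum of the blocks `B j`, each followed by a copy of `IterSum J B`. -/
theorem nonempty_orderIso : Nonempty (IterSum J B ≃o Σₗ j, (B j ⊕ₗ IterSum J B)) := by
  let F : (Σₗ j, (B j ⊕ₗ IterSum J B)) → IterSum J B := fun x =>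
    (ofLex (ofLex x).2).elim (base (ofLex x).1) (deep (ofLex x).1)
  have hF : StrictMono F := by
    rintro ⟨j, x⟩ ⟨k, y⟩ hxy
    rcases sigmaLex_lt.1 hxy with h | ⟨h, h'⟩
    · rcases x with x | x <;> rcases y with y | y <;>
        exact lt_iff.2 (List.cons_lt_cons_iff.2 (.inl (sigmaLex_lt.2 (.inl h))))
    · subst h
      change x < y at h'
      rcases x with x | x <;> rcases y with y | y
      · exact lt_iff.2 (List.cons_lt_cons_iff.2 (.inl (sigmaLex_lt_same.2
          (WithTop.coe_lt_coe.2 (Sum.Lex.inl_lt_inl_iff.1 h')))))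
      · exact lt_iff.2 (List.cons_lt_cons_iff.2 (.inl (sigmaLex_lt_same.2
          (WithTop.coe_lt_top _))))
      · exact absurd h' Sum.Lex.not_inr_lt_inl
      · have h2 : x < y := Sum.Lex.inr_lt_inr_iff.1 h'
        exact lt_iff.2 (List.cons_lt_cons_iff.2 (.inr ⟨rfl, h2⟩))
  refine ⟨(hF.orderIsoOfSurjective F ?_).symm⟩
  rintro (⟨j, b⟩ | ⟨j, a⟩)
  · exact ⟨toLex ⟨j, toLex (.inl b)⟩, rfl⟩
  · exact ⟨toLex ⟨j, toLex (.inr a)⟩, rfl⟩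

end IterSum

/-! ### Absorption of intervals, and colourings that agree on a club -/

variable {C : Type w} (B : C → Type v) [∀ c, LinearOrder (B c)] (A : Type v) [LinearOrder A]

/-- The sum, over `i : I`, of the block of colour `f i` followed by a copy of `A`. -/
abbrev BlockSum {I : Type*} (f : I → C) := Σₗ i : I, (B (f i) ⊕ₗ A)

variable {B A} {J : Type*} [LinearOrder J] {col : J → C}

/-- If `A` is the sum of blocks followed by copies of `A`, then it absorbs on the right the final
segments of this sum. -/
theorem absorb_Ioi (hA : Nonempty (A ≃o BlockSum B A col)) (j : J) :
    Nonempty (A ≃o A ⊕ₗ BlockSum B A fun i : Ioi j => col i) := by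
  obtain ⟨φ⟩ := hA
  -- Lindenbaum's theorem applies: A is an initial segment of the right side, while the right side
  -- is the final segment of the block sum that starts with the copy of A just after the block of j.
  let f : A → A ⊕ₗ BlockSum B A fun i : Ioi j => col i := fun a => toLex (.inl a)
  let g₀ : (A ⊕ₗ BlockSum B A fun i : Ioi j => col i) → BlockSum B A col := fun x =>
    (ofLex x).elim (fun a => toLex ⟨j, toLex (.inr a)⟩)
      (fun y => toLex ⟨(ofLex y).1.1, (ofLex y).2⟩)
  have hg₀ : StrictMono g₀ := by
    rintro (x | ⟨⟨i, hi⟩, x⟩) (y | ⟨⟨k, hk⟩, y⟩) hxy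
    · exact sigmaLex_lt_same.2 (Sum.Lex.inr_lt_inr_iff.2 (Sum.Lex.inl_lt_inl_iff.1 hxy))
    · exact sigmaLex_lt.2 (.inl hk)
    · exact absurd hxy Sum.Lex.not_inr_lt_inl
    · rcases sigmaLex_lt.1 (Sum.Lex.inr_lt_inr_iff.1 hxy) with h | ⟨h, h'⟩
      · exact sigmaLex_lt.2 (.inl h)
      · obtain rfl := Subtype.mk.inj h
        exact sigmaLex_lt_same.2 h'
  have hg₀r : IsUpperSet (range g₀) := by
    rintro _ ⟨k, y⟩ hxy ⟨x, rfl⟩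
    rcases lt_or_ge j k with hjk | hjk
    · exact ⟨toLex (.inr (toLex ⟨⟨k, hjk⟩, y⟩)), rfl⟩
    · have hle := not_lt.2 hxy
      rcases x with a | ⟨⟨i, hi⟩, x⟩
      · rcases hjk.lt_or_eq with h | rfl
        · exact absurd (sigmaLex_lt.2 (.inl h)) hle
        · rcases y with b | a'
          · exact absurd (sigmaLex_lt_same.2 (Sum.Lex.inl_lt_inr _ _)) hle
          · exact ⟨toLex (.inl a'), rfl⟩
      · exact absurd (sigmaLex_lt.2 (.inl (lt_of_le_of_lt hjk hi))) hle
  refine nonempty_orderIso_of_initial_of_final (f := f) (g := φ.symm ∘ g₀)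
    (fun x y h => Sum.Lex.inl_lt_inl_iff.2 h) (φ.symm.strictMono.comp hg₀) ?_ ?_
  · rintro _ (y | y) hxy ⟨x, rfl⟩
    · exact ⟨y, rfl⟩
    · exact absurd hxy Sum.Lex.not_inr_le_inl
  · rw [range_comp]
    exact hg₀r.image φ.symm

/-- A word over `C` whose length is a closed initial segment of `K`. -/
structure WordOn (K : Type*) [LinearOrder K] (C : Type*) where
  /-- The last position. -/
  top : K
  /-- The letters. -/
  letter : Iic top → C

variable {K : Type*} [LinearOrder K] [LinearOrder (WordOn K C)]

/-- The concatenation of all words over `C` whose length is a closed initial segment of `K`. -/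
abbrev AllWords (K : Type*) [LinearOrder K] (C : Type*) := Σₗ w : WordOn K C, Iic w.top

/-- The colour of a position of a word. -/
def AllWords.color (j : AllWords K C) : C := (ofLex j).1.letter (ofLex j).2

/-- If `A` is the sum of blocks followed by copies of `A`, in the order given by all words, then
`A` absorbs the sum over any interval with a greatest element. -/
theorem absorb_Ioc (hA : Nonempty (A ≃o BlockSum B A (AllWords.color (K := K) (C := C))))
    (f : K → C) {e z : K} (hez : e ≤ z) :
    Nonempty (A ≃o A ⊕ₗ BlockSum B A fun i : Ioc e z => f i) := by
  rcases hez.eq_or_lt with rfl | hez'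
  · have : IsEmpty (BlockSum B A fun i : Ioc e e => f i) := by
      refine ⟨?_⟩
      rintro ⟨⟨i, hi⟩, x⟩
      exact absurd hi.1 (not_lt.2 hi.2)
    exact sumLex_isEmpty.map OrderIso.symm
  -- The colouring f up to z is one of the words concatenated in `AllWords`, so the interval (e, z]
  -- reappears there, with its colours, as the interval from `je` to `jz`.
  let w : WordOn K C := ⟨z, fun i => f i⟩
  let jz : AllWords K C := toLex ⟨w, ⟨z, le_refl z⟩⟩
  let je : AllWords K C := toLex ⟨w, ⟨e, hez⟩⟩
  have hlt : je < jz := sigmaLex_lt_same.2 hez'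
  obtain ⟨φe⟩ := absorb_Ioi hA je
  obtain ⟨φz⟩ := absorb_Ioi hA jz
  obtain ⟨σ⟩ := sigmaLex_union (α := fun j : AllWords K C => B j.color ⊕ₗ A)
    (s := Ioc je jz) (t := Ioi jz) (r := Ioi je) (Ioc_union_Ioi_eq_Ioi hlt.le).symm
    (fun i hi j hj => lt_of_le_of_lt hi.2 hj)
  let G : Ioc e z → Ioc je jz := fun i =>
    ⟨toLex ⟨w, ⟨i, i.2.2⟩⟩, sigmaLex_lt_same.2 i.2.1, not_lt.1 fun h =>
      absurd (sigmaLex_lt_same.1 h) (not_lt.2 i.2.2)⟩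
  have hG : StrictMono G := fun i j hij => sigmaLex_lt_same.2 hij
  have hGs : Function.Surjective G := by
    rintro ⟨⟨w', ⟨k, hk⟩⟩, h1, h2⟩
    have hw : w' = w := by
      rcases sigmaLex_lt.1 h1 with h | ⟨h, -⟩
      · exact absurd (sigmaLex_lt.2 (.inl h)) (not_lt.2 h2)
      · exact h.symm
    subst hw
    exact ⟨⟨k, sigmaLex_lt_same.1 h1, hk⟩, rfl⟩
  obtain ⟨γ⟩ := sigmaLex_congr (α := fun i : Ioc e z => B (f i) ⊕ₗ A)
    (β := fun j : Ioc je jz => B j.1.color ⊕ₗ A) (hG.orderIsoOfSurjective G hGs)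
    (fun i => ⟨OrderIso.refl _⟩)
  obtain ⟨τ⟩ := sigmaLex_union (α := fun i : K => B (f i) ⊕ₗ A)
    (s := Ioo e z) (t := {z}) (r := Ioc e z) (Ioo_union_right hez').symm
    (fun i hi j hj => by rw [mem_singleton_iff.1 hj]; exact hi.2)
  obtain ⟨ρ⟩ := sigmaLex_singleton (α := fun i : K => B (f i) ⊕ₗ A) z
  have τ' := τ.trans (OrderIso.sumLexCongr (OrderIso.refl _) ρ)
  have step1 := φe.trans (OrderIso.sumLexCongr (OrderIso.refl A)
    (σ.trans (OrderIso.sumLexCongr (γ.symm.trans τ') (OrderIso.refl _))))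
  -- By `step1`, A is A plus the sum over (e, z] plus the tail after `jz`. As z is the greatest
  -- element, the middle sum ends with a copy of A, and this copy absorbs the tail.
  have step2 := step1.trans (OrderIso.sumLexCongr (OrderIso.refl A)
    ((OrderIso.sumLexAssoc _ _ _).trans (OrderIso.sumLexCongr (OrderIso.refl _)
      ((OrderIso.sumLexAssoc _ _ _).trans (OrderIso.sumLexCongr (OrderIso.refl _) φz.symm)))))
  exact ⟨step2.trans (OrderIso.sumLexCongr (OrderIso.refl A) τ'.symm)⟩

/-- The sum over a closed interval only depends on the colour of its least element. -/
theorem blockSum_Icc (hA : Nonempty (A ≃o BlockSum B A (AllWords.color (K := K) (C := C))))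
    (f : K → C) {e z : K} (hez : e ≤ z) :
    Nonempty ((BlockSum B A fun i : Icc e z => f i) ≃o B (f e) ⊕ₗ A) := by
  obtain ⟨τ⟩ := sigmaLex_union (α := fun i : K => B (f i) ⊕ₗ A)
    (s := {e}) (t := Ioc e z) (r := Icc e z)
    (by rw [← Icc_self]; exact (Icc_union_Ioc_eq_Icc le_rfl hez).symm)
    (fun i hi j hj => by rw [mem_singleton_iff.1 hi]; exact hj.1)
  obtain ⟨ρ⟩ := sigmaLex_singleton (α := fun i : K => B (f i) ⊕ₗ A) e
  obtain ⟨φ⟩ := absorb_Ioc hA f hez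
  exact ⟨(τ.trans (OrderIso.sumLexCongr ρ (OrderIso.refl _))).trans
    ((OrderIso.sumLexAssoc _ _ _).trans (OrderIso.sumLexCongr (OrderIso.refl _) φ.symm))⟩

/-- Colourings that agree at all closure points of some function and at all successors give
isomorphic sums. -/
theorem blockSum_congr_of_agree [WellFoundedLT K] [NoMaxOrder K]
    (hA : Nonempty (A ≃o BlockSum B A (AllWords.color (K := K) (C := C))))
    {f g : K → C} {h : K → K} (hunb : ∀ β, ∃ δ > β, ∀ γ < δ, h γ < δ)
    (hfg : ∀ δ, (∀ γ < δ, h γ < δ) → f δ = g δ)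
    (hsucc : ∀ δ, (∃ γ < δ, ∀ β < δ, β ≤ γ) → f δ = g δ) :
    Nonempty (BlockSum B A f ≃o BlockSum B A g) := by
  classical
  let D : Set K := {δ | ∀ γ < δ, h γ < δ}
  have hne : ∀ β, ∃ δ, β ≤ δ ∧ δ ∈ D := fun β =>
    let ⟨δ, h1, h2⟩ := hunb β; ⟨δ, le_of_lt h1, h2⟩
  -- The least closure point that is at least β. Its nonempty fibres are closed intervals [e, d]
  -- with d a closure point, so the two sums can be compared fibre by fibre.
  let p : K → K := fun β => WellFounded.min wellFounded_lt {δ | β ≤ δ ∧ δ ∈ D} (hne β)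
  have hp : ∀ β, β ≤ p β ∧ p β ∈ D := fun β => WellFounded.min_mem wellFounded_lt _ (hne β)
  have hpmin : ∀ β δ, β ≤ δ → δ ∈ D → p β ≤ δ := fun β δ h1 h2 =>
    not_lt.1 (WellFounded.not_lt_min wellFounded_lt {δ | β ≤ δ ∧ δ ∈ D} ⟨h1, h2⟩)
  have hpm : Monotone p := fun β γ hβγ => hpmin _ _ (hβγ.trans (hp γ).1) (hp γ).2
  refine nonempty_orderIso_of_fibers (p := fun x => p (ofLex x).1) (q := fun x => p (ofLex x).1)
    (fun x y hxy => hpm (sigmaLex_fst_mono hxy)) (fun x y hxy => hpm (sigmaLex_fst_mono hxy))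
    fun d => ?_
  obtain ⟨φ⟩ := sigmaLex_restrict (α := fun i => B (f i) ⊕ₗ A) (p ⁻¹' {d})
  obtain ⟨ψ⟩ := sigmaLex_restrict (α := fun i => B (g i) ⊕ₗ A) (p ⁻¹' {d})
  suffices h : Nonempty ((BlockSum B A fun i : (p ⁻¹' {d} : Set K) => f i) ≃o
      BlockSum B A fun i : (p ⁻¹' {d} : Set K) => g i) by
    obtain ⟨χ⟩ := h
    exact ⟨(φ.trans χ).trans ψ.symm⟩
  rcases (p ⁻¹' {d}).eq_empty_or_nonempty with he | hne'
  · have : IsEmpty (p ⁻¹' {d} : Set K) := by rw [he]; infer_instance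
    exact sigmaLex_congr (OrderIso.refl _) fun i => isEmptyElim i
  obtain ⟨e, hed, hemin⟩ : ∃ e, p e = d ∧ ∀ β, p β = d → e ≤ β :=
    ⟨WellFounded.min wellFounded_lt _ hne', WellFounded.min_mem wellFounded_lt _ hne',
      fun β hβ => not_lt.1 (WellFounded.not_lt_min wellFounded_lt (p ⁻¹' {d}) hβ)⟩
  have hle : e ≤ d := hed ▸ (hp e).1
  have hdD : d ∈ D := hed ▸ (hp e).2
  have hfib : p ⁻¹' {d} = Icc e d := by
    ext β
    refine ⟨fun hβ => ⟨hemin β hβ, ?_⟩, fun hβ => ?_⟩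
    · have : p β = d := hβ
      exact this ▸ (hp β).1
    · exact le_antisymm (hpmin _ _ hβ.2 hdD) (hed ▸ hpm hβ.1)
  have hfe : f e = g e := by
    by_cases hs : ∃ γ < e, ∀ β < e, β ≤ γ
    · exact hsucc e hs
    · push Not at hs
      -- The left end e of a fibre is not a successor here. Then the closure points p β for β < e
      -- stay below e and are unbounded in it, so e is itself a closure point.
      refine hfg e fun γ hγ => ?_
      obtain ⟨β, hβe, hγβ⟩ := hs γ hγ
      have h1 : p β < e := by
        by_contra hcon
        have : p β = d := le_antisymm (hed ▸ hpm hβe.le) (hed ▸ hpmin _ _ (not_lt.1 hcon) (hp β).2)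
        exact absurd (hemin β this) (not_le.2 hβe)
      exact ((hp β).2 γ (hγβ.trans_le (hp β).1)).trans h1
  rw [hfib]
  obtain ⟨α⟩ := blockSum_Icc hA f hle
  obtain ⟨β⟩ := blockSum_Icc hA g hle
  rw [hfe] at α
  exact ⟨α.trans β.symm⟩

end LinearOrders


/-! ### Recovering the colours from coinitialities -/

section Coinitiality

open Set Ordinal

/-- The block of colour `c`: the initial ordinal `ω_ (c + 1)`, reversed. -/
abbrev Block (c : Ordinal.{u}) : Type (u + 1) := (Iio (ω_ (c + 1)))ᵒᵈ

variable {K : Type (u + 1)} [LinearOrder K] {A : Type (u + 1)} [LinearOrder A]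

/-- The dense linear order obtained from a sum of blocks. -/
abbrev DenseSum (A : Type (u + 1)) [LinearOrder A] (f : K → Ordinal.{u}) : Type (u + 1) :=
  BlockSum Block A f ×ₗ ℚ

/-- The index of the block that contains `x`. -/
def DenseSum.idx {f : K → Ordinal.{u}} (x : DenseSum A f) : K := (ofLex (ofLex x).1).1

theorem DenseSum.idx_mono {f : K → Ordinal.{u}} {x y : DenseSum A f} (h : x ≤ y) :
    x.idx ≤ y.idx := by
  refine sigmaLex_fst_mono ?_
  rcases Prod.Lex.le_iff.1 h with h | h
  · exact h.le
  · exact h.1.le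

theorem DenseSum.lt_of_idx_lt {f : K → Ordinal.{u}} {x y : DenseSum A f} (h : x.idx < y.idx) :
    x < y :=
  Prod.Lex.lt_iff.2 (.inl (Sigma.Lex.lt_def.2 (.inl h)))

/-- The point of the block with index `δ` given by `i < ω_ (f δ + 1)`. -/
def DenseSum.pt (f : K → Ordinal.{u}) (δ : K) (i : Iio (ω_ (f δ + 1))) : DenseSum A f :=
  toLex (toLex ⟨δ, toLex (.inl (OrderDual.toDual i))⟩, 0)

theorem zero_lt_omega_succ (c : Ordinal.{u}) : 0 < ω_ (c + 1) :=
  (Cardinal.isSuccLimit_omega _).bot_lt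

/-- The coinitiality of a final segment of a dense sum. -/
theorem DenseSum.cof_final (f : K → Ordinal.{u}) (δ : K) :
    Order.cof ({x : DenseSum A f // δ ≤ x.idx}ᵒᵈ) = Cardinal.lift.{u + 1} (ℵ_ (f δ + 1)) := by
  -- The points of the block of δ are coinitial in the final segment. Since the block is a reversed
  -- ω_(f δ + 1) and the index is a successor, the cardinal is regular and its cofinality is ℵ_(f δ
  -- + 1), from which f δ can be read off.
  let F : Iio (ω_ (f δ + 1)) → {x : DenseSum A f // δ ≤ x.idx}ᵒᵈ := fun i =>
    OrderDual.toDual ⟨DenseSum.pt f δ i, le_refl δ⟩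
  have hF : StrictMono F := by
    intro i j hij
    refine OrderDual.toDual_lt_toDual.2 ?_
    refine Prod.Lex.lt_iff.2 (.inl (sigmaLex_lt_same.2 (Sum.Lex.inl_lt_inl_iff.2 ?_)))
    exact OrderDual.toDual_lt_toDual.2 hij
  have hcof : IsCofinal (range F) := by
    intro x
    obtain ⟨⟨x, hx⟩, rfl⟩ := OrderDual.toDual.surjective x
    suffices h : ∃ i, DenseSum.pt f δ i < x by
      obtain ⟨i, hi⟩ := h
      exact ⟨F i, ⟨i, rfl⟩, OrderDual.toDual_le_toDual.2 hi.le⟩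
    rcases hx.lt_or_eq with hlt | heq
    · exact ⟨⟨0, zero_lt_omega_succ _⟩, DenseSum.lt_of_idx_lt hlt⟩
    · obtain ⟨⟨k, y⟩, q⟩ := x
      obtain rfl : δ = k := heq
      rcases y with y | a
      · obtain ⟨⟨i, hi⟩, rfl⟩ := OrderDual.toDual.surjective y
        have hi' : i + 1 < ω_ (f δ + 1) := by
          have := (Cardinal.isSuccLimit_omega (f δ + 1)).succ_lt hi
          rwa [Order.succ_eq_add_one] at this
        refine ⟨⟨i + 1, hi'⟩, Prod.Lex.lt_iff.2 (.inl (sigmaLex_lt_same.2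
          (Sum.Lex.inl_lt_inl_iff.2 (OrderDual.toDual_lt_toDual.2 ?_))))⟩
        exact Subtype.mk_lt_mk.2 (lt_add_one i)
      · exact ⟨⟨0, zero_lt_omega_succ _⟩, Prod.Lex.lt_iff.2 (.inl (sigmaLex_lt_same.2
          (Sum.Lex.inl_lt_inr _ _)))⟩
  rw [← Order.cof_congr_of_strictMono hF hcof, Ordinal.cof_Iio, ← Ordinal.lift_cof,
    Cardinal.cof_omega_add_one]

/-- Isomorphic dense sums have colourings that agree at the limit closure points of a function. -/
theorem DenseSum.agree_of_orderIso {f g : K → Ordinal.{u}} (φ : DenseSum A f ≃o DenseSum A g) :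
    ∃ h : K → K, ∀ δ, (∀ γ < δ, h γ < δ) → (∀ γ < δ, ∃ β < δ, γ < β) → f δ = g δ := by
  let pf : K → DenseSum A f := fun δ => DenseSum.pt f δ ⟨0, zero_lt_omega_succ _⟩
  let pg : K → DenseSum A g := fun δ => DenseSum.pt g δ ⟨0, zero_lt_omega_succ _⟩
  -- The function bounds how far φ and its inverse move one sample point of each block. At a limit δ
  -- closed under it, φ maps the points with index below δ onto the points with index below δ, and
  -- hence induces an isomorphism of the final segments.
  refine ⟨fun β => max (φ (pf β)).idx (φ.symm (pg β)).idx, fun δ hδ hlim => ?_⟩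
  have h1 : ∀ x : DenseSum A f, x.idx < δ → (φ x).idx < δ := by
    intro x hx
    obtain ⟨β, hβ, hxβ⟩ := hlim _ hx
    have hlt : x < pf β := DenseSum.lt_of_idx_lt hxβ
    exact (DenseSum.idx_mono (φ.lt_iff_lt.2 hlt).le).trans_lt
      ((le_max_left _ _).trans_lt (hδ β hβ))
  have h2 : ∀ x : DenseSum A g, x.idx < δ → (φ.symm x).idx < δ := by
    intro x hx
    obtain ⟨β, hβ, hxβ⟩ := hlim _ hx
    have hlt : x < pg β := DenseSum.lt_of_idx_lt hxβ
    exact (DenseSum.idx_mono (φ.symm.lt_iff_lt.2 hlt).le).trans_lt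
      ((le_max_right _ _).trans_lt (hδ β hβ))
  have h3 : ∀ x : DenseSum A f, δ ≤ x.idx ↔ δ ≤ (φ x).idx := by
    intro x
    rw [← not_lt, ← not_lt, not_iff_not]
    refine ⟨h1 x, fun h => ?_⟩
    have := h2 _ h
    rwa [φ.symm_apply_apply] at this
  let ψ : {x : DenseSum A f // δ ≤ x.idx} ≃o {x : DenseSum A g // δ ≤ x.idx} :=
    { φ.toEquiv.subtypeEquiv h3 with
      map_rel_iff' := fun {a b} => φ.le_iff_le }
  have h4 := ψ.dual.cof_congr
  rw [DenseSum.cof_final, DenseSum.cof_final, Cardinal.lift_inj] at h4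
  simpa using h4

end Coinitiality


/-! ### Arithmetic of the initial ordinal `κ` -/

section Arithmetic

open Set Ordinal

variable {κ : Cardinal.{u}}

theorem mk_Iio_ord (κ : Cardinal.{u}) : #(Iio κ.ord) = Cardinal.lift.{u + 1} κ := by
  rw [Cardinal.mk_Iio_ordinal, Cardinal.card_ord]

/-- By König's theorem κ < κ^cof(κ), which is impossible for cof(κ) < κ if κ^{<κ} = κ. -/
theorem isRegular_of_powerlt (hκ : ℵ₀ < κ) (hpow : κ ^< κ = κ) : κ.IsRegular := by
  refine ⟨hκ.le, ?_⟩
  by_contra hlt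
  have h1 := Cardinal.lt_power_cof_ord hκ.le
  have h2 := Cardinal.le_powerlt (b := κ) κ (c := κ.ord.cof) (not_le.1 hlt)
  rw [hpow] at h2
  exact absurd h1 (not_lt.2 h2)

theorem mk_Iio_lt_mk (a : Iio κ.ord) : #(Iio a) < #(Iio κ.ord) := by
  have h : #(Iio a) ≤ #(Iio a.1) := by
    refine Cardinal.mk_le_of_injective (f := fun x : Iio a => (⟨x.1.1, x.2⟩ : Iio a.1)) ?_
    intro x y hxy
    exact Subtype.ext (Subtype.ext (congrArg (fun z : Iio a.1 => z.1) hxy))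
  refine h.trans_lt ?_
  rw [mk_Iio_ord, Cardinal.mk_Iio_ordinal, Cardinal.lift_lt]
  exact Cardinal.lt_ord.1 a.2

theorem cof_Iio_ord (hreg : κ.IsRegular) : Order.cof (Iio κ.ord) = #(Iio κ.ord) := by
  rw [Ordinal.cof_Iio, ← Ordinal.lift_cof, hreg.cof_ord, mk_Iio_ord]

theorem exists_forall_lt (hreg : κ.IsRegular) {ι : Type*} {s : Set (Iio κ.ord)}
    (f : ι → Iio κ.ord) (hs : range f ⊆ s) (hι : #s < #(Iio κ.ord)) : ∃ b, ∀ i, f i < b := by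
  have h : ¬ IsCofinal s := fun h => by
    have := Order.cof_le h
    rw [cof_Iio_ord hreg] at this
    exact absurd hι (not_lt.2 this)
  unfold IsCofinal at h
  push Not at h
  obtain ⟨b, hb⟩ := h
  exact ⟨b, fun i => hb _ (hs ⟨i, rfl⟩)⟩

theorem exists_gt_Iio (hreg : κ.IsRegular) (a : Iio κ.ord) (f : Iio κ.ord → Iio κ.ord) :
    ∃ b, ∀ γ < a, f γ < b := by
  obtain ⟨b, hb⟩ := exists_forall_lt hreg (fun γ : Iio a => f γ) (s := f '' Iio a)
    (by rintro _ ⟨γ, rfl⟩; exact ⟨γ, γ.2, rfl⟩) (Cardinal.mk_image_le.trans_lt (mk_Iio_lt_mk a))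
  exact ⟨b, fun γ hγ => hb ⟨γ, hγ⟩⟩

theorem exists_gt_seq (hκ : ℵ₀ < κ) (hreg : κ.IsRegular) (f : ℕ → Iio κ.ord) :
    ∃ b, ∀ n, f n < b := by
  refine exists_forall_lt hreg f subset_rfl ?_
  refine (countable_range f).le_aleph0.trans_lt ?_
  rw [mk_Iio_ord]
  exact Cardinal.aleph0_lt_lift.2 hκ

theorem noMaxOrder_Iio_ord (hκ : ℵ₀ < κ) : NoMaxOrder (Iio κ.ord) := by
  refine ⟨fun a => ?_⟩
  have h := (Cardinal.isSuccLimit_ord hκ.le).succ_lt a.2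
  exact ⟨⟨_, h⟩, Subtype.mk_lt_mk.2 (Order.lt_succ a.1)⟩

/-- Closure points of a function are unbounded. -/
theorem exists_closure_point (hκ : ℵ₀ < κ) (hreg : κ.IsRegular) (h : Iio κ.ord → Iio κ.ord)
    (β : Iio κ.ord) : ∃ δ > β, ∀ γ < δ, h γ < δ := by
  have := noMaxOrder_Iio_ord hκ
  have step : ∀ a : Iio κ.ord, ∃ b, a < b ∧ ∀ γ ≤ a, h γ < b := by
    intro a
    obtain ⟨a', ha'⟩ := exists_gt a
    obtain ⟨b, hb⟩ := exists_gt_Iio hreg a' h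
    exact ⟨max b a', lt_max_of_lt_right ha',
      fun γ hγ => lt_max_of_lt_left (hb γ (hγ.trans_lt ha'))⟩
  choose s hs1 hs2 using step
  -- The least strict upper bound of the iterates of s is closed under h; it is below κ because κ is
  -- regular and uncountable.
  let d : ℕ → Iio κ.ord := fun n => s^[n] β
  have hd : ∀ n, d (n + 1) = s (d n) := fun n => Function.iterate_succ_apply' s n β
  have hne : {b | ∀ n, d n < b}.Nonempty := exists_gt_seq hκ hreg d
  refine ⟨WellFounded.min wellFounded_lt _ hne,
    WellFounded.min_mem wellFounded_lt _ hne 0, fun γ hγ => ?_⟩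
  have : ∃ n, γ ≤ d n := by
    by_contra hcon
    push Not at hcon
    exact WellFounded.not_lt_min wellFounded_lt {b | ∀ n, d n < b} hcon hγ
  obtain ⟨n, hn⟩ := this
  have h1 := hs2 _ _ hn
  rw [← hd] at h1
  exact h1.trans (WellFounded.min_mem wellFounded_lt _ hne (n + 1))

/-- By induction on c, ℵ_c < κ for all c < κ: successor steps use that κ is a limit cardinal, limit
steps that it is regular. This keeps the blocks small. -/
theorem aleph_succ_lt (hκ : ℵ₀ < κ) (hreg : κ.IsRegular) (hlim : ∀ μ < κ, Order.succ μ < κ)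
    (c : Ordinal.{u}) (hc : c < κ.ord) : ℵ_ (c + 1) < κ := by
  have key : ∀ c : Ordinal.{u}, c < κ.ord → ℵ_ c < κ := by
    intro c
    induction c using Ordinal.limitRecOn with
    | zero => intro _; simpa using hκ
    | add_one c ih =>
      intro hc
      have := hlim _ (ih ((lt_add_one c).trans hc))
      rwa [Cardinal.succ_aleph] at this
    | limit c hc ih =>
      intro hck
      rw [Cardinal.aleph_limit hc]
      refine Cardinal.lift_iSup_lt_of_lt_cof_ord ?_ fun i => ih i.1 i.2 (lt_trans i.2 hck)
      rw [hreg.lift.cof_ord, Cardinal.mk_Iio_ordinal, Cardinal.lift_lift, Cardinal.lift_lt]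
      exact Cardinal.lt_ord.1 hck
  rw [← Cardinal.succ_aleph]
  exact hlim _ (key c hc)

theorem mk_pi_Iio_le (hpow : κ ^< κ = κ) {l : Ordinal.{u}} (hl : l ≤ κ.ord) (s : Set (Iio κ.ord))
    (hs : #s < #(Iio κ.ord)) : #(s → Iio l) ≤ #(Iio κ.ord) := by
  have h1 : #(Iio l) ≤ Cardinal.lift.{u + 1} κ := by
    rw [Cardinal.mk_Iio_ordinal, Cardinal.lift_le]
    exact (Ordinal.card_le_card hl).trans_eq (Cardinal.card_ord κ)
  rw [mk_Iio_ord] at hs ⊢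
  obtain ⟨μ, hμ⟩ := Cardinal.mem_range_lift_of_le hs.le
  rw [← Cardinal.power_def, ← hμ]
  refine (Cardinal.power_le_power_right h1).trans ?_
  rw [← Cardinal.lift_power, Cardinal.lift_le]
  rw [← hμ, Cardinal.lift_lt] at hs
  exact (Cardinal.le_powerlt κ hs).trans hpow.le

theorem mk_Iic_lt_mk (hκ : ℵ₀ < κ) (a : Iio κ.ord) : #(Iic a) < #(Iio κ.ord) := by
  have := noMaxOrder_Iio_ord hκ
  obtain ⟨b, hb⟩ := exists_gt a
  exact (Cardinal.mk_le_mk_of_subset (Iic_subset_Iio.2 hb)).trans_lt (mk_Iio_lt_mk b)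

theorem aleph0_le_mk (hκ : ℵ₀ < κ) : ℵ₀ ≤ #(Iio κ.ord) := by
  rw [mk_Iio_ord]; exact (Cardinal.aleph0_lt_lift.2 hκ).le

theorem mk_sigma_le (hκ : ℵ₀ < κ) {ι : Type (u + 1)} {X : ι → Type (u + 1)}
    (hι : #ι ≤ #(Iio κ.ord)) (hX : ∀ i, #(X i) ≤ #(Iio κ.ord)) : #(Σ i, X i) ≤ #(Iio κ.ord) := by
  rw [Cardinal.mk_sigma]
  refine (Cardinal.sum_le_sum _ (fun _ => #(Iio κ.ord)) hX).trans ?_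
  rw [Cardinal.sum_const']
  exact (mul_le_mul_left hι _).trans (Cardinal.mul_eq_self (aleph0_le_mk hκ)).le

end Arithmetic


/-! ### The absorbing order and the dense orders on κ -/

section Orders

open Set Ordinal

variable {κ : Cardinal.{u}}

theorem mk_block_le (hκ : ℵ₀ < κ) (hreg : κ.IsRegular) (hlim : ∀ μ < κ, Order.succ μ < κ)
    (c : Iio κ.ord) : #(Block c.1) ≤ #(Iio κ.ord) := by
  have : #(Block c.1) = #(Iio (ω_ (c.1 + 1))) := rfl
  rw [this, mk_Iio_ord, Cardinal.mk_Iio_ordinal, Cardinal.lift_le, Ordinal.card_omega]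
  exact (aleph_succ_lt hκ hreg hlim c.1 c.2).le

/-- A linear order of size `κ` that is the sum of all words of blocks followed by copies of
itself. -/
theorem exists_absorbing_order (hκ : ℵ₀ < κ) (hpow : κ ^< κ = κ)
    (hlim : ∀ μ < κ, Order.succ μ < κ) :
    ∃ (_ : LinearOrder (WordOn (Iio κ.ord) (Iio κ.ord))) (A : Type (u + 1))
      (_ : LinearOrder A), #A = #(Iio κ.ord) ∧
      Nonempty (A ≃o BlockSum (fun c : Iio κ.ord => Block c.1) A
        (AllWords.color (K := Iio κ.ord) (C := Iio κ.ord))) := by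
  classical
  have hreg := isRegular_of_powerlt hκ hpow
  -- The order in which the words are concatenated is irrelevant, so an arbitrary well-ordering
  -- serves.
  let i1 : LinearOrder (WordOn (Iio κ.ord) (Iio κ.ord)) :=
    IsWellOrder.linearOrder WellOrderingRel
  let J := AllWords (Iio κ.ord) (Iio κ.ord)
  let B : J → Type (u + 1) := fun j => Block (j.color).1
  refine ⟨i1, IterSum J B, inferInstance, le_antisymm ?_ ?_, 
    IterSum.nonempty_orderIso (J := J) (B := B)⟩
  · refine (Cardinal.mk_le_of_injective (IterSum.toList_injective (J := J) (B := B))).trans ?_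
    refine (Cardinal.mk_list_le_max _).trans (max_le (aleph0_le_mk hκ) ?_)
    refine mk_sigma_le hκ (X := fun j => WithTop (B j)) ?_ fun j => ?_
    · refine mk_sigma_le hκ (X := fun w : WordOn (Iio κ.ord) (Iio κ.ord) => Iic w.top)
        ?_ fun w => (mk_Iic_lt_mk hκ w.top).le
      refine (Cardinal.mk_le_of_injective (f := fun w : WordOn (Iio κ.ord) (Iio κ.ord) =>
        (⟨w.top, w.letter⟩ : Σ z : Iio κ.ord, (Iic z → Iio κ.ord))) ?_).trans ?_
      · rintro ⟨z, g⟩ ⟨z', g'⟩ h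
        simp only [Sigma.mk.injEq] at h
        obtain ⟨rfl, h⟩ := h
        rw [eq_of_heq h]
      exact mk_sigma_le hκ le_rfl fun z => mk_pi_Iio_le hpow le_rfl _ (mk_Iic_lt_mk hκ z)
    · have : #(WithTop (B j)) = #(B j) + 1 := Cardinal.mk_option
      rw [this]
      exact (add_le_add (mk_block_le hκ hreg hlim _) (Cardinal.one_le_aleph0.trans
        (aleph0_le_mk hκ))).trans (Cardinal.add_eq_self (aleph0_le_mk hκ)).le
  · have hpos : (0 : Ordinal.{u}) < κ.ord := hreg.ord_pos
    -- For the lower bound on the size: one point in a block at the last position of a constant word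
    -- of each length.
    let F : Iio κ.ord → IterSum J B := fun z =>
      .base (toLex ⟨⟨z, fun _ => ⟨0, hpos⟩⟩, ⟨z, le_refl z⟩⟩)
        (OrderDual.toDual ⟨0, zero_lt_omega_succ _⟩)
    refine Cardinal.mk_le_of_injective (f := F) fun x y hxy => ?_
    injection hxy with h1
    exact congrArg (fun j : J => (ofLex j).1.top) h1

/-- The universe `κ × κ` of a dense sum. -/
theorem DenseSum.lt_iff {K A : Type (u + 1)} [LinearOrder K] [LinearOrder A] {f : K → Ordinal.{u}}
    {i j : K} {x : (Block (f i) ⊕ₗ A) ×ₗ ℚ} {y : (Block (f j) ⊕ₗ A) ×ₗ ℚ} :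
    ((toLex (toLex ⟨i, (ofLex x).1⟩, (ofLex x).2) : DenseSum A f) <
      toLex (toLex ⟨j, (ofLex y).1⟩, (ofLex y).2)) ↔ i < j ∨ ∃ h : i = j, h ▸ x < y := by
  constructor
  · intro h
    rcases Prod.Lex.lt_iff.1 h with h | ⟨h, h'⟩
    · rcases sigmaLex_lt.1 h with h | ⟨h, h'⟩
      · exact .inl h
      · subst h
        exact .inr ⟨rfl, Prod.Lex.lt_iff.2 (.inl h')⟩
    · obtain rfl := IterSum.fst_eq_of_toLex_eq h
      refine .inr ⟨rfl, Prod.Lex.lt_iff.2 (.inr ⟨IterSum.toLex_mk_inj.1 h, h'⟩)⟩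
  · rintro (h | ⟨rfl, h⟩)
    · exact Prod.Lex.lt_iff.2 (.inl (sigmaLex_lt.2 (.inl h)))
    · rcases Prod.Lex.lt_iff.1 h with h | ⟨h, h'⟩
      · exact Prod.Lex.lt_iff.2 (.inl (sigmaLex_lt_same.2 h))
      · exact Prod.Lex.lt_iff.2 (.inr ⟨IterSum.toLex_mk_inj.2 h, h'⟩)

/-- A strict dense linear order without endpoints. -/
structure IsDenseOrder {X : Type*} (r : X → X → Prop) : Prop where
  irrefl : ∀ a, ¬ r a a
  trans : ∀ a b c, r a b → r b c → r a c
  total : ∀ a b, r a b ∨ a = b ∨ r b a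
  dense : ∀ a b, r a b → ∃ c, r a c ∧ r c b
  above : ∀ a, ∃ b, r a b
  below : ∀ a, ∃ b, r b a

/-- A family of dense linear orders on `κ`, indexed by `κ ^ κ`, whose isomorphism relation encodes
agreement of functions at the closure points of a function. -/
theorem exists_dense_orders (hκ : ℵ₀ < κ) (hpow : κ ^< κ = κ)
    (hlim : ∀ μ < κ, Order.succ μ < κ) :
    ∃ R : (Iio κ.ord → Iio κ.ord) → Iio κ.ord → Iio κ.ord → Prop,
      (∀ f, IsDenseOrder (R f)) ∧
      (∀ a b, ∃ α, ∀ f g, f α = g α → (R f a b ↔ R g a b)) ∧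
      (∀ f g, ∀ h : Iio κ.ord → Iio κ.ord, (∀ δ, (∀ γ < δ, h γ < δ) → f δ = g δ) →
        (∀ δ, (∃ γ < δ, ∀ β < δ, β ≤ γ) → f δ = g δ) →
        ∃ e : Iio κ.ord ≃ Iio κ.ord, ∀ a b, R f a b ↔ R g (e a) (e b)) ∧
      (∀ f g, (∃ e : Iio κ.ord ≃ Iio κ.ord, ∀ a b, R f a b ↔ R g (e a) (e b)) →
        ∃ h : Iio κ.ord → Iio κ.ord, ∀ δ, (∀ γ < δ, h γ < δ) →
          (∀ γ < δ, ∃ β < δ, γ < β) → f δ = g δ) := by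
  have hreg := isRegular_of_powerlt hκ hpow
  have := noMaxOrder_Iio_ord hκ
  obtain ⟨i1, A, i2, hAc, hA⟩ := exists_absorbing_order hκ hpow hlim
  have hK := aleph0_le_mk hκ
  -- Each piece of the sum has size κ, so one bijection with κ can be fixed for each colour,
  -- independently of the colouring.
  have hpiece : ∀ c : Iio κ.ord, Nonempty (Iio κ.ord ≃ (Block c.1 ⊕ₗ A) ×ₗ ℚ) := by
    intro c
    have h1 : #((Block c.1 ⊕ₗ A) ×ₗ ℚ) = (#(Block c.1) + #A) * ℵ₀ := by
      have : #((Block c.1 ⊕ₗ A) ×ₗ ℚ) = #((Block c.1 ⊕ A) × ℚ) := rfl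
      rw [this]
      simp
    rw [← Cardinal.eq, h1, hAc, Cardinal.add_eq_right hK (mk_block_le hκ hreg hlim c),
      Cardinal.mul_eq_left hK hK Cardinal.aleph0_ne_zero]
  let e := fun c => (hpiece c).some
  obtain ⟨p⟩ : Nonempty (Iio κ.ord ≃ Iio κ.ord × Iio κ.ord) := by
    rw [← Cardinal.eq, Cardinal.mk_prod, Cardinal.lift_id,
      Cardinal.mul_eq_self hK]
  -- A point of κ × κ consists of an index and a position in its piece; only the colour of that
  -- index enters its interpretation.
  let E₀ : ∀ f : Iio κ.ord → Iio κ.ord, Iio κ.ord × Iio κ.ord → DenseSum A fun k => (f k).1 :=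
    fun f x => toLex (toLex ⟨x.1, (ofLex (e (f x.1) x.2)).1⟩, (ofLex (e (f x.1) x.2)).2)
  have hE₀ : ∀ f, Function.Bijective (E₀ f) := by
    intro f
    constructor
    · rintro ⟨i, x⟩ ⟨j, y⟩ h
      have h1 : (toLex ⟨i, (ofLex (e (f i) x)).1⟩ : Σₗ k, (Block (f k).1 ⊕ₗ A)) =
        toLex ⟨j, (ofLex (e (f j) y)).1⟩ := congrArg (fun z => (ofLex z).1) h
      have h2 : (ofLex (e (f i) x)).2 = (ofLex (e (f j) y)).2 := congrArg (fun z => (ofLex z).2) h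
      obtain rfl := IterSum.fst_eq_of_toLex_eq h1
      have h3 := IterSum.toLex_mk_inj.1 h1
      have h4 : e (f i) x = e (f i) y := Prod.ext h3 h2
      rw [(e (f i)).injective h4]
    · rintro ⟨⟨i, y⟩, q⟩
      refine ⟨(i, (e (f i)).symm (toLex (y, q))), ?_⟩
      simp only [E₀, Equiv.apply_symm_apply]
      rfl
  let E : ∀ f : Iio κ.ord → Iio κ.ord, Iio κ.ord ≃ DenseSum A fun k => (f k).1 := fun f =>
    p.trans (Equiv.ofBijective _ (hE₀ f))
  refine ⟨fun f a b => E f a < E f b, fun f => ⟨fun a => lt_irrefl _, fun a b c => lt_trans,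
    fun a b => ?_, fun a b hab => ?_, fun a => ?_, fun a => ?_⟩, fun a b => ?_,
    fun f g h h1 h2 => ?_, fun f g ⟨σ, hσ⟩ => ?_⟩
  · rcases lt_trichotomy (E f a) (E f b) with h | h | h
    · exact .inl h
    · exact .inr (.inl ((E f).injective h))
    · exact .inr (.inr h)
  -- Density and the absence of endpoints come from the factor ℚ, which replaces each point of the
  -- block sum.
  · obtain ⟨c, hc⟩ := exists_between hab
    exact ⟨(E f).symm c, by simpa using hc⟩
  · obtain ⟨c, hc⟩ := exists_gt (E f a)
    exact ⟨(E f).symm c, by simpa using hc⟩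
  · obtain ⟨c, hc⟩ := exists_lt (E f a)
    exact ⟨(E f).symm c, by simpa using hc⟩
  -- Points with different indices are compared by index alone. If the indices coincide, only the
  -- colour at this common index matters.
  · refine ⟨(p a).1, fun f g hfg => ?_⟩
    have key : ∀ f, E f a < E f b ↔ (p a).1 < (p b).1 ∨ ((p a).1 = (p b).1 ∧
        e (f (p a).1) (p a).2 < e (f (p a).1) (p b).2) := by
      intro f
      refine (DenseSum.lt_iff (f := fun k => (f k).1) (x := e (f (p a).1) (p a).2)
        (y := e (f (p b).1) (p b).2)).trans (or_congr Iff.rfl ?_)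
      obtain ⟨i, x⟩ := p a
      obtain ⟨j, y⟩ := p b
      constructor
      · rintro ⟨h, h'⟩
        dsimp only at h
        subst h
        exact ⟨rfl, h'⟩
      · rintro ⟨h, h'⟩
        dsimp only at h
        subst h
        exact ⟨rfl, h'⟩
    have hg := key g
    rw [← hfg] at hg
    exact (key f).trans hg.symm
  · obtain ⟨φ⟩ := blockSum_congr_of_agree hA (exists_closure_point hκ hreg h) h1 h2
    let ψ : (DenseSum A fun k => (f k).1) ≃o DenseSum A fun k => (g k).1 :=
      Prod.Lex.prodLexCongr φ (OrderIso.refl ℚ)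
    refine ⟨((E f).trans ψ.toEquiv).trans (E g).symm, fun a b => ?_⟩
    simp
  · let ψ : (DenseSum A fun k => (f k).1) ≃o DenseSum A fun k => (g k).1 :=
      StrictMono.orderIsoOfSurjective (fun x => E g (σ ((E f).symm x)))
        (fun x y hxy => (hσ _ _).1 (by simpa using hxy))
        ((E g).surjective.comp (σ.surjective.comp (E f).symm.surjective))
    obtain ⟨h, hh⟩ := DenseSum.agree_of_orderIso ψ
    exact ⟨h, fun δ h1 h2 => Subtype.ext (hh δ h1 h2)⟩

end Orders


/-! ### The bounded topology -/

section Topology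

open Set

variable {κ : Cardinal.{u}} {l : Ordinal.{u}}

theorem self_mem_cyl (ζ : GenSpace κ l) (α : Iio κ.ord) : ζ ∈ cyl ζ α := fun _ _ => rfl

theorem cyl_eq_of_mem {ζ η : GenSpace κ l} {α : Iio κ.ord} (h : η ∈ cyl ζ α) :
    cyl ζ α = cyl η α := by
  ext ξ
  exact ⟨fun hξ β hβ => (hξ β hβ).trans (h β hβ).symm, fun hξ β hβ => (hξ β hβ).trans (h β hβ)⟩

theorem cyl_anti (ζ : GenSpace κ l) {α β : Iio κ.ord} (h : α ≤ β) : cyl ζ β ⊆ cyl ζ α :=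
  fun _ hη γ hγ => hη γ (hγ.trans_le h)

theorem isOpen_cyl (ζ : GenSpace κ l) (α : Iio κ.ord) : IsOpen (cyl ζ α) :=
  TopologicalSpace.isOpen_generateFrom_of_mem ⟨ζ, α, rfl⟩

/-- An open set contains a basic neighbourhood of each of its points. -/
theorem exists_cyl_subset [hne : Nonempty (Iio κ.ord)] {U : Set (GenSpace κ l)} (hU : IsOpen U)
    {η : GenSpace κ l} (hη : η ∈ U) : ∃ α, cyl η α ⊆ U := by
  change TopologicalSpace.GenerateOpen _ U at hU
  induction hU with
  | basic s hs =>
    obtain ⟨ζ, α, rfl⟩ := hs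
    exact ⟨α, (cyl_eq_of_mem hη).symm.subset⟩
  | univ => exact ⟨hne.some, subset_univ _⟩
  | inter s t _ _ ihs iht =>
    obtain ⟨α, hα⟩ := ihs hη.1
    obtain ⟨β, hβ⟩ := iht hη.2
    exact ⟨max α β, subset_inter ((cyl_anti η (le_max_left _ _)).trans hα)
      ((cyl_anti η (le_max_right _ _)).trans hβ)⟩
  | sUnion S _ ih =>
    obtain ⟨s, hs, hηs⟩ := hη
    obtain ⟨α, hα⟩ := ih s hs hηs
    exact ⟨α, hα.trans (subset_sUnion_of_mem hs)⟩

theorem isOpen_of_forall_cyl {U : Set (GenSpace κ l)} (h : ∀ η ∈ U, ∃ α, cyl η α ⊆ U) :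
    IsOpen U := by
  rw [isOpen_iff_forall_mem_open]
  intro η hη
  obtain ⟨α, hα⟩ := h η hη
  exact ⟨_, hα, isOpen_cyl η α, self_mem_cyl η α⟩

theorem continuous_to_genSpace {Z : Type*} [TopologicalSpace Z] {F : Z → GenSpace κ l}
    (h : ∀ z α, F ⁻¹' cyl (F z) α ∈ nhds z) : Continuous F := by
  refine continuous_generateFrom_iff.2 ?_
  rintro _ ⟨ζ, α, rfl⟩
  rw [isOpen_iff_mem_nhds]
  intro z hz
  have hz' : F z ∈ cyl ζ α := hz
  rw [cyl_eq_of_mem hz']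
  exact h z α

/-- Open sets are Borel. -/
theorem IsKBorel.of_isOpen (hκ : ℵ₀ < κ) (hpow : κ ^< κ = κ) (hl : l ≤ κ.ord) (hl2 : 2 ≤ l)
    {U : Set (GenSpace κ l)} (hU : IsOpen U) : IsKBorel U := by
  classical
  have hpos : (0 : Ordinal.{u}) < κ.ord := (isRegular_of_powerlt hκ hpow).ord_pos
  have : Nonempty (Iio κ.ord) := ⟨⟨0, hpos⟩⟩
  have h01 : (0 : Ordinal.{u}) < l := two_pos.trans_le hl2
  have h11 : (1 : Ordinal.{u}) < l := one_lt_two.trans_le hl2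
  rcases U.eq_empty_or_nonempty with rfl | ⟨η₀, hη₀⟩
  · have := noMaxOrder_Iio_ord hκ
    obtain ⟨a, ha⟩ := exists_gt (⟨0, hpos⟩ : Iio κ.ord)
    -- The empty set is an intersection of two disjoint basic sets, repeated to length κ; two
    -- distinct values are needed, hence 2 ≤ l.
    let z : GenSpace κ l := fun _ => ⟨0, h01⟩
    let o : GenSpace κ l := fun _ => ⟨1, h11⟩
    have : (∅ : Set (GenSpace κ l)) =
        ⋂ i : Iio κ.ord, if i = ⟨0, hpos⟩ then cyl z a else cyl o a := by
      symm
      rw [eq_empty_iff_forall_notMem]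
      intro η hη
      rw [mem_iInter] at hη
      have h1 := hη ⟨0, hpos⟩
      have h2 := hη a
      rw [if_pos rfl] at h1
      rw [if_neg ha.ne'] at h2
      have h3 := (h1 _ ha).symm.trans (h2 _ ha)
      exact zero_ne_one (congrArg Subtype.val h3)
    rw [this]
    refine .iInter _ fun i => ?_
    split_ifs
    · exact .basic _ _
    · exact .basic _ _
  · let S := {c : Set (GenSpace κ l) // (∃ ζ α, c = cyl ζ α) ∧ c ⊆ U}
    obtain ⟨α₀, hα₀⟩ := exists_cyl_subset hU hη₀
    have hSne : Nonempty S := ⟨⟨_, ⟨_, _, rfl⟩, hα₀⟩⟩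
    -- A basic open set is determined by a bounded function, and there are at most κ of these
    -- because κ^{<κ} = κ.
    have hS : #S ≤ #(Iio κ.ord) := by
      let F : (Σ α : Iio κ.ord, (Iio α → Iio l)) → Set (GenSpace κ l) := fun x =>
        {η | ∀ β : Iio x.1, η β = x.2 β}
      have h1 : ∀ c : S, ∃ x, F x = c.1 := by
        rintro ⟨c, ⟨ζ, α, rfl⟩, -⟩
        exact ⟨⟨α, fun β => ζ β⟩, by ext η; simp [F, cyl]⟩
      choose G hG using h1
      refine (Cardinal.mk_le_of_injective (f := G) fun c d hcd => ?_).trans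
        (mk_sigma_le hκ le_rfl fun α => mk_pi_Iio_le hpow hl _ (mk_Iio_lt_mk α))
      exact Subtype.ext ((hG c).symm.trans ((congrArg F hcd).trans (hG d)))
    obtain ⟨⟨e, he⟩⟩ := Cardinal.le_def _ _ |>.1 hS
    have : U = ⋃ i : Iio κ.ord, (Function.invFun e i).1 := by
      ext η
      rw [mem_iUnion]
      constructor
      · intro hη
        obtain ⟨α, hα⟩ := exists_cyl_subset hU hη
        refine ⟨e ⟨_, ⟨η, α, rfl⟩, hα⟩, ?_⟩
        rw [Function.leftInverse_invFun he]
        exact self_mem_cyl _ _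
      · rintro ⟨i, hi⟩
        exact (Function.invFun e i).2.2 hi
    rw [this]
    refine .iUnion _ fun i => ?_
    obtain ⟨ζ, α, h⟩ := (Function.invFun e i).2.1
    rw [h]
    exact .basic _ _

/-! ### Projections of closed sets -/

variable {Z : Type*} [TopologicalSpace Z]

/-- `P` is the projection of a closed subset of `Z × κ ^ κ`. -/
def IsProj (κ : Cardinal.{u}) (P : Z → Prop) : Prop :=
  ∃ C : Set (Z × Baire κ), IsClosed C ∧ ∀ z, P z ↔ ∃ θ, (z, θ) ∈ C

/-- Both `P` and its negation are projections of closed sets. -/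
def IsBiProj (κ : Cardinal.{u}) (P : Z → Prop) : Prop :=
  IsProj κ P ∧ IsProj κ fun z => ¬ P z

/-- The function `θ ∘ σ`. -/
def reindex (σ : Iio κ.ord → Iio κ.ord) (θ : GenSpace κ l) : GenSpace κ l := fun β => θ (σ β)

theorem continuous_reindex (hreg : κ.IsRegular) (σ : Iio κ.ord → Iio κ.ord) :
    Continuous (reindex (l := l) σ) := by
  refine continuous_to_genSpace fun θ α => ?_
  obtain ⟨b, hb⟩ := exists_gt_Iio hreg α σ
  exact Filter.mem_of_superset ((isOpen_cyl θ b).mem_nhds (self_mem_cyl θ b))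
    fun ξ hξ β hβ => hξ _ (hb β hβ)

theorem isClopen_coord (hκ : ℵ₀ < κ) (a : Iio κ.ord) (s : Set (Iio l)) :
    IsClopen {η : GenSpace κ l | η a ∈ s} := by
  have := noMaxOrder_Iio_ord hκ
  obtain ⟨b, hb⟩ := exists_gt a
  have key : ∀ s : Set (Iio l), IsOpen {η : GenSpace κ l | η a ∈ s} := fun s =>
    isOpen_of_forall_cyl fun η hη => ⟨b, fun ξ hξ => by
      rw [mem_ofPred_eq, hξ a hb]; exact hη⟩
  exact ⟨⟨key sᶜ⟩, key s⟩

theorem IsProj.of_isClosed (h : Nonempty (Baire κ)) {P : Z → Prop} (hP : IsClosed {z | P z}) :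
    IsProj κ P :=
  ⟨{x | P x.1}, hP.preimage continuous_fst, fun _ => ⟨fun hz => ⟨h.some, hz⟩, fun ⟨_, hz⟩ => hz⟩⟩

/-- A pairing function on `κ`. -/
theorem nonempty_pairing (hκ : ℵ₀ < κ) : Nonempty (Iio κ.ord × Iio κ.ord ≃ Iio κ.ord) := by
  rw [← Cardinal.eq, Cardinal.mk_prod, Cardinal.lift_id, Cardinal.mul_eq_self (aleph0_le_mk hκ)]

/-- The witnesses for all i are merged into one: the slice of the new witness with first pairing
coordinate `e i` is the witness for i. Slices are continuous because κ is regular. -/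
theorem IsProj.forall (hκ : ℵ₀ < κ) (hreg : κ.IsRegular) {ι : Type*} (e : ι ↪ Iio κ.ord)
    {P : ι → Z → Prop} (hP : ∀ i, IsProj κ (P i)) : IsProj κ fun z => ∀ i, P i z := by
  classical
  obtain ⟨p⟩ := nonempty_pairing hκ
  choose C hC hPC using hP
  refine ⟨{x | ∀ i, (x.1, reindex (fun β => p (e i, β)) x.2) ∈ C i}, ?_, fun z => ⟨?_, ?_⟩⟩
  · rw [ofPred_forall]
    exact isClosed_iInter fun i => (hC i).preimage (continuous_fst.prodMk
      ((continuous_reindex hreg fun β => p (e i, β)).comp continuous_snd))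
  · intro h
    choose θ hθ using fun i => (hPC i z).1 (h i)
    refine ⟨fun β => if h : ∃ i, e i = (p.symm β).1 then θ h.choose (p.symm β).2 else β,
      fun i => ?_⟩
    have h1 : (reindex (fun β => p (e i, β)) (fun β => if h : ∃ i, e i = (p.symm β).1 then
        θ h.choose (p.symm β).2 else β : Baire κ)) = θ i := by
      funext β
      have h2 : ∃ j, e j = (p.symm (p (e i, β))).1 := ⟨i, by simp⟩
      have h3 : h2.choose = i := e.injective (by simp)
      simp only [reindex]
      rw [dif_pos h2, h3]
      simp
    change (z, reindex _ _) ∈ C i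
    rw [h1]
    exact hθ i
  · rintro ⟨θ, hθ⟩ i
    exact (hPC i z).2 ⟨_, hθ i⟩

theorem exists_two_lt (hκ : ℵ₀ < κ) (hreg : κ.IsRegular) : ∃ a b : Iio κ.ord, a ≠ b := by
  have := noMaxOrder_Iio_ord hκ
  obtain ⟨b, hb⟩ := exists_gt (⟨0, hreg.ord_pos⟩ : Iio κ.ord)
  exact ⟨_, b, hb.ne⟩

/-- One coordinate of the new witness names an index i and a slice disjoint from it holds a witness
for i. The set stays closed because naming a given index is a clopen condition. -/
theorem IsProj.exists (hκ : ℵ₀ < κ) (hreg : κ.IsRegular) {ι : Type*} (e : ι ↪ Iio κ.ord)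
    {P : ι → Z → Prop} (hP : ∀ i, IsProj κ (P i)) : IsProj κ fun z => ∃ i, P i z := by
  classical
  obtain ⟨p⟩ := nonempty_pairing hκ
  obtain ⟨a, b, hab⟩ := exists_two_lt hκ hreg
  choose C hC hPC using hP
  refine ⟨{x | x.2 (p (a, a)) ∈ range e ∧
    ∀ i, x.2 (p (a, a)) = e i → (x.1, reindex (fun β => p (b, β)) x.2) ∈ C i}, ?_,
    fun z => ⟨?_, ?_⟩⟩
  · have h1 : ∀ s : Set (Iio κ.ord), IsClopen {x : Z × Baire κ | x.2 (p (a, a)) ∈ s} :=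
      fun s => (isClopen_coord hκ (p (a, a)) s).preimage continuous_snd
    have h2 : IsClosed {x : Z × Baire κ | ∀ i, x.2 (p (a, a)) = e i →
        (x.1, reindex (fun β => p (b, β)) x.2) ∈ C i} := by
      rw [ofPred_forall]
      refine isClosed_iInter fun i => ?_
      exact isClosed_imp (h1 {e i}).isOpen ((hC i).preimage (continuous_fst.prodMk
        ((continuous_reindex hreg fun β => p (b, β)).comp continuous_snd)))
    exact (h1 (range e)).isClosed.inter h2
  · rintro ⟨i, hi⟩
    obtain ⟨θ, hθ⟩ := (hPC i z).1 hi
    let ξ : Baire κ := fun β => if β = p (a, a) then e i else θ (p.symm β).2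
    refine ⟨ξ, ⟨i, (if_pos rfl).symm⟩, fun j hj => ?_⟩
    have h1 : ξ (p (a, a)) = e i := if_pos rfl
    obtain rfl : i = j := e.injective (h1.symm.trans hj)
    have h2 : reindex (fun β => p (b, β)) ξ = θ := by
      funext β
      have : p (b, β) ≠ p (a, a) := fun h =>
        hab (congrArg Prod.fst (p.injective h)).symm
      simp only [reindex, ξ]
      rw [if_neg this]
      simp
    change (z, reindex _ _) ∈ C i
    rw [h2]
    exact hθ
  · rintro ⟨θ, ⟨i, hi⟩, h⟩
    exact ⟨i, (hPC i z).2 ⟨_, h i hi.symm⟩⟩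

/-- Projections along `κ ^ κ`. -/
theorem IsProj.exists_baire (hκ : ℵ₀ < κ) (hreg : κ.IsRegular) {P : Z × Baire κ → Prop}
    (hP : IsProj κ P) : IsProj κ fun z => ∃ θ, P (z, θ) := by
  classical
  obtain ⟨p⟩ := nonempty_pairing hκ
  obtain ⟨a, b, hab⟩ := exists_two_lt hκ hreg
  obtain ⟨C, hC, hPC⟩ := hP
  refine ⟨{x | ((x.1, reindex (fun β => p (a, β)) x.2), reindex (fun β => p (b, β)) x.2) ∈ C},
    hC.preimage ((continuous_fst.prodMk ((continuous_reindex hreg _).comp continuous_snd)).prodMk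
      ((continuous_reindex hreg _).comp continuous_snd)), fun z => ⟨?_, ?_⟩⟩
  · rintro ⟨θ, hθ⟩
    obtain ⟨θ', hθ'⟩ := (hPC _).1 hθ
    refine ⟨fun β => if (p.symm β).1 = a then θ (p.symm β).2 else θ' (p.symm β).2, ?_⟩
    have h1 : ∀ c : Iio κ.ord, reindex (fun β => p (c, β)) (fun β => if (p.symm β).1 = a then
        θ (p.symm β).2 else θ' (p.symm β).2 : Baire κ) = if c = a then θ else θ' := by
      intro c
      funext β
      simp only [reindex, Equiv.symm_apply_apply]
      split_ifs <;> rfl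
    change ((z, reindex _ _), reindex _ _) ∈ C
    rw [h1, h1, if_pos rfl, if_neg hab.symm]
    exact hθ'
  · rintro ⟨θ, hθ⟩
    exact ⟨_, (hPC _).2 ⟨_, hθ⟩⟩

/-! ### Relations with projective complement -/

theorem IsProj.congr {P Q : Z → Prop} (hP : IsProj κ P) (h : ∀ z, Q z ↔ P z) : IsProj κ Q := by
  obtain rfl : Q = P := funext fun z => propext (h z)
  exact hP

theorem IsBiProj.of_isClopen (h : Nonempty (Baire κ)) {P : Z → Prop} (hP : IsClopen {z | P z}) :
    IsBiProj κ P :=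
  ⟨.of_isClosed h hP.isClosed, .of_isClosed h hP.compl.isClosed⟩

theorem IsBiProj.const (h : Nonempty (Baire κ)) (p : Prop) : IsBiProj κ fun _ : Z => p := by
  by_cases hp : p
  · exact .of_isClopen h (by simp [hp, isClopen_univ])
  · exact .of_isClopen h (by simp [hp, isClopen_empty])

theorem IsBiProj.not {P : Z → Prop} (hP : IsBiProj κ P) : IsBiProj κ fun z => ¬ P z :=
  ⟨hP.2, hP.1.congr fun _ => not_not⟩

theorem IsBiProj.forall (hκ : ℵ₀ < κ) (hreg : κ.IsRegular) {ι : Type*} (e : ι ↪ Iio κ.ord)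
    {P : ι → Z → Prop} (hP : ∀ i, IsBiProj κ (P i)) : IsBiProj κ fun z => ∀ i, P i z :=
  ⟨.forall hκ hreg e fun i => (hP i).1,
    (IsProj.exists hκ hreg e fun i => (hP i).2).congr fun _ => not_forall⟩

theorem IsBiProj.exists (hκ : ℵ₀ < κ) (hreg : κ.IsRegular) {ι : Type*} (e : ι ↪ Iio κ.ord)
    {P : ι → Z → Prop} (hP : ∀ i, IsBiProj κ (P i)) : IsBiProj κ fun z => ∃ i, P i z :=
  ⟨.exists hκ hreg e fun i => (hP i).1,
    (IsProj.forall hκ hreg e fun i => (hP i).2).congr fun _ => not_exists⟩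

theorem nonempty_bool_embedding (hκ : ℵ₀ < κ) (hreg : κ.IsRegular) :
    Nonempty (Bool ↪ Iio κ.ord) := by
  obtain ⟨a, b, hab⟩ := exists_two_lt hκ hreg
  refine ⟨⟨fun i => if i then a else b, fun i j h => ?_⟩⟩
  cases i <;> cases j <;> simp_all [hab.symm]

theorem IsProj.and (hκ : ℵ₀ < κ) (hreg : κ.IsRegular) {P Q : Z → Prop} (hP : IsProj κ P)
    (hQ : IsProj κ Q) : IsProj κ fun z => P z ∧ Q z := by
  obtain ⟨e⟩ := nonempty_bool_embedding hκ hreg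
  refine (IsProj.forall hκ hreg e (P := fun i => if i then P else Q) ?_).congr fun z => ?_
  · rintro (_ | _)
    · exact hQ
    · exact hP
  · simp [and_comm]

theorem IsProj.or (hκ : ℵ₀ < κ) (hreg : κ.IsRegular) {P Q : Z → Prop} (hP : IsProj κ P)
    (hQ : IsProj κ Q) : IsProj κ fun z => P z ∨ Q z := by
  obtain ⟨e⟩ := nonempty_bool_embedding hκ hreg
  refine (IsProj.exists hκ hreg e (P := fun i => if i then P else Q) ?_).congr fun z => ?_
  · rintro (_ | _)
    · exact hQ
    · exact hP
  · simp [or_comm]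

theorem IsBiProj.and (hκ : ℵ₀ < κ) (hreg : κ.IsRegular) {P Q : Z → Prop} (hP : IsBiProj κ P)
    (hQ : IsBiProj κ Q) : IsBiProj κ fun z => P z ∧ Q z :=
  ⟨hP.1.and hκ hreg hQ.1, (hP.2.or hκ hreg hQ.2).congr fun _ => not_and_or⟩

theorem IsBiProj.or (hκ : ℵ₀ < κ) (hreg : κ.IsRegular) {P Q : Z → Prop} (hP : IsBiProj κ P)
    (hQ : IsBiProj κ Q) : IsBiProj κ fun z => P z ∨ Q z :=
  ⟨hP.1.or hκ hreg hQ.1, (hP.2.and hκ hreg hQ.2).congr fun _ => not_or⟩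

theorem IsBiProj.imp (hκ : ℵ₀ < κ) (hreg : κ.IsRegular) {P Q : Z → Prop} (hP : IsBiProj κ P)
    (hQ : IsBiProj κ Q) : IsBiProj κ fun z => P z → Q z := by
  have := hP.not.or hκ hreg hQ
  simpa only [← imp_iff_not_or] using this

theorem IsBiProj.iff (hκ : ℵ₀ < κ) (hreg : κ.IsRegular) {P Q : Z → Prop} (hP : IsBiProj κ P)
    (hQ : IsBiProj κ Q) : IsBiProj κ fun z => P z ↔ Q z := by
  have := (hP.imp hκ hreg hQ).and hκ hreg (hQ.imp hκ hreg hP)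
  simpa only [← iff_iff_implies_and_implies] using this

theorem IsProj.comp {W : Type*} [TopologicalSpace W] {P : Z → Prop} (hP : IsProj κ P) {F : W → Z}
    (hF : Continuous F) : IsProj κ fun w => P (F w) := by
  obtain ⟨C, hC, hPC⟩ := hP
  exact ⟨{x | (F x.1, x.2) ∈ C},
    hC.preimage ((hF.comp continuous_fst).prodMk continuous_snd), fun w => hPC (F w)⟩

theorem IsBiProj.comp {W : Type*} [TopologicalSpace W] {P : Z → Prop} (hP : IsBiProj κ P)
    {F : W → Z} (hF : Continuous F) : IsBiProj κ fun w => P (F w) :=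
  ⟨hP.1.comp hF, hP.2.comp hF⟩

end Topology


/-! ### The isomorphism relation of dense linear orders -/

section Isomorphism

open Set FirstOrder FirstOrder.Language

variable {κ : Cardinal.{u}} (hκ : ℵ₀ < κ) (ar : ℕ → ℕ) (s : ℕ)
  (π : List (Iio κ.ord) ≃ Iio κ.ord)

/-- The binary relation `P_s` coded by `η`. -/
def codedLT (η : Baire κ) (a b : Iio κ.ord) : Prop :=
  (1 : Ordinal.{u}) ≤ (η (π [natElt hκ s, a, b])).1

/-- All relations other than `P_s` coded by `η` are empty. -/
def CodesOnly (η : Baire κ) : Prop :=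
  ∀ m, m ≠ s → ∀ v : Fin (ar m) → Iio κ.ord,
    ¬ (1 : Ordinal.{u}) ≤ (η (π (natElt hκ m :: List.ofFn v))).1

theorem isDenseOrder_iff {X : Type*} (r : X → X → Prop) : IsDenseOrder r ↔
    (∀ a, ¬ r a a) ∧ (∀ a b c, r a b → r b c → r a c) ∧ (∀ a b, r a b ∨ a = b ∨ r b a) ∧
      (∀ a b, r a b → ∃ c, r a c ∧ r c b) ∧ (∀ a, ∃ b, r a b) ∧ ∀ a, ∃ b, r b a :=
  ⟨fun ⟨a, b, c, d, e, f⟩ => ⟨a, b, c, d, e, f⟩, fun ⟨a, b, c, d, e, f⟩ => ⟨a, b, c, d, e, f⟩⟩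

section Axioms

variable {L : FirstOrder.Language.{0, 0}} {M : Type*} [L.Structure M] (r : L.Relations 2)

theorem realize_dloAxioms :
    M ⊨ dloAxioms r ↔ IsDenseOrder fun a b : M => Structure.RelMap r ![a, b] := by
  have h3 : M ⊨ (∀' ∀' (r.boundedFormula₂ (&0) &1 ⊔ (Term.bdEqual (&0) &1 ⊔
      r.boundedFormula₂ (&1) &0)) : L.Sentence) ↔ ∀ a b : M, Structure.RelMap r ![a, b] ∨ a = b ∨
        Structure.RelMap r ![b, a] := by
    simp [Sentence.Realize, Formula.Realize, BoundedFormula.realize_rel₂, Fin.snoc]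
  have h4 : M ⊨ (∀' ∀' (r.boundedFormula₂ (&0) &1 ⟹
      ∃' (r.boundedFormula₂ (&0) &2 ⊓ r.boundedFormula₂ (&2) &1)) : L.Sentence) ↔
      ∀ a b : M, Structure.RelMap r ![a, b] →
        ∃ c, Structure.RelMap r ![a, c] ∧ Structure.RelMap r ![c, b] := by
    simp [Sentence.Realize, Formula.Realize, BoundedFormula.realize_rel₂, Fin.snoc]
  have h5 : M ⊨ (∀' ∃' (r.boundedFormula₂ (&0) &1) : L.Sentence) ↔
      ∀ a : M, ∃ b, Structure.RelMap r ![a, b] := by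
    simp [Sentence.Realize, Formula.Realize, BoundedFormula.realize_rel₂, Fin.snoc]
  have h6 : M ⊨ (∀' ∃' (r.boundedFormula₂ (&1) &0) : L.Sentence) ↔
      ∀ a : M, ∃ b, Structure.RelMap r ![b, a] := by
    simp [Sentence.Realize, Formula.Realize, BoundedFormula.realize_rel₂, Fin.snoc]
  simp only [dloAxioms, Theory.model_iff, mem_insert_iff, mem_singleton_iff, forall_eq_or_imp,
    forall_eq, h3, h4, h5, h6, Relations.realize_irreflexive, Relations.realize_transitive,
    irrefl_def, isTrans_def]
  exact ⟨fun ⟨a, b, c, d, e, f⟩ => ⟨@a, @b, c, d, e, f⟩,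
    fun ⟨a, b, c, d, e, f⟩ => ⟨fun x => a x, fun x y z => b x y z, c, d, e, f⟩⟩

end Axioms

variable {ar s} in
theorem models_DLO_iff (hs : ar s = 2) (η : Baire κ) :
    CodedModel hκ ar π η ⊨ DLO ar s hs ↔
      IsDenseOrder (codedLT hκ s π η) ∧ CodesOnly hκ ar s π η := by
  rw [DLO, Theory.model_union_iff, realize_dloAxioms]
  refine and_congr Iff.rfl ?_
  simp only [Theory.model_iff, mem_ofPred_eq]
  have key : ∀ m, CodedModel hκ ar π η ⊨ (BoundedFormula.alls (∼(Relations.boundedFormula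
      (L := relLang ar) (α := Empty) (n := ar m) (l := ar m) ⟨m, rfl⟩ (fun i => &i))) :
        (relLang ar).Sentence) ↔ ∀ v : Fin (ar m) → Iio κ.ord,
          ¬ (1 : Ordinal.{u}) ≤ (η (π (natElt hκ m :: List.ofFn v))).1 := by
    intro m
    exact BoundedFormula.realize_alls
  constructor
  · intro h m hm
    exact (key m).1 (h _ ⟨m, hm, rfl⟩)
  · rintro h _ ⟨m, hm, rfl⟩
    exact (key m).2 (h m hm)

variable {ar s} in
-- In models of the theory all symbols other than `P_s` are empty, so only the coded order has to be
-- preserved.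
theorem isoRel_iff (hs : ar s = 2) (η ξ : Baire κ) :
    IsoRel hκ ar π (DLO ar s hs) η ξ ↔
      ((IsDenseOrder (codedLT hκ s π η) ∧ CodesOnly hκ ar s π η) ∧
        (IsDenseOrder (codedLT hκ s π ξ) ∧ CodesOnly hκ ar s π ξ) ∧
        ∃ e : Iio κ.ord ≃ Iio κ.ord,
          ∀ a b, codedLT hκ s π η a b ↔ codedLT hκ s π ξ (e a) (e b)) ∨
      (¬ (IsDenseOrder (codedLT hκ s π η) ∧ CodesOnly hκ ar s π η) ∧
        ¬ (IsDenseOrder (codedLT hκ s π ξ) ∧ CodesOnly hκ ar s π ξ)) := by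
  rw [IsoRel, models_DLO_iff, models_DLO_iff]
  refine or_congr (and_congr_right fun hη => and_congr_right fun hξ => ⟨?_, ?_⟩) Iff.rfl
  · rintro ⟨e⟩
    refine ⟨e.toEquiv, fun a b => ?_⟩
    have h := e.map_rel (⟨s, hs⟩ : (relLang ar).Relations 2) ![a, b]
    exact h.symm
  · rintro ⟨e, he⟩
    refine ⟨{ toEquiv := e, map_fun' := fun f => f.elim, map_rel' := ?_ }⟩
    rintro n ⟨m, rfl⟩ x
    by_cases hm : m = s
    · subst hm
      have h2 : ∀ n (hn : n = 2) (y : Fin n → Iio κ.ord),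
          ∃ a b, List.ofFn y = [a, b] ∧ List.ofFn (e ∘ y) = [e a, e b] := by
        rintro n rfl y
        exact ⟨y 0, y 1, rfl, rfl⟩
      obtain ⟨a, b, h3, h4⟩ := h2 _ hs x
      change (1 : Ordinal.{u}) ≤ (ξ (π (natElt hκ m :: List.ofFn (e ∘ x)))).1 ↔
        (1 : Ordinal.{u}) ≤ (η (π (natElt hκ m :: List.ofFn x))).1
      rw [h3, h4]
      exact (he a b).symm
    · exact iff_of_false (hξ.2 m hm _) (hη.2 m hm _)

/-- The isomorphism relation is an equivalence relation. -/
theorem isoRel_equivalence (T : (relLang ar).Theory) : Equivalence (IsoRel hκ ar π T) := by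
  refine ⟨fun η => ?_, fun {η ξ} h => ?_, fun {η ξ ζ} h h' => ?_⟩
  · by_cases h : CodedModel hκ ar π η ⊨ T
    · exact .inl ⟨h, h, ⟨Language.Equiv.refl _ _⟩⟩
    · exact .inr ⟨h, h⟩
  · rcases h with ⟨h1, h2, ⟨e⟩⟩ | ⟨h1, h2⟩
    · exact .inl ⟨h2, h1, ⟨e.symm⟩⟩
    · exact .inr ⟨h2, h1⟩
  · rcases h with ⟨h1, h2, ⟨e⟩⟩ | ⟨h1, h2⟩ <;> rcases h' with ⟨h3, h4, ⟨e'⟩⟩ | ⟨h3, h4⟩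
    · exact .inl ⟨h1, h4, ⟨e'.comp e⟩⟩
    · exact absurd h2 h3
    · exact absurd h3 h2
    · exact .inr ⟨h1, h4⟩

theorem isBiProj_codedLT (hreg : κ.IsRegular) (a b : Iio κ.ord) :
    IsBiProj κ fun η : Baire κ => codedLT hκ s π η a b :=
  have : Nonempty (Iio κ.ord) := ⟨⟨0, hreg.ord_pos⟩⟩
  .of_isClopen ⟨id⟩ (isClopen_coord hκ (π [natElt hκ s, a, b]) {x | (1 : Ordinal.{u}) ≤ x.1})

/-- All quantifiers range over κ, over the natural numbers or over finite tuples from κ, all of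
which embed into κ, and the atomic conditions on η are clopen or constant. -/
theorem isBiProj_model (hreg : κ.IsRegular) :
    IsBiProj κ fun η : Baire κ =>
      IsDenseOrder (codedLT hκ s π η) ∧ CodesOnly hκ ar s π η := by
  have e := Function.Embedding.refl (Iio κ.ord)
  have h := isBiProj_codedLT hκ s π hreg
  have heq : ∀ a b : Iio κ.ord, IsBiProj κ fun _ : Baire κ => a = b := fun a b =>
    .const ⟨id⟩ _
  have h1 : IsBiProj κ fun η : Baire κ => IsDenseOrder (codedLT hκ s π η) := by
    have := (IsBiProj.forall hκ hreg e fun a => (h a a).not).and hκ hreg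
      ((IsBiProj.forall hκ hreg e fun a => .forall hκ hreg e fun b => .forall hκ hreg e fun c =>
        (h a b).imp hκ hreg ((h b c).imp hκ hreg (h a c))).and hκ hreg
      ((IsBiProj.forall hκ hreg e fun a => .forall hκ hreg e fun b =>
        (h a b).or hκ hreg ((heq a b).or hκ hreg (h b a))).and hκ hreg
      ((IsBiProj.forall hκ hreg e fun a => .forall hκ hreg e fun b =>
        (h a b).imp hκ hreg (.exists hκ hreg e fun c => (h a c).and hκ hreg (h c b))).and hκ hreg
      ((IsBiProj.forall hκ hreg e fun a => .exists hκ hreg e fun b => h a b).and hκ hreg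
      (IsBiProj.forall hκ hreg e fun a => .exists hκ hreg e fun b => h b a)))))
    exact ⟨this.1.congr fun η => isDenseOrder_iff _,
      this.2.congr fun η => not_congr (isDenseOrder_iff _)⟩
  refine h1.and hκ hreg ?_
  have eN : ℕ ↪ Iio κ.ord := ⟨fun m => natElt hκ m, fun m n hmn => by
    exact Nat.cast_injective (congrArg Subtype.val hmn : (m : Ordinal.{u}) = n)⟩
  refine .forall hκ hreg eN fun m => ?_
  have hm : IsBiProj κ fun _ : Baire κ => m ≠ s := .const ⟨id⟩ _
  refine hm.imp hκ hreg ?_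
  have eL : (Fin (ar m) → Iio κ.ord) ↪ Iio κ.ord :=
    ⟨fun v => π (List.ofFn v), fun v w hvw => List.ofFn_injective (π.injective hvw)⟩
  refine .forall hκ hreg eL fun v => ?_
  exact (IsBiProj.of_isClopen ⟨id⟩
    (isClopen_coord hκ (π (natElt hκ m :: List.ofFn v)) {x | (1 : Ordinal.{u}) ≤ x.1})).not

variable {ar s} in
/-- The isomorphism relation of dense linear orders is a `Σ¹₁` equivalence relation. -/
theorem isoRel_sigma11 (hreg : κ.IsRegular) (hs : ar s = 2) :
    IsSigma11Equiv (IsoRel hκ ar π (DLO ar s hs)) := by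
  refine ⟨isoRel_equivalence hκ ar π _, ?_⟩
  have e := Function.Embedding.refl (Iio κ.ord)
  have hM := isBiProj_model hκ ar s π hreg
  have hM1 := hM.comp (continuous_fst (X := Baire κ) (Y := Baire κ))
  have hM2 := hM.comp (continuous_snd (X := Baire κ) (Y := Baire κ))
  have hlt := isBiProj_codedLT hκ s π hreg
  have hval : ∀ a c : Iio κ.ord, IsBiProj κ fun x : (Baire κ × Baire κ) × Baire κ => x.2 a = c :=
    fun a c => (IsBiProj.of_isClopen ⟨id⟩ (isClopen_coord hκ a {c})).comp continuous_snd
  -- The isomorphism is the projected point θ. It is described through its graph, since θ a = c is a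
  -- clopen condition, whereas a condition on the order at θ a and θ b is not of the treated form.
  have hE : IsProj κ fun x : Baire κ × Baire κ => ∃ θ : Baire κ,
      (∀ a b, (∃ c, θ a = c ∧ θ b = c) → a = b) ∧ (∀ b, ∃ a, θ a = b) ∧
      ∀ a b c d, θ a = c → θ b = d → (codedLT hκ s π x.1 a b ↔ codedLT hκ s π x.2 c d) := by
    refine IsProj.exists_baire hκ hreg (P := fun x : (Baire κ × Baire κ) × Baire κ =>
      (∀ a b, (∃ c, x.2 a = c ∧ x.2 b = c) → a = b) ∧ (∀ b, ∃ a, x.2 a = b) ∧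
      ∀ a b c d, x.2 a = c → x.2 b = d →
        (codedLT hκ s π x.1.1 a b ↔ codedLT hκ s π x.1.2 c d)) ?_
    refine (IsBiProj.and hκ hreg (.forall hκ hreg e fun a => .forall hκ hreg e fun b =>
      .imp hκ hreg (.exists hκ hreg e fun c => (hval a c).and hκ hreg (hval b c))
        (.const ⟨id⟩ _))
      (.and hκ hreg (.forall hκ hreg e fun b => .exists hκ hreg e fun a => hval a b)
      (.forall hκ hreg e fun a => .forall hκ hreg e fun b => .forall hκ hreg e fun c =>
        .forall hκ hreg e fun d => (hval a c).imp hκ hreg ((hval b d).imp hκ hreg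
        (.iff hκ hreg ((hlt a b).comp (continuous_fst.comp continuous_fst))
          ((hlt c d).comp (continuous_snd.comp continuous_fst))))))).1
  obtain ⟨C, hC, hPC⟩ := (hM1.1.and hκ hreg (hM2.1.and hκ hreg hE)).or hκ hreg
    (hM1.2.and hκ hreg hM2.2)
  refine ⟨{x | ((x.1, x.2.1), x.2.2) ∈ C}, hC.preimage ((continuous_fst.prodMk
    (continuous_fst.comp continuous_snd)).prodMk (continuous_snd.comp continuous_snd)),
    fun η ξ => ?_⟩
  rw [isoRel_iff]
  refine Iff.trans ?_ (hPC (η, ξ))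
  refine or_congr (and_congr_right fun _ => and_congr_right fun _ => ⟨?_, ?_⟩) Iff.rfl
  · rintro ⟨f, hf⟩
    refine ⟨(fun a => f a : Baire κ), fun a b ⟨c, h1, h2⟩ => f.injective (h1.trans h2.symm), f.surjective, ?_⟩
    rintro a b _ _ rfl rfl
    exact hf a b
  · rintro ⟨θ, h1, h2, h3⟩
    exact ⟨Equiv.ofBijective θ ⟨fun a b hab => h1 a b ⟨_, rfl, hab.symm⟩, h2⟩,
      fun a b => h3 a b _ _ rfl rfl⟩

end Isomorphism


/-! ### Formulas over the von Neumann hierarchy -/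

section Formulas

open Set FirstOrder FirstOrder.Language

variable {k l n : ℕ}

/-- `i ∈ j` -/
def memF (i j : Fin n) : (setLang k l).BoundedFormula Empty n :=
  Relations.boundedFormula₂ (L := setLang k l) (SetRel.mem : SetRel k l 2) (&i) (&j)

/-- `i` satisfies the predicate `r` -/
def predF (r : SetRel k l 1) (i : Fin n) : (setLang k l).BoundedFormula Empty n :=
  Relations.boundedFormula₁ (L := setLang k l) r (&i)

/-- `i = j` -/
def eqF (i j : Fin n) : (setLang k l).BoundedFormula Empty n :=
  Term.bdEqual (L := setLang k l) (&i) (&j)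

/-- `i = ∅` -/
def emptyF (i : Fin n) : (setLang k l).BoundedFormula Empty n :=
  ∀' (∼(memF (Fin.last n) i.castSucc))

/-- `p = (a, b)` -/
def pairF (p a b : Fin n) : (setLang k l).BoundedFormula Empty n :=
  ∀' (memF (Fin.last n) p.castSucc ⇔
    ((∀' (memF (Fin.last (n + 1)) (Fin.last n).castSucc ⇔
        eqF (Fin.last (n + 1)) a.castSucc.castSucc)) ⊔
      (∀' (memF (Fin.last (n + 1)) (Fin.last n).castSucc ⇔
        (eqF (Fin.last (n + 1)) a.castSucc.castSucc ⊔
          eqF (Fin.last (n + 1)) b.castSucc.castSucc)))))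

/-- `x = v ∩ r` -/
def interF (r : SetRel k l 1) (x v : Fin n) : (setLang k l).BoundedFormula Empty n :=
  ∀' (memF (Fin.last n) x.castSucc ⇔ (memF (Fin.last n) v.castSucc ⊓ predF r (Fin.last n)))

variable {α : Ordinal.{u}} {A : Set ZFSet.{u}} {X : Fin k → Set (VSet α)} {Y : Fin l → Set (VSet α)}

/-- The interpretation of a predicate. -/
def predSet (A : Set ZFSet.{u}) (X : Fin k → Set (VSet α)) (Y : Fin l → Set (VSet α)) :
    SetRel k l 1 → Set ZFSet.{u}
  | .param => A
  | .allVar i => Subtype.val '' X i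
  | .exVar j => Subtype.val '' Y j

/-- Satisfaction in the structure `(V_α, ∈, A ∩ V_α, X, Y)`. -/
def Sat (A : Set ZFSet.{u}) (X : Fin k → Set (VSet α)) (Y : Fin l → Set (VSet α))
    (φ : (setLang k l).BoundedFormula Empty n) (xs : Fin n → VSet α) : Prop :=
  letI := vStructure α A X Y
  φ.Realize default xs

section Connectives

variable {φ ψ : (setLang k l).BoundedFormula Empty n} {xs : Fin n → VSet α}
  {θ : (setLang k l).BoundedFormula Empty (n + 1)}

@[simp] theorem sat_all : Sat A X Y (∀' θ) xs ↔ ∀ x, Sat A X Y θ (Fin.snoc xs x) := Iff.rfl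

@[simp] theorem sat_ex : Sat A X Y (∃' θ) xs ↔ ∃ x, Sat A X Y θ (Fin.snoc xs x) :=
  letI := vStructure α A X Y
  BoundedFormula.realize_ex

@[simp] theorem sat_inf : Sat A X Y (φ ⊓ ψ) xs ↔ Sat A X Y φ xs ∧ Sat A X Y ψ xs :=
  letI := vStructure α A X Y
  BoundedFormula.realize_inf

@[simp] theorem sat_sup : Sat A X Y (φ ⊔ ψ) xs ↔ Sat A X Y φ xs ∨ Sat A X Y ψ xs :=
  letI := vStructure α A X Y
  BoundedFormula.realize_sup

@[simp] theorem sat_imp : Sat A X Y (φ ⟹ ψ) xs ↔ (Sat A X Y φ xs → Sat A X Y ψ xs) := Iff.rfl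

@[simp] theorem sat_iff : Sat A X Y (φ ⇔ ψ) xs ↔ (Sat A X Y φ xs ↔ Sat A X Y ψ xs) :=
  letI := vStructure α A X Y
  BoundedFormula.realize_iff

@[simp] theorem sat_not : Sat A X Y (∼φ) xs ↔ ¬ Sat A X Y φ xs := Iff.rfl

@[simp] theorem sat_mem {i j : Fin n} :
    Sat A X Y (memF i j) xs ↔ (xs i).1 ∈ (xs j).1 :=
  letI := vStructure α A X Y
  BoundedFormula.realize_rel₂

@[simp] theorem sat_eq {i j : Fin n} : Sat A X Y (eqF i j) xs ↔ xs i = xs j := Iff.rfl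

@[simp] theorem sat_pred {r : SetRel k l 1} {i : Fin n} :
    Sat A X Y (predF r i) xs ↔ (xs i).1 ∈ predSet A X Y r := by
  let := vStructure α A X Y
  refine (BoundedFormula.realize_rel₁ (L := setLang k l) (R := r)).trans ?_
  cases r with
  | param => exact Iff.rfl
  | allVar i =>
    exact ⟨fun h => ⟨_, h, rfl⟩, fun ⟨y, hy, h⟩ => by rw [Subtype.ext h] at hy; exact hy⟩
  | exVar i =>
    exact ⟨fun h => ⟨_, h, rfl⟩, fun ⟨y, hy, h⟩ => by rw [Subtype.ext h] at hy; exact hy⟩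

theorem mem_V_of_mem {x y : ZFSet.{u}} (h : x ∈ y) (hy : y ∈ V_ α) : x ∈ V_ α :=
  ZFSet.isTransitive_vonNeumann α y hy h

@[simp] theorem sat_empty {i : Fin n} : Sat A X Y (emptyF i) xs ↔ (xs i).1 = ∅ := by
  simp only [emptyF, sat_all, sat_not, sat_mem, Fin.snoc_last, Fin.snoc_castSucc]
  rw [ZFSet.eq_empty]
  exact ⟨fun h y hy => h ⟨y, mem_V_of_mem hy (xs i).2⟩ hy, fun h y => h y.1⟩

@[simp] theorem sat_inter {r : SetRel k l 1} {i j : Fin n} : Sat A X Y (interF r i j) xs ↔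
    (xs i).1 = ZFSet.sep (· ∈ predSet A X Y r) (xs j).1 := by
  simp only [interF, sat_all, sat_iff, sat_inf, sat_mem, sat_pred, Fin.snoc_last,
    Fin.snoc_castSucc]
  constructor
  · intro h
    ext y
    rw [ZFSet.mem_sep]
    constructor
    · intro hy
      exact (h ⟨y, mem_V_of_mem hy (xs i).2⟩).1 hy
    · intro hy
      exact (h ⟨y, mem_V_of_mem hy.1 (xs j).2⟩).2 hy
  · intro h y
    rw [h, ZFSet.mem_sep]

theorem pair_mem_V (hα : Order.IsSuccLimit α) {x y : ZFSet.{u}} (hx : x ∈ V_ α) (hy : y ∈ V_ α) :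
    ({x, y} : ZFSet.{u}) ∈ V_ α := by
  rw [ZFSet.mem_vonNeumann] at *
  rw [ZFSet.rank_pair]
  exact max_lt (hα.succ_lt hx) (hα.succ_lt hy)

theorem singleton_mem_V (hα : Order.IsSuccLimit α) {x : ZFSet.{u}} (hx : x ∈ V_ α) :
    ({x} : ZFSet.{u}) ∈ V_ α := by
  rw [← ZFSet.pair_eq_singleton]
  exact pair_mem_V hα hx hx

theorem opair_mem_V (hα : Order.IsSuccLimit α) {x y : ZFSet.{u}} (hx : x ∈ V_ α)
    (hy : y ∈ V_ α) : ZFSet.pair x y ∈ V_ α :=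
  pair_mem_V hα (singleton_mem_V hα hx) (pair_mem_V hα hx hy)

/-- At limit height the singleton and the unordered pair that make up a Kuratowski pair belong to
V_α, so the quantifiers over V_α see them. -/
theorem sat_pair (hα : Order.IsSuccLimit α) {p a b : Fin n} : Sat A X Y (pairF p a b) xs ↔
    (xs p).1 = ZFSet.pair (xs a).1 (xs b).1 := by
  simp only [pairF, sat_all, sat_iff, sat_sup, sat_mem, sat_eq, Fin.snoc_last,
    Fin.snoc_castSucc]
  have h1 : ∀ w : VSet α, (∀ x : VSet α, x.1 ∈ w.1 ↔ x = xs a) ↔ w.1 = {(xs a).1} := by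
    intro w
    constructor
    · intro h
      ext y
      rw [ZFSet.mem_singleton]
      constructor
      · intro hy
        exact congrArg Subtype.val ((h ⟨y, mem_V_of_mem hy w.2⟩).1 hy)
      · rintro rfl
        exact (h _).2 rfl
    · intro h y
      rw [h, ZFSet.mem_singleton, Subtype.ext_iff]
  have h2 : ∀ w : VSet α, (∀ x : VSet α, x.1 ∈ w.1 ↔ x = xs a ∨ x = xs b) ↔
      w.1 = {(xs a).1, (xs b).1} := by
    intro w
    constructor
    · intro h
      ext y
      rw [ZFSet.mem_pair]
      constructor
      · intro hy
        exact ((h ⟨y, mem_V_of_mem hy w.2⟩).1 hy).imp (congrArg Subtype.val)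
          (congrArg Subtype.val)
      · rintro (rfl | rfl)
        · exact (h _).2 (.inl rfl)
        · exact (h _).2 (.inr rfl)
    · intro h y
      rw [h, ZFSet.mem_pair, Subtype.ext_iff, Subtype.ext_iff]
  simp only [h1, h2]
  rw [ZFSet.pair]
  constructor
  · intro h
    ext y
    rw [ZFSet.mem_pair]
    constructor
    · intro hy
      exact (h ⟨y, mem_V_of_mem hy (xs p).2⟩).1 hy
    · rintro (rfl | rfl)
      · exact (h ⟨_, singleton_mem_V hα (xs a).2⟩).2 (.inl rfl)
      · exact (h ⟨_, pair_mem_V hα (xs a).2 (xs b).2⟩).2 (.inr rfl)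
  · intro h y
    rw [h, ZFSet.mem_pair]

end Connectives

/-- The height of the universe is a limit ordinal. -/
def limitF : (setLang k l).Sentence := (∃' eqF (n := 1) 0 0) ⊓ ∀' ∃' memF (n := 2) 0 1

/-- If α is the successor of β, then V_β is a member of V_α that belongs to no member of V_α; for
limit α, every x belongs to {x}. -/
theorem sat_limit {xs : Fin 0 → VSet α} : Sat A X Y limitF xs ↔ Order.IsSuccLimit α := by
  simp only [limitF, sat_inf, sat_ex, sat_all, sat_mem, sat_eq]
  constructor
  · rintro ⟨⟨x, -⟩, h⟩
    refine ⟨?_, ?_⟩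
    · intro hmin
      exact hmin.not_lt (ZFSet.mem_vonNeumann.1 x.2)
    · intro β hβ
      have hβα := hβ.lt
      obtain ⟨y, hy⟩ := h ⟨V_ β, ZFSet.vonNeumann_mem_of_lt hβα⟩
      have h1 := ZFSet.rank_lt_of_mem hy
      have h2 := ZFSet.mem_vonNeumann.1 y.2
      have h3 : β < ZFSet.rank y.1 := by
        simpa [Fin.snoc] using h1
      exact hβ.2 h3 h2
  · intro hα
    refine ⟨⟨⟨V_ 0, ZFSet.vonNeumann_mem_of_lt hα.bot_lt⟩, trivial⟩, fun x => ?_⟩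
    exact ⟨⟨{x.1}, singleton_mem_V hα x.2⟩, by simp [Fin.snoc]⟩

/-- The set `v ∩ X`. -/
noncomputable def cut (X : Set ZFSet.{u}) (v : ZFSet.{u}) : ZFSet.{u} := ZFSet.sep (· ∈ X) v

theorem cut_mem_V {X : Set ZFSet.{u}} {v : ZFSet.{u}} (hv : v ∈ V_ α) : cut X v ∈ V_ α :=
  ZFSet.mem_vonNeumann_of_subset (fun _ hy => (ZFSet.mem_sep.1 hy).1) hv

/-- The code of the approximation of `(X, Y, Z)` on `v`. -/
noncomputable def approx (X Y Z : Set ZFSet.{u}) (v : ZFSet.{u}) : ZFSet.{u} :=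
  ZFSet.pair v (ZFSet.pair (cut X v) (ZFSet.pair (cut Y v) (cut Z v)))

/-- Arbitrarily good approximations of `(X, Y, Z)` in `V_α` belong to `A`. -/
def Track (α : Ordinal.{u}) (A X Y Z : Set ZFSet.{u}) : Prop :=
  ∀ u ∈ V_ α, ∃ v ∈ V_ α, u ∈ v ∧ approx X Y Z v ∈ A

/-- The formula for `Track`. -/
def trackF (r₁ r₂ r₃ : SetRel k l 1) : (setLang k l).Sentence :=
  -- Variable 0 is u and variable 1 is v; 2, 3, 4 are the cuts of the three classes by v, and 5, 6,
  -- 7 are the nested pairs, from the inside out, that build the approximation.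
  ∀' ∃' ∃' ∃' ∃' ∃' ∃' ∃' (memF (n := 8) 0 1 ⊓ (interF r₁ 2 1 ⊓ (interF r₂ 3 1 ⊓
    (interF r₃ 4 1 ⊓ (pairF 5 3 4 ⊓ (pairF 6 2 5 ⊓ (pairF 7 1 6 ⊓ predF .param 7)))))))

theorem sat_track (hα : Order.IsSuccLimit α) {r₁ r₂ r₃ : SetRel k l 1} {xs : Fin 0 → VSet α} :
    Sat A X Y (trackF r₁ r₂ r₃) xs ↔
      Track α A (predSet A X Y r₁) (predSet A X Y r₂) (predSet A X Y r₃) := by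
  simp only [trackF, sat_all, sat_ex, sat_inf, sat_mem, sat_inter, sat_pair hα, sat_pred]
  constructor
  · intro h u hu
    obtain ⟨v, x, y, z, p, q, r, h1, h2, h3, h4, h5, h6, h7, h8⟩ := h ⟨u, hu⟩
    refine ⟨v.1, v.2, h1, ?_⟩
    simp [Fin.snoc] at h2 h3 h4 h5 h6 h7 h8
    rw [h7, h6, h5, h2, h3, h4] at h8
    exact h8
  · intro h u
    obtain ⟨v, hv, huv, hA⟩ := h u.1 u.2
    have h1 := cut_mem_V (X := predSet A X Y r₁) hv
    have h2 := cut_mem_V (X := predSet A X Y r₂) hv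
    have h3 := cut_mem_V (X := predSet A X Y r₃) hv
    have h4 := opair_mem_V hα h2 h3
    have h5 := opair_mem_V hα h1 h4
    exact ⟨⟨v, hv⟩, ⟨_, h1⟩, ⟨_, h2⟩, ⟨_, h3⟩, ⟨_, h4⟩, ⟨_, h5⟩, ⟨_, opair_mem_V hα hv h5⟩,
      huv, rfl, rfl, rfl, rfl, rfl, rfl, hA⟩

end Formulas


/-! ### Reflection -/

section Reflection

open Set FirstOrder FirstOrder.Language

variable {k l n : ℕ} {α : Ordinal.{u}} {A : Set ZFSet.{u}}

theorem satPi12_iff {φ : (setLang k l).Sentence} : SatPi12 α A φ ↔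
    ∀ X : Fin k → Set (VSet α), ∃ Y : Fin l → Set (VSet α), Sat A X Y φ default := Iff.rfl

/-- The formula saying that `r` consists of the `y` with `(y, ∅) ∈ A`. -/
def tagRightF (r : SetRel k l 1) : (setLang k l).Sentence :=
  ∀' (predF (n := 1) r 0 ⇔ ∃' ∃' (emptyF (n := 3) 1 ⊓ (pairF 2 0 1 ⊓ predF .param 2)))

/-- The formula saying that `r` consists of the `y` with `(∅, y) ∈ A`. -/
def tagLeftF (r : SetRel k l 1) : (setLang k l).Sentence :=
  ∀' (predF (n := 1) r 0 ⇔ ∃' ∃' (emptyF (n := 3) 1 ⊓ (pairF 2 1 0 ⊓ predF .param 2)))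

/-- The formula saying that every set belongs to some `v` with `(v, v) ∈ A`. -/
def unboundedF : (setLang k l).Sentence :=
  ∀' ∃' ∃' (memF (n := 3) 0 1 ⊓ (pairF 2 1 1 ⊓ predF .param 2))

/-- The class `X` consists of the `y` with `(y, ∅) ∈ A`. -/
def TagRight (α : Ordinal.{u}) (A X : Set ZFSet.{u}) : Prop :=
  ∀ y ∈ V_ α, y ∈ X ↔ ZFSet.pair y ∅ ∈ A

/-- The class `X` consists of the `y` with `(∅, y) ∈ A`. -/
def TagLeft (α : Ordinal.{u}) (A X : Set ZFSet.{u}) : Prop :=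
  ∀ y ∈ V_ α, y ∈ X ↔ ZFSet.pair ∅ y ∈ A

variable {X : Fin k → Set (VSet α)} {Y : Fin l → Set (VSet α)} {xs : Fin 0 → VSet α}

theorem empty_mem_V (hα : Order.IsSuccLimit α) : (∅ : ZFSet.{u}) ∈ V_ α := by
  rw [ZFSet.mem_vonNeumann, ZFSet.rank_empty]
  exact hα.bot_lt

theorem sat_tagRight (hα : Order.IsSuccLimit α) {r : SetRel k l 1} :
    Sat A X Y (tagRightF r) xs ↔ TagRight α A (predSet A X Y r) := by
  simp only [tagRightF, sat_all, sat_ex, sat_inf, sat_iff, sat_empty, sat_pair hα, sat_pred]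
  constructor
  · intro h y hy
    refine (h ⟨y, hy⟩).trans ⟨?_, fun hA => ?_⟩
    · rintro ⟨e, p, h1, h2, h3⟩
      simp [Fin.snoc] at h1 h2 h3
      rwa [h2, h1] at h3
    · exact ⟨⟨∅, empty_mem_V hα⟩, ⟨_, opair_mem_V hα hy (empty_mem_V hα)⟩, rfl, rfl, hA⟩
  · intro h y
    refine (h y.1 y.2).trans ⟨fun hA => ?_, ?_⟩
    · exact ⟨⟨∅, empty_mem_V hα⟩, ⟨_, opair_mem_V hα y.2 (empty_mem_V hα)⟩, rfl, rfl, hA⟩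
    · rintro ⟨e, p, h1, h2, h3⟩
      simp [Fin.snoc] at h1 h2 h3
      rwa [h2, h1] at h3

theorem sat_tagLeft (hα : Order.IsSuccLimit α) {r : SetRel k l 1} :
    Sat A X Y (tagLeftF r) xs ↔ TagLeft α A (predSet A X Y r) := by
  simp only [tagLeftF, sat_all, sat_ex, sat_inf, sat_iff, sat_empty, sat_pair hα, sat_pred]
  constructor
  · intro h y hy
    refine (h ⟨y, hy⟩).trans ⟨?_, fun hA => ?_⟩
    · rintro ⟨e, p, h1, h2, h3⟩
      simp [Fin.snoc] at h1 h2 h3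
      rwa [h2, h1] at h3
    · exact ⟨⟨∅, empty_mem_V hα⟩, ⟨_, opair_mem_V hα (empty_mem_V hα) hy⟩, rfl, rfl, hA⟩
  · intro h y
    refine (h y.1 y.2).trans ⟨fun hA => ?_, ?_⟩
    · exact ⟨⟨∅, empty_mem_V hα⟩, ⟨_, opair_mem_V hα (empty_mem_V hα) y.2⟩, rfl, rfl, hA⟩
    · rintro ⟨e, p, h1, h2, h3⟩
      simp [Fin.snoc] at h1 h2 h3
      rwa [h2, h1] at h3

theorem sat_unbounded (hα : Order.IsSuccLimit α) : Sat A X Y unboundedF xs ↔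
    ∀ u ∈ V_ α, ∃ v ∈ V_ α, u ∈ v ∧ ZFSet.pair v v ∈ A := by
  simp only [unboundedF, sat_all, sat_ex, sat_inf, sat_mem, sat_pair hα, sat_pred]
  constructor
  · intro h u hu
    obtain ⟨v, p, h1, h2, h3⟩ := h ⟨u, hu⟩
    refine ⟨v.1, v.2, h1, ?_⟩
    simp [Fin.snoc] at h2 h3
    rwa [h2] at h3
  · intro h u
    obtain ⟨v, hv, huv, hA⟩ := h u.1 u.2
    exact ⟨⟨v, hv⟩, ⟨_, opair_mem_V hα hv hv⟩, huv, rfl, hA⟩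

/-- The first order statement that is reflected: `Track` is transitive and symmetric, closure
points are unbounded, and the two tagged classes are not related. -/
structure Reflected (α : Ordinal.{u}) (A : Set ZFSet.{u}) (X : Fin 5 → Set ZFSet.{u})
    (Y : Fin 3 → Set ZFSet.{u}) : Prop where
  -- The classes to be compared are X 0, X 1, X 2; the classes X 3 and X 4 are assumed witnesses and
  -- the Y are the witnesses produced, which gives the form ∀X ∃Y. Reflexivity is required only for
  -- the tagged class, because an arbitrary class need not code a function.
  trans : Track α A (X 0) (X 1) (X 3) → Track α A (X 1) (X 2) (X 4) → Track α A (X 0) (X 2) (Y 0)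
  symm : Track α A (X 0) (X 1) (X 3) → Track α A (X 1) (X 0) (Y 1)
  unbounded : ∀ u ∈ V_ α, ∃ v ∈ V_ α, u ∈ v ∧ ZFSet.pair v v ∈ A
  not_track : TagRight α A (X 0) → TagLeft α A (X 1) → ¬ Track α A (X 0) (X 1) (X 3)
  refl : TagLeft α A (X 1) → Track α A (X 1) (X 1) (Y 2)

/-- The sentence for `Reflected`. -/
def reflectedF : (setLang 5 3).Sentence :=
  limitF ⊓ ((trackF (.allVar 0) (.allVar 1) (.allVar 3) ⟹
      trackF (.allVar 1) (.allVar 2) (.allVar 4) ⟹ trackF (.allVar 0) (.allVar 2) (.exVar 0)) ⊓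
    ((trackF (.allVar 0) (.allVar 1) (.allVar 3) ⟹
        trackF (.allVar 1) (.allVar 0) (.exVar 1)) ⊓
      (unboundedF ⊓ ((tagRightF (.allVar 0) ⟹ tagLeftF (.allVar 1) ⟹
          ∼(trackF (.allVar 0) (.allVar 1) (.allVar 3))) ⊓
        (tagLeftF (.allVar 1) ⟹ trackF (.allVar 1) (.allVar 1) (.exVar 2))))))

theorem sat_reflected {X : Fin 5 → Set (VSet α)} {Y : Fin 3 → Set (VSet α)} :
    Sat A X Y reflectedF xs ↔ Order.IsSuccLimit α ∧
      Reflected α A (fun i => Subtype.val '' X i) (fun i => Subtype.val '' Y i) := by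
  rw [reflectedF, sat_inf, sat_limit]
  refine and_congr_right fun hα => ?_
  simp only [sat_inf, sat_imp, sat_not, sat_track hα, sat_tagLeft hα, sat_tagRight hα,
    sat_unbounded hα, predSet]
  exact ⟨fun ⟨h1, h2, h3, h4, h5⟩ => ⟨h1, h2, h3, h4, h5⟩,
    fun ⟨h1, h2, h3, h4, h5⟩ => ⟨h1, h2, h3, h4, h5⟩⟩

theorem cut_congr {X X' : Set ZFSet.{u}} {v : ZFSet.{u}} (h : ∀ y ∈ v, y ∈ X ↔ y ∈ X') :
    cut X v = cut X' v := by
  ext y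
  simp only [cut, ZFSet.mem_sep]
  exact and_congr_right (h y)

/-- Every v in V_α is a subset of V_α, so the cuts by v see only the parts of the classes inside
V_α. -/
theorem track_congr {X X' Y Y' Z Z' : Set ZFSet.{u}} (hX : ∀ y ∈ V_ α, y ∈ X ↔ y ∈ X')
    (hY : ∀ y ∈ V_ α, y ∈ Y ↔ y ∈ Y') (hZ : ∀ y ∈ V_ α, y ∈ Z ↔ y ∈ Z') :
    Track α A X Y Z ↔ Track α A X' Y' Z' := by
  refine forall₂_congr fun u hu => exists_congr fun v => and_congr_right fun hv => ?_
  rw [approx, approx, cut_congr fun y hy => hX y (mem_V_of_mem hy hv),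
    cut_congr fun y hy => hY y (mem_V_of_mem hy hv), cut_congr fun y hy => hZ y (mem_V_of_mem hy hv)]

theorem Reflected.congr {X X' : Fin 5 → Set ZFSet.{u}} {Y Y' : Fin 3 → Set ZFSet.{u}}
    (h : Reflected α A X Y) (hX : ∀ i, ∀ y ∈ V_ α, y ∈ X' i ↔ y ∈ X i)
    (hY : ∀ i, ∀ y ∈ V_ α, y ∈ Y' i ↔ y ∈ Y i) : Reflected α A X' Y' := by
  have hR : ∀ i, TagRight α A (X' i) → TagRight α A (X i) :=
    fun i h y hy => (hX i y hy).symm.trans (h y hy)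
  have hL : ∀ i, TagLeft α A (X' i) → TagLeft α A (X i) :=
    fun i h y hy => (hX i y hy).symm.trans (h y hy)
  refine ⟨?_, ?_, h.unbounded, ?_, ?_⟩
  · rw [track_congr (hX 0) (hX 1) (hX 3), track_congr (hX 1) (hX 2) (hX 4),
      track_congr (hX 0) (hX 2) (hY 0)]
    exact h.trans
  · rw [track_congr (hX 0) (hX 1) (hX 3), track_congr (hX 1) (hX 0) (hY 1)]
    exact h.symm
  · rw [track_congr (hX 0) (hX 1) (hX 3)]
    exact fun h1 h2 => h.not_track (hR 0 h1) (hL 1 h2)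
  · rw [track_congr (hX 1) (hX 1) (hY 2)]
    exact fun h2 => h.refl (hL 1 h2)

/-- Indescribability for the sentence above, with the second order variables replaced by arbitrary
sets of `ZFSet`s, of which only the trace on V_α counts. The limit height of κ is reflected along.
-/
theorem exists_reflected {κ : Cardinal.{u}} (hind : IsPi12Indescribable κ)
    (hlim : Order.IsSuccLimit κ.ord) (hA : ∀ x ∈ A, x ∈ V_ κ.ord)
    (h : ∀ X : Fin 5 → Set ZFSet.{u}, ∃ Y, Reflected κ.ord A X Y) :
    ∃ α < κ.ord, Order.IsSuccLimit α ∧ ∀ X : Fin 5 → Set ZFSet.{u}, ∃ Y, Reflected α A X Y := by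
  have himg : ∀ (β : Ordinal.{u}) (Z : Set ZFSet.{u}), ∀ y ∈ V_ β,
      y ∈ (Subtype.val '' (Subtype.val ⁻¹' Z : Set (VSet β))) ↔ y ∈ Z := by
    intro β Z y hy
    exact ⟨fun ⟨z, hz, h⟩ => h ▸ hz, fun h => ⟨⟨y, hy⟩, h, rfl⟩⟩
  have hsat : SatPi12 κ.ord A reflectedF := by
    rw [satPi12_iff]
    intro X
    obtain ⟨Y, hY⟩ := h fun i => Subtype.val '' X i
    exact ⟨fun i => Subtype.val ⁻¹' Y i, sat_reflected.2 ⟨hlim,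
      hY.congr (fun _ _ _ => Iff.rfl) fun i => himg _ _⟩⟩
  obtain ⟨α, hα, hs⟩ := hind A hA 5 3 _ hsat
  rw [satPi12_iff] at hs
  refine ⟨α, hα, ?_, fun X => ?_⟩
  · obtain ⟨Y, hY⟩ := hs fun _ => ∅
    exact (sat_reflected.1 hY).1
  · obtain ⟨Y, hY⟩ := hs fun i => Subtype.val ⁻¹' X i
    exact ⟨_, (sat_reflected.1 hY).2.congr (fun i y hy => (himg _ _ y hy).symm)
      fun _ _ _ => Iff.rfl⟩

end Reflection


section SuccLt

open Set FirstOrder FirstOrder.Language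

variable {k l n : ℕ} {α : Ordinal.{u}} {A : Set ZFSet.{u}}

/-- The class `X` is a function that maps the members of `a` cofinally into the universe. -/
def CofinalMap (α : Ordinal.{u}) (X : Set ZFSet.{u}) (a : ZFSet.{u}) : Prop :=
  (∀ w ∈ V_ α, ∀ v ∈ V_ α, ∀ v' ∈ V_ α, ZFSet.pair w v ∈ X → ZFSet.pair w v' ∈ X → v = v') ∧
    ∀ u ∈ V_ α, ∃ w ∈ V_ α, ∃ v ∈ V_ α, w ∈ a ∧ u ∈ v ∧ ZFSet.pair w v ∈ X

/-- The formula for `CofinalMap`. -/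
def cofinalMapF (r : SetRel k l 1) : (setLang k l).BoundedFormula Empty 1 :=
  (∀' ∀' ∀' ((∃' (pairF (n := 5) 4 1 2 ⊓ predF r 4)) ⟹ (∃' (pairF (n := 5) 4 1 3 ⊓ predF r 4)) ⟹
      eqF (n := 4) 2 3)) ⊓
    ∀' ∃' ∃' ∃' (memF (n := 5) 2 0 ⊓ (memF 1 3 ⊓ (pairF 4 2 3 ⊓ predF r 4)))

theorem sat_cofinalMap (hα : Order.IsSuccLimit α) {X : Fin k → Set (VSet α)}
    {Y : Fin l → Set (VSet α)} {xs : Fin 1 → VSet α} {r : SetRel k l 1} :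
    Sat A X Y (cofinalMapF r) xs ↔ CofinalMap α (predSet A X Y r) (xs 0).1 := by
  simp only [cofinalMapF, sat_inf, sat_all, sat_imp, sat_ex, sat_pair hα, sat_pred, sat_mem, sat_eq]
  refine and_congr ⟨fun h w hw v hv v' hv' h1 h2 => ?_, fun h w v v' => ?_⟩
    ⟨fun h u hu => ?_, fun h u => ?_⟩
  · exact congrArg Subtype.val (h ⟨w, hw⟩ ⟨v, hv⟩ ⟨v', hv'⟩ ⟨⟨_, opair_mem_V hα hw hv⟩, rfl, h1⟩
      ⟨⟨_, opair_mem_V hα hw hv'⟩, rfl, h2⟩)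
  · rintro ⟨p, h1, h2⟩ ⟨q, h3, h4⟩
    simp [Fin.snoc] at h1 h2 h3 h4
    rw [h1] at h2
    rw [h3] at h4
    exact Subtype.ext (h w.1 w.2 v.1 v.2 v'.1 v'.2 h2 h4)
  · obtain ⟨w, v, p, h1, h2, h3, h4⟩ := h ⟨u, hu⟩
    simp [Fin.snoc] at h3 h4
    rw [h3] at h4
    exact ⟨w.1, w.2, v.1, v.2, h1, h2, h4⟩
  · obtain ⟨w, hw, v, hv, h1, h2, h3⟩ := h u.1 u.2
    exact ⟨⟨w, hw⟩, ⟨v, hv⟩, ⟨_, opair_mem_V hα hw hv⟩, h1, h2, rfl, h3⟩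

/-- The sentence saying that the universe has limit height and that some member of the parameter
is not mapped cofinally into the universe by the second order variable. -/
def notCofinalF : (setLang 1 0).Sentence :=
  limitF ⊓ ∃' (predF (n := 1) .param 0 ⊓ ∼(cofinalMapF (.allVar 0)))

theorem sat_notCofinal {X : Fin 1 → Set (VSet α)} {Y : Fin 0 → Set (VSet α)}
    {xs : Fin 0 → VSet α} : Sat A X Y notCofinalF xs ↔ Order.IsSuccLimit α ∧
      ∃ a ∈ V_ α, a ∈ A ∧ ¬ CofinalMap α (Subtype.val '' X 0) a := by
  rw [notCofinalF, sat_inf, sat_limit]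
  refine and_congr_right fun hα => ?_
  simp only [sat_ex, sat_inf, sat_not, sat_cofinalMap hα, sat_pred, predSet]
  exact ⟨fun ⟨a, h1, h2⟩ => ⟨a.1, a.2, h1, h2⟩, fun ⟨a, h, h1, h2⟩ => ⟨⟨a, h⟩, h1, h2⟩⟩

/-- The values at the fewer than κ members of μ have ranks bounded by some b < κ, by regularity, so
none of them contains V_b. -/
theorem not_cofinalMap_of_isRegular {κ : Cardinal.{u}} (hreg : κ.IsRegular) {μ : Ordinal.{u}}
    (hμ : μ < κ.ord) (X : Set ZFSet.{u}) : ¬ CofinalMap κ.ord X μ.toZFSet := by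
  classical
  rintro ⟨h1, h2⟩
  have hlim : Order.IsSuccLimit κ.ord := Cardinal.isSuccLimit_ord hreg.aleph0_le
  have : ∀ γ : Iio κ.ord, ∃ b : Iio κ.ord, ∀ v ∈ V_ κ.ord, ZFSet.pair γ.1.toZFSet v ∈ X →
      v.rank ≤ b.1 := by
    intro γ
    by_cases h : ∃ v ∈ V_ κ.ord, ZFSet.pair γ.1.toZFSet v ∈ X
    · obtain ⟨v, hv, hp⟩ := h
      refine ⟨⟨v.rank, ZFSet.mem_vonNeumann.1 hv⟩, fun v' hv' hp' => ?_⟩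
      rw [h1 _ (ZFSet.mem_vonNeumann.2 (by rw [Ordinal.rank_toZFSet]; exact γ.2)) v' hv' v hv hp' hp]
    · push Not at h
      exact ⟨γ, fun v hv hp => (h v hv hp).elim⟩
  choose f hf using this
  obtain ⟨b, hb⟩ := exists_gt_Iio hreg ⟨μ, hμ⟩ f
  obtain ⟨w, -, v, hv, hw, huv, hp⟩ := h2 (V_ b.1) (ZFSet.vonNeumann_mem_of_lt b.2)
  obtain ⟨γ, hγ, rfl⟩ := Ordinal.mem_toZFSet_iff.1 hw
  have h3 := hf ⟨γ, hγ.trans hμ⟩ v hv hp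
  have h4 := ZFSet.rank_lt_of_mem huv
  rw [ZFSet.rank_vonNeumann] at h4
  exact (h4.trans_le h3).not_gt (hb ⟨γ, hγ.trans hμ⟩ hγ)

/-- Compose a surjection g of μ onto α with the map from β to V_β. -/
theorem exists_cofinalMap {μ : Ordinal.{u}} (hα : Order.IsSuccLimit α) (hμ : μ < α)
    (h : α.card ≤ μ.card) : ∃ X : Set ZFSet.{u}, CofinalMap α X μ.toZFSet := by
  have h0 : Nonempty (Iio α) := ⟨⟨μ, hμ⟩⟩
  have hle : #(Iio α) ≤ #(Iio μ) := by
    rw [Cardinal.mk_Iio_ordinal, Cardinal.mk_Iio_ordinal]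
    exact Cardinal.lift_le.2 h
  obtain ⟨e⟩ := hle
  have : ∃ g : Iio μ → Iio α, Function.Surjective g :=
    ⟨Function.invFun e, Function.invFun_surjective e.injective⟩
  obtain ⟨g, hg⟩ := this
  refine ⟨range fun γ : Iio μ => ZFSet.pair γ.1.toZFSet (V_ (g γ).1), ?_, ?_⟩
  · rintro w - v - v' - ⟨γ, h1⟩ ⟨δ, h2⟩
    obtain ⟨h1, h3⟩ := ZFSet.pair_inj.1 h1
    obtain ⟨h2, h4⟩ := ZFSet.pair_inj.1 h2
    have : γ = δ := Subtype.ext (Ordinal.toZFSet_injective (h1.trans h2.symm))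
    rw [← h3, ← h4, this]
  · intro u hu
    rw [ZFSet.mem_vonNeumann] at hu
    obtain ⟨γ, hγ⟩ := hg ⟨Order.succ u.rank, hα.succ_lt hu⟩
    refine ⟨γ.1.toZFSet, ?_, V_ (g γ).1, ZFSet.vonNeumann_mem_of_lt (g γ).2,
      Ordinal.mem_toZFSet_iff.2 ⟨_, γ.2, rfl⟩, ?_, γ, rfl⟩
    · rw [ZFSet.mem_vonNeumann, Ordinal.rank_toZFSet]
      exact lt_trans γ.2 hμ
    · rw [hγ, ZFSet.mem_vonNeumann]
      exact Order.lt_succ _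

/-- Suppose that κ is the successor of μ. By regularity no class maps μ cofinally into V_κ. With {μ}
as parameter this reflects to a limit α with μ < α < κ; but α has cardinality at most μ, so a
cofinal map exists there. -/
theorem IsPi12Indescribable.succ_lt {κ : Cardinal.{u}} (hind : IsPi12Indescribable κ)
    (hreg : κ.IsRegular) {μ : Cardinal.{u}} (hμ : μ < κ) : Order.succ μ < κ := by
  refine (Order.succ_le_of_lt hμ).lt_of_ne fun heq => ?_
  have hlim : Order.IsSuccLimit κ.ord := Cardinal.isSuccLimit_ord hreg.aleph0_le
  have hμ' : μ.ord < κ.ord := Cardinal.ord_lt_ord.2 hμ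
  have hmem : ∀ {β : Ordinal.{u}}, μ.ord.toZFSet ∈ V_ β ↔ μ.ord < β := by
    intro β
    rw [ZFSet.mem_vonNeumann, Ordinal.rank_toZFSet]
  obtain ⟨α, hα, hs⟩ := hind {μ.ord.toZFSet} (by rintro _ rfl; exact hmem.2 hμ') 1 0 notCofinalF
    (satPi12_iff.2 fun X => ⟨fun i => i.elim0, sat_notCofinal.2 ⟨hlim, _, hmem.2 hμ', rfl,
      not_cofinalMap_of_isRegular hreg hμ' _⟩⟩)
  rw [satPi12_iff] at hs
  obtain ⟨Y, hY⟩ := hs fun _ => ∅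
  have hαl := (sat_notCofinal.1 hY).1
  obtain ⟨a, ha, rfl, -⟩ := (sat_notCofinal.1 hY).2
  have hμα := hmem.1 ha
  obtain ⟨X, hX⟩ := exists_cofinalMap hαl hμα (by
    rw [Cardinal.card_ord, ← Order.lt_succ_iff, heq]
    exact Cardinal.lt_ord.1 hα)
  obtain ⟨Y, hY⟩ := hs fun _ => Subtype.val ⁻¹' X
  obtain ⟨a, ha, rfl, h⟩ := (sat_notCofinal.1 hY).2
  refine h ⟨?_, ?_⟩
  · rintro w hw v hv v' hv' ⟨p, hp, hp'⟩ ⟨q, hq, hq'⟩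
    exact hX.1 w hw v hv v' hv' (hp' ▸ hp) (hq' ▸ hq)
  · intro u hu
    obtain ⟨w, hw, v, hv, h1, h2, h3⟩ := hX.2 u hu
    exact ⟨w, hw, v, hv, h1, h2, ⟨_, opair_mem_V hαl hw hv⟩, h3, rfl⟩

end SuccLt


/-! ### Coding relations by subsets of the von Neumann hierarchy -/

section Coding

open Set

variable {κ : Cardinal.{u}} {l : Ordinal.{u}} {α : Ordinal.{u}}

theorem opair_ne_empty (x y : ZFSet.{u}) : ZFSet.pair x y ≠ ∅ := by
  intro h
  have : ({x} : ZFSet.{u}) ∈ ZFSet.pair x y := ZFSet.mem_pair.2 (.inl rfl)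
  rw [h] at this
  exact ZFSet.notMem_empty _ this

theorem empty_notMem_opair (x y : ZFSet.{u}) : ∅ ∉ ZFSet.pair x y := by
  intro h
  rcases ZFSet.mem_pair.1 h with h | h
  · exact ZFSet.notMem_empty x (h ▸ ZFSet.mem_singleton.2 rfl)
  · exact ZFSet.notMem_empty x (h ▸ ZFSet.mem_pair.2 (.inl rfl))

theorem vonNeumann_ne_opair (x y : ZFSet.{u}) (hα : α ≠ 0) : V_ α ≠ ZFSet.pair x y := by
  intro h
  refine empty_notMem_opair x y (h ▸ ZFSet.mem_vonNeumann.2 ?_)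
  rw [ZFSet.rank_empty]
  exact pos_iff_ne_zero.2 hα

theorem vonNeumann_ne_empty (hα : α ≠ 0) : V_ α ≠ ∅ := by
  intro h
  have := ZFSet.rank_vonNeumann α
  rw [h, ZFSet.rank_empty] at this
  exact hα this.symm

theorem opair_mem_V_iff (hα : Order.IsSuccLimit α) {x y : ZFSet.{u}} :
    ZFSet.pair x y ∈ V_ α ↔ x ∈ V_ α ∧ y ∈ V_ α := by
  refine ⟨fun h => ?_, fun h => opair_mem_V hα h.1 h.2⟩
  have h1 : ({x, y} : ZFSet.{u}) ∈ V_ α := mem_V_of_mem (ZFSet.mem_pair.2 (.inr rfl)) h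
  exact ⟨mem_V_of_mem (ZFSet.mem_pair.2 (.inl rfl)) h1,
    mem_V_of_mem (ZFSet.mem_pair.2 (.inr rfl)) h1⟩

theorem toZFSet_mem_V {β : Ordinal.{u}} : β.toZFSet ∈ V_ α ↔ β < α := by
  rw [ZFSet.mem_vonNeumann, Ordinal.rank_toZFSet]

/-- The code of an element of a generalized Baire space as a subset of `V_κ`. -/
def enc (η : GenSpace κ l) : Set ZFSet.{u} :=
  {y | ∃ β : Iio κ.ord, y = ZFSet.pair β.1.toZFSet (η β).1.toZFSet}

theorem opair_mem_enc {η : GenSpace κ l} {β : Iio κ.ord} {x : Ordinal.{u}} :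
    ZFSet.pair β.1.toZFSet x.toZFSet ∈ enc η ↔ (η β).1 = x := by
  constructor
  · rintro ⟨γ, h⟩
    obtain ⟨h1, h2⟩ := ZFSet.pair_inj.1 h
    have h3 : β = γ := Subtype.ext (Ordinal.toZFSet_injective h1)
    rw [h3, Ordinal.toZFSet_injective h2]
  · rintro rfl
    exact ⟨β, rfl⟩

theorem empty_notMem_enc (η : GenSpace κ l) : ∅ ∉ enc η :=
  fun ⟨_, h⟩ => opair_ne_empty _ _ h.symm

theorem enc_subset_V (hlim : Order.IsSuccLimit κ.ord) (hl : l ≤ κ.ord) (η : GenSpace κ l) :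
    ∀ y ∈ enc η, y ∈ V_ κ.ord := by
  rintro _ ⟨β, rfl⟩
  exact opair_mem_V hlim (toZFSet_mem_V.2 β.2) (toZFSet_mem_V.2 (lt_of_lt_of_le (η β).2 hl))

theorem enc_congr (hα : Order.IsSuccLimit α) {η ξ : GenSpace κ l}
    (h : ∀ β : Iio κ.ord, β.1 < α → η β = ξ β) : ∀ y ∈ V_ α, y ∈ enc η ↔ y ∈ enc ξ := by
  intro y hy
  constructor
  · rintro ⟨β, rfl⟩
    exact ⟨β, by rw [h β (toZFSet_mem_V.1 ((opair_mem_V_iff hα).1 hy).1)]⟩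
  · rintro ⟨β, rfl⟩
    exact ⟨β, by rw [h β (toZFSet_mem_V.1 ((opair_mem_V_iff hα).1 hy).1)]⟩

theorem eq_of_enc (hα : Order.IsSuccLimit α) {η ξ : GenSpace κ l}
    (hη : ∀ β : Iio κ.ord, β.1 < α → (η β).1 < α) (h : ∀ y ∈ V_ α, y ∈ enc η → y ∈ enc ξ) :
    ∀ β : Iio κ.ord, β.1 < α → η β = ξ β := by
  intro β hβ
  exact Subtype.ext (opair_mem_enc.1 (h _
    (opair_mem_V hα (toZFSet_mem_V.2 hβ) (toZFSet_mem_V.2 (hη β hβ))) ⟨β, rfl⟩)).symm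

theorem enc_injective (hlim : Order.IsSuccLimit κ.ord) (hl : l ≤ κ.ord) {η ξ : GenSpace κ l}
    (h : ∀ y ∈ V_ κ.ord, y ∈ enc η → y ∈ enc ξ) : η = ξ :=
  funext fun β => eq_of_enc hlim (fun β _ => lt_of_lt_of_le (η β).2 hl) h β β.2

theorem mem_cut {X : Set ZFSet.{u}} {v y : ZFSet.{u}} : y ∈ cut X v ↔ y ∈ v ∧ y ∈ X :=
  ZFSet.mem_sep

theorem cut_eq_iff {X X' : Set ZFSet.{u}} {v : ZFSet.{u}} :
    cut X v = cut X' v ↔ ∀ y ∈ v, y ∈ X ↔ y ∈ X' := by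
  refine ⟨fun h y hy => ?_, cut_congr⟩
  have : y ∈ cut X v ↔ y ∈ cut X' v := by rw [h]
  simpa only [mem_cut, hy, true_and] using this

/-- A class that is locally the code of a function is the code of a function. -/
theorem exists_enc_of_local (X : Set ZFSet.{u}) (d : Iio κ.ord → Iio κ.ord) (hd : ∀ γ, γ < d γ)
    (hdl : ∀ γ, Order.IsSuccLimit (d γ).1) (η : Iio κ.ord → GenSpace κ l)
    (hη : ∀ γ, ∀ β < d γ, (η γ β).1 < (d γ).1)
    (hX : ∀ γ, ∀ y ∈ V_ (d γ).1, y ∈ X ↔ y ∈ enc (η γ)) :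
    ∃ ζ : GenSpace κ l, (∀ γ, ∀ β < d γ, ζ β = η γ β) ∧ ∀ y ∈ V_ κ.ord, y ∈ X ↔ y ∈ enc ζ := by
  have key : ∀ γ γ', d γ ≤ d γ' → ∀ β < d γ, η γ β = η γ' β := by
    intro γ γ' hle β hβ
    refine eq_of_enc (hdl γ) (fun β hβ => hη γ β hβ) (fun y hy hyη => ?_) β hβ
    exact (hX γ' y (ZFSet.vonNeumann_subset_of_le hle hy)).1 ((hX γ y hy).2 hyη)
  have hζ : ∀ γ, ∀ β < d γ, η β β = η γ β := by
    intro γ β hβ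
    rcases le_total (d γ) (d β) with h | h
    · exact (key γ β h β hβ).symm
    · exact key β γ h β (hd β)
  -- The value at β is read from the local function chosen for β, which is correct there since β < d
  -- β; any two local functions agree on their common domain.
  refine ⟨fun β => η β β, hζ, fun y hy => ?_⟩
  let γ : Iio κ.ord := ⟨y.rank, ZFSet.mem_vonNeumann.1 hy⟩
  have hyγ : y ∈ V_ (d γ).1 := ZFSet.mem_vonNeumann.2 (hd γ)
  rw [hX γ y hyγ]
  exact enc_congr (hdl γ) (fun β hβ => (hζ γ β hβ).symm) y hyγ

variable {C : Set (GenSpace κ l × GenSpace κ l × Baire κ)}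

/-- `δ` is a limit ordinal that is closed under the three functions. -/
structure ClosedAt (δ : Iio κ.ord) (p : GenSpace κ l × GenSpace κ l × Baire κ) : Prop where
  -- These conditions put the codes of all pairs (β, value at β) with β < δ into V_δ, so the codes
  -- cut to V_δ determine the restrictions to δ.
  limit : Order.IsSuccLimit δ.1
  fst : ∀ β < δ, (p.1 β).1 < δ.1
  snd : ∀ β < δ, (p.2.1 β).1 < δ.1
  thd : ∀ β < δ, (p.2.2 β).1 < δ.1

/-- The codes of the approximations of the elements of `C`. -/
def approxSet (C : Set (GenSpace κ l × GenSpace κ l × Baire κ)) : Set ZFSet.{u} :=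
  {y | ∃ p ∈ C, ∃ δ, ClosedAt δ p ∧ y = approx (enc p.1) (enc p.2.1) (enc p.2.2) (V_ δ.1)}

theorem exists_closedAt (hκ : ℵ₀ < κ) (hreg : κ.IsRegular) (hl : l ≤ κ.ord)
    (p : GenSpace κ l × GenSpace κ l × Baire κ) (β : Iio κ.ord) : ∃ δ > β, ClosedAt δ p := by
  have := noMaxOrder_Iio_ord hκ
  let a (γ : Iio κ.ord) : Iio κ.ord := ⟨(p.1 γ).1, lt_of_lt_of_le (p.1 γ).2 hl⟩
  let b (γ : Iio κ.ord) : Iio κ.ord := ⟨(p.2.1 γ).1, lt_of_lt_of_le (p.2.1 γ).2 hl⟩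
  have hs : ∀ γ : Iio κ.ord, Order.succ γ.1 < κ.ord := fun γ =>
    (Cardinal.isSuccLimit_ord hreg.aleph0_le).succ_lt γ.2
  -- The successor function is included so that the closure point is a limit.
  obtain ⟨δ, hδ, h⟩ := exists_closure_point hκ hreg
    (fun γ => max (max (a γ) (b γ)) (max (p.2.2 γ) ⟨_, hs γ⟩)) β
  simp only [max_lt_iff] at h
  refine ⟨δ, hδ, ⟨?_, ?_⟩, fun γ hγ => (h γ hγ).1.1, fun γ hγ => (h γ hγ).1.2,
    fun γ hγ => (h γ hγ).2.1⟩
  · intro hm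
    exact hm.not_lt hδ
  · intro x hx
    have hx' := hx.lt
    exact hx.2 (Order.lt_succ x) (h ⟨x, hx'.trans δ.2⟩ hx').2.2

theorem track_enc {p : GenSpace κ l × GenSpace κ l × Baire κ} (hp : p ∈ C) (hα : α ≤ κ.ord)
    (h : ∀ γ : Iio κ.ord, γ.1 < α → ∃ δ > γ, δ.1 < α ∧ ClosedAt δ p) :
    Track α (approxSet C) (enc p.1) (enc p.2.1) (enc p.2.2) := by
  intro x hx
  rw [ZFSet.mem_vonNeumann] at hx
  obtain ⟨δ, hδ, hδα, hcl⟩ := h ⟨x.rank, hx.trans_le hα⟩ hx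
  exact ⟨V_ δ.1, ZFSet.vonNeumann_mem_of_lt hδα, ZFSet.mem_vonNeumann.2 hδ, p, hp, δ, hcl, rfl⟩

theorem approx_inj {X Y Z X' Y' Z' : Set ZFSet.{u}} {v v' : ZFSet.{u}}
    (h : approx X Y Z v = approx X' Y' Z' v') : v = v' ∧ (∀ y ∈ v, y ∈ X ↔ y ∈ X') ∧
      (∀ y ∈ v, y ∈ Y ↔ y ∈ Y') ∧ ∀ y ∈ v, y ∈ Z ↔ y ∈ Z' := by
  obtain ⟨rfl, h⟩ := ZFSet.pair_inj.1 h
  obtain ⟨h1, h⟩ := ZFSet.pair_inj.1 h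
  obtain ⟨h2, h3⟩ := ZFSet.pair_inj.1 h
  exact ⟨rfl, cut_eq_iff.1 h1, cut_eq_iff.1 h2, cut_eq_iff.1 h3⟩

/-- The approximations make the three classes locally codes of points of C at unboundedly many
heights. The local pieces glue to a triple every neighbourhood of which meets C, and C is closed. -/
theorem exists_of_track (hlim : Order.IsSuccLimit κ.ord) (hC : IsClosed C)
    {X Y Z : Set ZFSet.{u}} (h : Track κ.ord (approxSet C) X Y Z) :
    ∃ p ∈ C, (∀ y ∈ V_ κ.ord, y ∈ X ↔ y ∈ enc p.1) ∧ (∀ y ∈ V_ κ.ord, y ∈ Y ↔ y ∈ enc p.2.1) := by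
  have : Nonempty (Iio κ.ord) := ⟨⟨0, hlim.bot_lt⟩⟩
  have step : ∀ γ : Iio κ.ord, ∃ δ > γ, ∃ p ∈ C, ClosedAt δ p ∧
      (∀ y ∈ V_ δ.1, y ∈ X ↔ y ∈ enc p.1) ∧ (∀ y ∈ V_ δ.1, y ∈ Y ↔ y ∈ enc p.2.1) ∧
      ∀ y ∈ V_ δ.1, y ∈ Z ↔ y ∈ enc p.2.2 := by
    intro γ
    obtain ⟨v, hv, hγ, p, hp, δ, hδ, heq⟩ := h (V_ γ.1) (ZFSet.vonNeumann_mem_of_lt γ.2)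
    obtain ⟨rfl, h1, h2, h3⟩ := approx_inj heq
    refine ⟨δ, ?_, p, hp, hδ, h1, h2, h3⟩
    have := ZFSet.mem_vonNeumann.1 hγ
    rwa [ZFSet.rank_vonNeumann] at this
  choose d hd p hp hcl hX hY hZ using step
  obtain ⟨η, hη, hη'⟩ := exists_enc_of_local X d hd (fun γ => (hcl γ).limit)
    (fun γ => (p γ).1) (fun γ => (hcl γ).fst) hX
  obtain ⟨ξ, hξ, hξ'⟩ := exists_enc_of_local Y d hd (fun γ => (hcl γ).limit)
    (fun γ => (p γ).2.1) (fun γ => (hcl γ).snd) hY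
  obtain ⟨θ, hθ, -⟩ := exists_enc_of_local Z d hd (fun γ => (hcl γ).limit)
    (fun γ => (p γ).2.2) (fun γ => (hcl γ).thd) hZ
  refine ⟨(η, ξ, θ), ?_, hη', hξ'⟩
  by_contra hmem
  obtain ⟨U, W, hU, hW, hηU, hW', hUW⟩ := isOpen_prod_iff.1 hC.isOpen_compl η (ξ, θ) hmem
  obtain ⟨W1, W2, hW1, hW2, hξW, hθW, hWW⟩ := isOpen_prod_iff.1 hW ξ θ hW'
  obtain ⟨a, ha⟩ := exists_cyl_subset hU hηU
  obtain ⟨b, hb⟩ := exists_cyl_subset hW1 hξW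
  obtain ⟨c, hc⟩ := exists_cyl_subset hW2 hθW
  let γ := max a (max b c)
  refine hUW (a := p γ) ⟨ha ?_, hWW ⟨hb ?_, hc ?_⟩⟩ (hp γ)
  · exact fun β hβ => (hη γ β ((hβ.trans_le (le_max_left _ _)).trans (hd γ))).symm
  · exact fun β hβ => (hξ γ β ((hβ.trans_le
      ((le_max_left _ _).trans (le_max_right _ _))).trans (hd γ))).symm
  · exact fun β hβ => (hθ γ β ((hβ.trans_le
      ((le_max_right _ _).trans (le_max_right _ _))).trans (hd γ))).symm

/-- The relation on subsets of `V_α` that approximates the projection of `C`. -/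
def LocalRel (C : Set (GenSpace κ l × GenSpace κ l × Baire κ)) (α : Ordinal.{u})
    (X Y : Set ZFSet.{u}) : Prop :=
  ∃ Z, Track α (approxSet C) X Y Z

theorem localRel_congr {X X' Y Y' : Set ZFSet.{u}} (hX : ∀ y ∈ V_ α, y ∈ X ↔ y ∈ X')
    (hY : ∀ y ∈ V_ α, y ∈ Y ↔ y ∈ Y') : LocalRel C α X Y ↔ LocalRel C α X' Y' :=
  exists_congr fun _ => track_congr hX hY fun _ _ => Iff.rfl

/-- At height κ the local relation is E transported to codes, and holds between nothing else. This
is what makes it symmetric and transitive on all classes. -/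
theorem localRel_iff (hκ : ℵ₀ < κ) (hreg : κ.IsRegular) (hl : l ≤ κ.ord) (hC : IsClosed C)
    {E : GenSpace κ l → GenSpace κ l → Prop} (hE : ∀ η ξ, E η ξ ↔ ∃ θ : Baire κ, (η, ξ, θ) ∈ C)
    {X Y : Set ZFSet.{u}} : LocalRel C κ.ord X Y ↔ ∃ η ξ, E η ξ ∧
      (∀ y ∈ V_ κ.ord, y ∈ X ↔ y ∈ enc η) ∧ ∀ y ∈ V_ κ.ord, y ∈ Y ↔ y ∈ enc ξ := by
  have hlim : Order.IsSuccLimit κ.ord := Cardinal.isSuccLimit_ord hreg.aleph0_le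
  constructor
  · rintro ⟨Z, hZ⟩
    obtain ⟨p, hp, h1, h2⟩ := exists_of_track hlim hC hZ
    exact ⟨p.1, p.2.1, (hE _ _).2 ⟨p.2.2, hp⟩, h1, h2⟩
  · rintro ⟨η, ξ, h, hX, hY⟩
    obtain ⟨θ, hθ⟩ := (hE _ _).1 h
    refine (localRel_congr hX hY).2 ⟨enc θ, track_enc (p := (η, ξ, θ)) hθ le_rfl fun γ _ => ?_⟩
    obtain ⟨δ, h1, h2⟩ := exists_closedAt hκ hreg hl (η, ξ, θ) γ
    exact ⟨δ, h1, δ.2, h2⟩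

end Coding


/-! ### Local classes and the reduction to equality on a club -/

section LocalClass

open Set

variable {κ : Cardinal.{u}} {l : Ordinal.{u}} {α : Ordinal.{u}}
  {C : Set (GenSpace κ l × GenSpace κ l × Baire κ)}

/-- The relation `LocalRel` on subsets of `V_α` is symmetric and transitive. -/
structure IsGood (C : Set (GenSpace κ l × GenSpace κ l × Baire κ)) (α : Ordinal.{u}) : Prop where
  limit : Order.IsSuccLimit α
  symm : ∀ X Y, LocalRel C α X Y → LocalRel C α Y X
  trans : ∀ X Y Z, LocalRel C α X Y → LocalRel C α Y Z → LocalRel C α X Z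

/-- The class of `η` under `LocalRel`, if this relation is symmetric and transitive. -/
def localClass (C : Set (GenSpace κ l × GenSpace κ l × Baire κ)) (α : Ordinal.{u})
    (η : GenSpace κ l) : Set (GenSpace κ l) :=
  {ζ | IsGood C α ∧ LocalRel C α (enc η) (enc ζ)}

/-- This default makes the local classes of all functions equal at ordinals that are not limits, in
particular at successors, where the sums of blocks need agreement. -/
theorem localClass_of_not_isGood (h : ¬ IsGood C α) (η : GenSpace κ l) :
    localClass C α η = ∅ :=
  eq_empty_of_forall_notMem fun _ hζ => h hζ.1

theorem localClass_congr {η ξ : GenSpace κ l} (h : ∀ β : Iio κ.ord, β.1 < α → η β = ξ β) :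
    localClass C α η = localClass C α ξ := by
  ext ζ
  exact and_congr_right fun hg =>
    localRel_congr (enc_congr hg.limit h) fun _ _ => Iff.rfl

theorem localClass_eq_of_localRel {η ξ : GenSpace κ l}
    (h : IsGood C α → LocalRel C α (enc η) (enc ξ)) : localClass C α η = localClass C α ξ := by
  ext ζ
  refine and_congr_right fun hg => ⟨fun h' => ?_, fun h' => ?_⟩
  · exact hg.trans _ _ _ (hg.symm _ _ (h hg)) h'
  · exact hg.trans _ _ _ (h hg) h'

/-- A function that depends only on a proper initial segment of its argument has at most `κ`
values. -/
theorem exists_code (hpow : κ ^< κ = κ) (hl : l ≤ κ.ord) (a : Iio κ.ord) {T : Type (u + 1)}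
    (g : GenSpace κ l → T) (hg : ∀ η ξ : GenSpace κ l, (∀ β < a, η β = ξ β) → g η = g ξ) :
    ∃ c : GenSpace κ l → Iio κ.ord, ∀ η ξ, c η = c ξ ↔ g η = g ξ := by
  have h1 : #(range g) ≤ #(Iio a → Iio l) := by
    refine ⟨⟨fun t β => t.2.choose β.1, ?_⟩⟩
    intro s t hst
    refine Subtype.ext (s.2.choose_spec.symm.trans (Eq.trans ?_ t.2.choose_spec))
    exact hg _ _ fun β hβ => congrFun hst ⟨β, hβ⟩
  obtain ⟨e⟩ := h1.trans (mk_pi_Iio_le hpow hl (Iio a) (mk_Iio_lt_mk a))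
  exact ⟨fun η => e ⟨g η, η, rfl⟩, fun η ξ => e.injective.eq_iff.trans Subtype.ext_iff⟩

/-- The parameter that codes `C`, two elements of the space and a closed unbounded set. -/
def codeParam (C : Set (GenSpace κ l × GenSpace κ l × Baire κ)) (η ξ : GenSpace κ l)
    (h : Iio κ.ord → Iio κ.ord) : Set ZFSet.{u} :=
  {y | y ∈ approxSet C ∨ (∃ z ∈ enc η, y = ZFSet.pair z ∅) ∨ (∃ z ∈ enc ξ, y = ZFSet.pair ∅ z) ∨
    ∃ δ : Iio κ.ord, δ.1 ≠ 0 ∧ (∀ γ < δ, h γ < δ) ∧ y = ZFSet.pair (V_ δ.1) (V_ δ.1)}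

variable {η ξ : GenSpace κ l} {h : Iio κ.ord → Iio κ.ord}

theorem exists_of_mem_approxSet {y : ZFSet.{u}} (hy : y ∈ approxSet C) :
    ∃ (δ : Iio κ.ord) (x z : ZFSet.{u}), δ.1 ≠ 0 ∧ y = ZFSet.pair (V_ δ.1) (ZFSet.pair x z) := by
  obtain ⟨p, -, δ, hδ, rfl⟩ := hy
  exact ⟨δ, _, _, hδ.limit.bot_lt.ne', rfl⟩

/-- The kinds of codes do not interfere. An approximation at a nonempty v has an ordered pair as
second component, whereas tagged elements have ∅ in one component and the club is coded by pairs
(V_δ, V_δ) with δ ≠ 0. Such a V_δ contains ∅, which no ordered pair does. -/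
theorem approx_mem_codeParam {X Y Z : Set ZFSet.{u}} {v w : ZFSet.{u}} (hv : w ∈ v) :
    approx X Y Z v ∈ codeParam C η ξ h ↔ approx X Y Z v ∈ approxSet C := by
  refine ⟨?_, .inl⟩
  rintro (h1 | ⟨z, -, h1⟩ | ⟨z, -, h1⟩ | ⟨δ, hδ, -, h1⟩)
  · exact h1
  · exact (opair_ne_empty _ _ (ZFSet.pair_inj.1 h1).2).elim
  · exact (ZFSet.notMem_empty w ((ZFSet.pair_inj.1 h1).1 ▸ hv)).elim
  · exact (vonNeumann_ne_opair _ _ hδ (ZFSet.pair_inj.1 h1).2.symm).elim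

theorem track_codeParam {X Y Z : Set ZFSet.{u}} :
    Track α (codeParam C η ξ h) X Y Z ↔ Track α (approxSet C) X Y Z :=
  forall₂_congr fun _ _ => exists_congr fun _ => and_congr_right fun _ =>
    and_congr_right fun hv => approx_mem_codeParam hv

theorem pair_empty_mem_codeParam {y : ZFSet.{u}} :
    ZFSet.pair y ∅ ∈ codeParam C η ξ h ↔ y ∈ enc η := by
  refine ⟨?_, fun hy => .inr (.inl ⟨y, hy, rfl⟩)⟩
  rintro (h1 | ⟨z, hz, h1⟩ | ⟨z, hz, h1⟩ | ⟨δ, hδ, -, h1⟩)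
  · obtain ⟨δ, x, z, -, h1⟩ := exists_of_mem_approxSet h1
    exact (opair_ne_empty _ _ (ZFSet.pair_inj.1 h1).2.symm).elim
  · rwa [(ZFSet.pair_inj.1 h1).1]
  · exact (empty_notMem_enc ξ ((ZFSet.pair_inj.1 h1).2 ▸ hz)).elim
  · exact (vonNeumann_ne_empty hδ (ZFSet.pair_inj.1 h1).2.symm).elim

theorem empty_pair_mem_codeParam {y : ZFSet.{u}} :
    ZFSet.pair ∅ y ∈ codeParam C η ξ h ↔ y ∈ enc ξ := by
  refine ⟨?_, fun hy => .inr (.inr (.inl ⟨y, hy, rfl⟩))⟩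
  rintro (h1 | ⟨z, hz, h1⟩ | ⟨z, hz, h1⟩ | ⟨δ, hδ, -, h1⟩)
  · obtain ⟨δ, x, z, hδ, h1⟩ := exists_of_mem_approxSet h1
    exact (vonNeumann_ne_empty hδ (ZFSet.pair_inj.1 h1).1.symm).elim
  · exact (empty_notMem_enc η ((ZFSet.pair_inj.1 h1).1 ▸ hz)).elim
  · rwa [(ZFSet.pair_inj.1 h1).2]
  · exact (vonNeumann_ne_empty hδ (ZFSet.pair_inj.1 h1).1.symm).elim

theorem pair_self_mem_codeParam {v w : ZFSet.{u}} (hw : w ∈ v) :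
    ZFSet.pair v v ∈ codeParam C η ξ h ↔ ∃ δ : Iio κ.ord, (∀ γ < δ, h γ < δ) ∧ v = V_ δ.1 := by
  constructor
  · rintro (h1 | ⟨z, hz, h1⟩ | ⟨z, hz, h1⟩ | ⟨δ, -, hδ, h1⟩)
    · obtain ⟨δ, x, z, hδ, h1⟩ := exists_of_mem_approxSet h1
      exact (vonNeumann_ne_opair _ _ hδ
        ((ZFSet.pair_inj.1 h1).1.symm.trans (ZFSet.pair_inj.1 h1).2)).elim
    · exact (ZFSet.notMem_empty w ((ZFSet.pair_inj.1 h1).2 ▸ hw)).elim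
    · exact (ZFSet.notMem_empty w ((ZFSet.pair_inj.1 h1).1 ▸ hw)).elim
    · exact ⟨δ, hδ, (ZFSet.pair_inj.1 h1).1⟩
  · rintro ⟨δ, hδ, rfl⟩
    refine .inr (.inr (.inr ⟨δ, ?_, hδ, rfl⟩))
    intro h0
    rw [h0, ZFSet.vonNeumann_zero] at hw
    exact ZFSet.notMem_empty w hw

theorem codeParam_subset_V (hlim : Order.IsSuccLimit κ.ord) (hl : l ≤ κ.ord) :
    ∀ y ∈ codeParam C η ξ h, y ∈ V_ κ.ord := by
  rintro _ (⟨p, -, δ, -, rfl⟩ | ⟨z, hz, rfl⟩ | ⟨z, hz, rfl⟩ | ⟨δ, -, -, rfl⟩)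
  · have hδ := ZFSet.vonNeumann_mem_of_lt δ.2
    exact opair_mem_V hlim hδ (opair_mem_V hlim (cut_mem_V hδ)
      (opair_mem_V hlim (cut_mem_V hδ) (cut_mem_V hδ)))
  · exact opair_mem_V hlim (enc_subset_V hlim hl η z hz) (empty_mem_V hlim)
  · exact opair_mem_V hlim (empty_mem_V hlim) (enc_subset_V hlim hl ξ z hz)
  · have hδ := ZFSet.vonNeumann_mem_of_lt δ.2
    exact opair_mem_V hlim hδ hδ

/-- At height κ the relation tracked is E on codes, so the clauses express that E is an equivalence
relation not relating η to ξ, and that closure points of h are unbounded. -/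
theorem exists_reflected_codeParam (hκ : ℵ₀ < κ) (hreg : κ.IsRegular) (hl : l ≤ κ.ord)
    (hC : IsClosed C) {E : GenSpace κ l → GenSpace κ l → Prop} (hequiv : Equivalence E)
    (hE : ∀ η ξ, E η ξ ↔ ∃ θ : Baire κ, (η, ξ, θ) ∈ C) (hne : ¬ E η ξ)
    (X : Fin 5 → Set ZFSet.{u}) : ∃ Y, Reflected κ.ord (codeParam C η ξ h) X Y := by
  have hlim : Order.IsSuccLimit κ.ord := Cardinal.isSuccLimit_ord hreg.aleph0_le
  -- A witness is chosen for every pair of classes, with an arbitrary value if they are unrelated,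
  -- so that the Y can be given before the premises of the clauses are known.
  have hw : ∀ X Y : Set ZFSet.{u}, ∃ Z, LocalRel C κ.ord X Y →
      Track κ.ord (codeParam C η ξ h) X Y Z := by
    intro X Y
    by_cases hr : LocalRel C κ.ord X Y
    · obtain ⟨Z, hZ⟩ := hr
      exact ⟨Z, fun _ => track_codeParam.2 hZ⟩
    · exact ⟨∅, fun h => (hr h).elim⟩
  choose W hW using hw
  have hrel : ∀ {X Y Z : Set ZFSet.{u}}, Track κ.ord (codeParam C η ξ h) X Y Z →
      ∃ η ξ, E η ξ ∧ (∀ y ∈ V_ κ.ord, y ∈ X ↔ y ∈ enc η) ∧ ∀ y ∈ V_ κ.ord, y ∈ Y ↔ y ∈ enc ξ :=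
    fun h => (localRel_iff hκ hreg hl hC hE).1 ⟨_, track_codeParam.1 h⟩
  have hinj : ∀ {X : Set ZFSet.{u}} {η ξ : GenSpace κ l}, (∀ y ∈ V_ κ.ord, y ∈ X ↔ y ∈ enc η) →
      (∀ y ∈ V_ κ.ord, y ∈ X ↔ y ∈ enc ξ) → η = ξ :=
    fun h1 h2 => enc_injective hlim hl fun y hy => ((h1 y hy).symm.trans (h2 y hy)).1
  refine ⟨![W (X 0) (X 2), W (X 1) (X 0), W (X 1) (X 1)], ?_, ?_, ?_, ?_, ?_⟩
  · intro h1 h2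
    obtain ⟨a, b, hab, ha, hb⟩ := hrel h1
    obtain ⟨b', c, hbc, hb', hc⟩ := hrel h2
    rw [← hinj hb hb'] at hbc
    exact hW _ _ ((localRel_iff hκ hreg hl hC hE).2 ⟨a, c, hequiv.trans hab hbc, ha, hc⟩)
  · intro h1
    obtain ⟨a, b, hab, ha, hb⟩ := hrel h1
    exact hW _ _ ((localRel_iff hκ hreg hl hC hE).2 ⟨b, a, hequiv.symm hab, hb, ha⟩)
  · intro x hx
    obtain ⟨δ, hδ, hδh⟩ := exists_closure_point hκ hreg h ⟨x.rank, ZFSet.mem_vonNeumann.1 hx⟩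
    have hxδ : x ∈ V_ δ.1 := ZFSet.mem_vonNeumann.2 hδ
    exact ⟨V_ δ.1, ZFSet.vonNeumann_mem_of_lt δ.2, hxδ,
      (pair_self_mem_codeParam hxδ).2 ⟨δ, hδh, rfl⟩⟩
  · intro hR hL h1
    obtain ⟨a, b, hab, ha, hb⟩ := hrel h1
    have h2 : a = η := hinj ha fun y hy => (hR y hy).trans pair_empty_mem_codeParam
    have h3 : b = ξ := hinj hb fun y hy => (hL y hy).trans empty_pair_mem_codeParam
    exact hne (h2 ▸ h3 ▸ hab)
  · intro hL
    have h3 := fun y hy => (hL y hy).trans empty_pair_mem_codeParam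
    exact hW _ _ ((localRel_iff hκ hreg hl hC hE).2 ⟨ξ, ξ, hequiv.refl ξ, h3, h3⟩)

/-- Elements that are not related have different local classes at some closure point. -/
theorem exists_localClass_ne (hκ : ℵ₀ < κ) (hreg : κ.IsRegular)
    (hind : IsPi12Indescribable κ) (hl : l ≤ κ.ord) (hC : IsClosed C)
    {E : GenSpace κ l → GenSpace κ l → Prop} (hequiv : Equivalence E)
    (hE : ∀ η ξ, E η ξ ↔ ∃ θ : Baire κ, (η, ξ, θ) ∈ C) (hne : ¬ E η ξ)
    (h : Iio κ.ord → Iio κ.ord) : ∃ δ : Iio κ.ord, Order.IsSuccLimit δ.1 ∧ (∀ γ < δ, h γ < δ) ∧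
      localClass C δ.1 η ≠ localClass C δ.1 ξ := by
  have hlim : Order.IsSuccLimit κ.ord := Cardinal.isSuccLimit_ord hreg.aleph0_le
  obtain ⟨α, hα, hαl, hs⟩ := exists_reflected hind hlim (codeParam_subset_V hlim hl)
    (exists_reflected_codeParam (h := h) hκ hreg hl hC hequiv hE hne)
  -- The reflected statement holds for all classes, so the given classes and witnesses are inserted
  -- and the slots that play no role are filled with ∅.
  have hgood : IsGood C α := by
    refine ⟨hαl, ?_, ?_⟩
    · rintro X Y ⟨Z, hZ⟩
      obtain ⟨W, hW⟩ := hs ![X, Y, ∅, Z, ∅]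
      exact ⟨_, track_codeParam.1 (hW.symm (track_codeParam.2 hZ))⟩
    · rintro X Y Y' ⟨Z, hZ⟩ ⟨Z', hZ'⟩
      obtain ⟨W, hW⟩ := hs ![X, Y, Y', Z, Z']
      exact ⟨_, track_codeParam.1 (hW.trans (track_codeParam.2 hZ) (track_codeParam.2 hZ'))⟩
  refine ⟨⟨α, hα⟩, hαl, fun γ hγ => ?_, fun heq => ?_⟩
  -- The coded V_δ for closure points δ of h are unbounded in V_α, so α is a limit of closure points
  -- and hence one itself.
  · obtain ⟨W, hW⟩ := hs fun _ => ∅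
    obtain ⟨v, hv, hγv, hA⟩ := hW.unbounded (V_ γ.1) (ZFSet.vonNeumann_mem_of_lt hγ)
    obtain ⟨δ, hδ, rfl⟩ := (pair_self_mem_codeParam hγv).1 hA
    exact (hδ γ (ZFSet.vonNeumann_mem_vonNeumann_iff.1 hγv)).trans
      (ZFSet.vonNeumann_mem_vonNeumann_iff.1 hv)
  · have hR : TagRight α (codeParam C η ξ h) (enc η) := fun y _ => pair_empty_mem_codeParam.symm
    have hL : TagLeft α (codeParam C η ξ h) (enc ξ) := fun y _ => empty_pair_mem_codeParam.symm
    -- The two classes differ at ξ, which lies in its own class by the reflected instance of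
    -- reflexivity, but not in that of η.
    obtain ⟨W, hW⟩ := hs ![∅, enc ξ, ∅, ∅, ∅]
    have h1 : ξ ∈ localClass C α ξ := ⟨hgood, _, track_codeParam.1 (hW.refl hL)⟩
    rw [← heq] at h1
    obtain ⟨-, Z, hZ⟩ := h1
    obtain ⟨W, hW⟩ := hs ![enc η, enc ξ, ∅, Z, ∅]
    exact hW.not_track hR hL (track_codeParam.2 hZ)

/-- Every `Σ¹₁` equivalence relation reduces to equality on a closed unbounded set. -/
theorem exists_reduction_club (hκ : ℵ₀ < κ) (hpow : κ ^< κ = κ) (hreg : κ.IsRegular)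
    (hind : IsPi12Indescribable κ) (hl : l ≤ κ.ord) {E : GenSpace κ l → GenSpace κ l → Prop}
    (hE : IsSigma11Equiv E) : ∃ F : GenSpace κ l → Iio κ.ord → Iio κ.ord,
      (∀ η ξ δ, (∀ β < δ, η β = ξ β) → F η δ = F ξ δ) ∧
      (∀ η ξ δ, (∃ γ < δ, ∀ β < δ, β ≤ γ) → F η δ = F ξ δ) ∧
      (∀ η ξ, E η ξ → ∃ h : Iio κ.ord → Iio κ.ord, ∀ δ, (∀ γ < δ, h γ < δ) → F η δ = F ξ δ) ∧
      ∀ η ξ, (∃ h : Iio κ.ord → Iio κ.ord, ∀ δ, (∀ γ < δ, h γ < δ) →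
        (∀ γ < δ, ∃ β < δ, γ < β) → F η δ = F ξ δ) → E η ξ := by
  obtain ⟨hequiv, C, hC, hEC⟩ := hE
  -- The local class at δ depends only on the restriction to δ, so there are at most κ such classes
  -- and they can be named by ordinals below κ.
  have hcode := fun δ : Iio κ.ord => exists_code hpow hl δ (localClass C δ.1)
    fun η ξ h => localClass_congr fun β hβ => h β hβ
  choose c hc using hcode
  refine ⟨fun η δ => c δ η, fun η ξ δ h => (hc δ η ξ).2 (localClass_congr fun β hβ => h β hβ),
    ?_, ?_, ?_⟩
  · rintro η ξ δ ⟨γ, hγ, hmax⟩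
    have : ¬ IsGood C δ.1 := fun hg => by
      have h1 := hg.limit.succ_lt hγ
      exact (Order.lt_succ γ.1).not_ge (hmax ⟨_, h1.trans δ.2⟩ h1)
    exact (hc δ η ξ).2 (by rw [localClass_of_not_isGood this, localClass_of_not_isGood this])
  · intro η ξ h
    obtain ⟨θ, hθ⟩ := (hEC _ _).1 h
    -- Since f γ > γ is closed under the triple, closed points are unbounded in every closure point
    -- of f, and the code of θ is a local witness there.
    choose f hf hcl using exists_closedAt hκ hreg hl (η, ξ, θ)
    refine ⟨f, fun δ hδ => (hc δ η ξ).2 (localClass_eq_of_localRel fun _ => ⟨enc θ, ?_⟩)⟩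
    exact track_enc (p := (η, ξ, θ)) hθ δ.2.le fun γ hγ => ⟨f γ, hf γ, hδ γ hγ, hcl γ⟩
  · rintro η ξ ⟨h, hh⟩
    by_contra hne
    obtain ⟨δ, hδ, hδh, hd⟩ := exists_localClass_ne hκ hreg hind hl hC hequiv hEC hne h
    refine hd ((hc δ η ξ).1 (hh δ hδh fun γ hγ => ?_))
    have h1 := hδ.succ_lt hγ
    exact ⟨⟨_, h1.trans δ.2⟩, h1, Order.lt_succ γ.1⟩

end LocalClass


/-! ### Coding orders in κ^κ and hardness of the isomorphism relation -/

section Completeness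

open Set

variable {κ : Cardinal.{u}} (hκ : ℵ₀ < κ) (ar : ℕ → ℕ) (s : ℕ)
  (π : List (Iio κ.ord) ≃ Iio κ.ord)

open Classical in
/-- The code of a binary relation on `κ`, as the interpretation of the symbol `P_s`. -/
noncomputable def relCode (r : Iio κ.ord → Iio κ.ord → Prop) : Baire κ := fun i =>
  if ∃ a b, π.symm i = [natElt hκ s, a, b] ∧ r a b then natElt hκ 1 else natElt hκ 0

theorem one_le_relCode (r : Iio κ.ord → Iio κ.ord → Prop) (i : Iio κ.ord) :
    (1 : Ordinal.{u}) ≤ (relCode hκ s π r i).1 ↔ ∃ a b, π.symm i = [natElt hκ s, a, b] ∧ r a b := by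
  rw [relCode]
  split_ifs with h
  · simpa [natElt] using h
  · simpa [natElt] using h

theorem codedLT_relCode (r : Iio κ.ord → Iio κ.ord → Prop) (a b : Iio κ.ord) :
    codedLT hκ s π (relCode hκ s π r) a b ↔ r a b := by
  rw [codedLT, one_le_relCode, Equiv.symm_apply_apply]
  constructor
  · rintro ⟨a', b', h, hr⟩
    simp only [List.cons.injEq, and_true, true_and] at h
    rwa [h.1, h.2]
  · exact fun h => ⟨a, b, rfl, h⟩

theorem natElt_injective : Function.Injective (natElt hκ) := fun m n h => by
  simpa [natElt] using congrArg Subtype.val h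

theorem codesOnly_relCode (r : Iio κ.ord → Iio κ.ord → Prop) :
    CodesOnly hκ ar s π (relCode hκ s π r) := by
  intro m hm v
  rw [one_le_relCode, Equiv.symm_apply_apply]
  rintro ⟨a, b, h, -⟩
  exact hm (natElt_injective hκ (List.cons.inj h).1)

theorem isoRel_relCode (hs : ar s = 2) {r r' : Iio κ.ord → Iio κ.ord → Prop} (hr : IsDenseOrder r)
    (hr' : IsDenseOrder r') :
    IsoRel hκ ar π (DLO ar s hs) (relCode hκ s π r) (relCode hκ s π r') ↔
      ∃ e : Iio κ.ord ≃ Iio κ.ord, ∀ a b, r a b ↔ r' (e a) (e b) := by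
  have h : ∀ r, codedLT hκ s π (relCode hκ s π r) = r := fun r =>
    funext₂ fun a b => propext (codedLT_relCode hκ s π r a b)
  rw [isoRel_iff, h, h]
  constructor
  · rintro (h | h)
    · exact h.2.2
    · exact (h.1 ⟨hr, codesOnly_relCode hκ ar s π r⟩).elim
  · exact fun h => .inl ⟨⟨hr, codesOnly_relCode hκ ar s π r⟩,
      ⟨hr', codesOnly_relCode hκ ar s π r'⟩, h⟩

/-- Fewer than κ coordinates of the value depend on a bounded part of the argument, because κ is
regular. -/
theorem continuous_of_local (hreg : κ.IsRegular) {l : Ordinal.{u}} {f : GenSpace κ l → Baire κ}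
    (h : ∀ i, ∃ δ : Iio κ.ord, ∀ η ξ : GenSpace κ l, (∀ β < δ, η β = ξ β) → f η i = f ξ i) :
    Continuous f := by
  choose d hd using h
  refine continuous_to_genSpace fun η α => ?_
  obtain ⟨b, hb⟩ := exists_gt_Iio hreg α d
  refine Filter.mem_of_superset ((isOpen_cyl η b).mem_nhds (self_mem_cyl η b)) fun ξ hξ i hi => ?_
  exact hd i ξ η fun β hβ => hξ β (hβ.trans (hb i hi))

/-- The reduction is the composition of the map to equality on a club with the family of dense
orders; the agreement at successors needed for isomorphism is built into the first map. -/
theorem isoRel_DLO_hard (hpow : κ ^< κ = κ) (hind : IsPi12Indescribable κ) (hs : ar s = 2)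
    {l : Ordinal.{u}} (hl : l ≤ κ.ord) (hl2 : 2 ≤ l) {E : GenSpace κ l → GenSpace κ l → Prop}
    (hE : IsSigma11Equiv E) : BorelReducible E (IsoRel hκ ar π (DLO ar s hs)) := by
  have hreg := isRegular_of_powerlt hκ hpow
  obtain ⟨F, hF1, hF2, hF3, hF4⟩ := exists_reduction_club hκ hpow hreg hind hl hE
  obtain ⟨R, hR1, hR2, hR3, hR4⟩ := exists_dense_orders hκ hpow fun μ hμ => hind.succ_lt hreg hμ
  refine ⟨fun η => relCode hκ s π (R (F η)), fun U hU => ?_, fun η ξ => ?_⟩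
  · refine .of_isOpen hκ hpow hl hl2 (hU.preimage (continuous_of_local hreg fun i => ?_))
    -- Coordinate i of the code records at most one comparison of some a with some b. This depends
    -- on a single value F η δ, and hence on the restriction of η to δ.
    by_cases h : ∃ a b, π.symm i = [natElt hκ s, a, b]
    · obtain ⟨a, b, hab⟩ := h
      obtain ⟨δ, hδ⟩ := hR2 a b
      refine ⟨δ, fun η ξ h => ?_⟩
      have key : (∃ a b, π.symm i = [natElt hκ s, a, b] ∧ R (F η) a b) ↔
          ∃ a b, π.symm i = [natElt hκ s, a, b] ∧ R (F ξ) a b := by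
        refine exists_congr fun a' => exists_congr fun b' => and_congr_right fun h' => ?_
        rw [hab] at h'
        simp only [List.cons.injEq, and_true, true_and] at h'
        rw [← h'.1, ← h'.2]
        exact hδ _ _ (hF1 η ξ δ h)
      by_cases hη : ∃ a b, π.symm i = [natElt hκ s, a, b] ∧ R (F η) a b
      · rw [relCode, relCode, if_pos hη, if_pos (key.1 hη)]
      · rw [relCode, relCode, if_neg hη, if_neg (mt key.2 hη)]
    · refine ⟨i, fun η ξ _ => ?_⟩
      have key : ∀ η, ¬ ∃ a b, π.symm i = [natElt hκ s, a, b] ∧ R (F η) a b :=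
        fun η ⟨a, b, hab, _⟩ => h ⟨a, b, hab⟩
      rw [relCode, relCode, if_neg (key η), if_neg (key ξ)]
  · rw [isoRel_relCode hκ ar s π hs (hR1 _) (hR1 _)]
    constructor
    · intro h
      obtain ⟨f, hf⟩ := hF3 η ξ h
      exact hR3 _ _ f hf fun δ hδ => hF2 η ξ δ hδ
    · exact fun h => hF4 η ξ (hR4 _ _ h)

end Completeness

end GDST

theorem theorem3p9 (κ : Cardinal.{u}) (hκ : ℵ₀ < κ) (hpow : κ ^< κ = κ)
    (hind : GDST.IsPi12Indescribable κ)
    (ar : ℕ → ℕ) (s : ℕ) (hs : ar s = 2)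
    (π : List (Set.Iio κ.ord) ≃ Set.Iio κ.ord) :
    GDST.IsSigma11Complete (GDST.IsoRel hκ ar π (GDST.DLO ar s hs)) := by
  have hω : Ordinal.omega0 ≤ κ.ord := Cardinal.omega0_le_ord.2 hκ.le
  have h2 : (2 : Ordinal.{u}) ≤ κ.ord := (Ordinal.natCast_lt_omega0 2).le.trans hω
  refine ⟨GDST.isoRel_sigma11 hκ π (GDST.isRegular_of_powerlt hκ hpow) hs, ?_⟩
  rintro l (rfl | rfl) E hE
  · exact GDST.isoRel_DLO_hard hκ ar s π hpow hind hs h2 le_rfl hE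
  · exact GDST.isoRel_DLO_hard hκ ar s π hpow hind hs le_rfl h2 hE
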